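/- **Setting.** A *block* is a single adjoint particle $g$ (then $l=r=g$) or $\mathsf B=(l,\mathsf B_{1},\dots,\mathsf B_{s},r)$, a fundamental/anti-fundamental ($\mathfrak f$-$\mathfrak{af}$) pair enclosing $s\ge 0$ blocks, $\mathrm{sub}[\mathsf B]=\{\mathsf B_1,\dots,\mathsf B_s\}$; all pairs have distinct flavors. Let $\alpha=[\mathsf B_1,\mathsf B_2,\dots,\mathsf B_m]$ be an ordering of $n$ particles, labelled $1,\dots,n$ by position, with $m\ge 3$, $\mathsf B_1=(1,2)$, and $\mathsf B_2$ an $\mathfrak f$-$\mathfrak{af}$ block (so $l_2=3$, and $X_{3,l_3}$ is a planar variable); the other blocks are arbitrary. The planar variables $X_{i,j}=(p_i+\dots+p_{j-1})^2$ are indexed by the diagonals of the $n$-gon ($X_{i,i+1}=0$, $n+1\equiv1$). With flavor symbols $f(l)=f_r$, $f(r)=-f_r$ for a pair of flavor $f_r$ and $f(g)=0$, $X_{i,j}$ is *allowed* if $\sum_{i\le s<j}f(s)$ is $0$ or a single term $\pm f_r$. $A_n[\alpha]=\sum_T\prod_{(i,j)\in T}1/X_{i,j}$, over all triangulations $T$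 of the $n$-gon by allowed diagonals; amplitudes of sub-polygons are defined in the same way. The subspace $H_n[\alpha]$ is given by $X_{i,j}=b_{i,j}$ for the diagonals that are not allowed, together with $-s_{I,J}=c_{I,J}$ for the following pairs, where $s_{I,J}=(p_I+p_J)^2$ and $b,c$ are constants: on adding a block $\mathsf B_k$ to $[\mathsf B_1,\dots,\mathsf B_{k-1}]$, one imposes (i) the constraints with $J=\mathsf B_k$ and $I$ any of $l_i$, $r_i$, $\mathsf I\in\mathrm{sub}[\mathsf B_i]$, $i<k$, except $I=l_1$ and $I=r_{k-1}$; if $\mathsf B_k$ is an $\mathfrak f$-$\mathfrak{af}$ block, also (ii) $s_{\mathsf B_i,r_k}$ for $2\le i<k$; and, if it has sub-blocks, also (iii) $s_{l_k,r_k}$, $s_{\mathsf I,r_k}$ for all sub-blocks $\mathsf I$ of $\mathsf B_k$ but the last, $s_{\mathsf B_i,\mathsf I}$ for $2\le i<k$ and all $\mathsf I\in\mathrm{sub}[\mathsf B_k]$, and (iv) recursively the constraints of $[(-L_k,l_k),\mathsf B_{k_1},\dots,\mathsf B_{k_s}]$, where $L_k$ is the total momentum of $\mathsf B_k$ without $r_k$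 (so that the first block has right particle $l_k$). For real positive $b,c$ the open associahedron $\mathcal A_n[\alpha]$ is the part of $H_n[\alpha]$ where all $X_{i,j}\ge0$. The preferred planar basis is $Y=f[(1,2),\mathsf B_2,\dots,\mathsf B_m]$ with $$f[(l_1,r_1),\mathsf B_2,\dots,\mathsf B_m]=\bigcup_{i=1}^m\{X_{l_i,l_{i+1}},X_{l_i,r_i}\}\cup\bigcup_{i=4}^m\{X_{l_2,l_i}\}\cup\bigcup_{i=2}^m f[(r_i,l_i),\mathsf B_{i_1},\dots,\mathsf B_{i_s}],$$ where $l_{m+1}=l_1$, pairs of equal or neighbouring indices are dropped, and adjoint particles and adjacent pairs contribute nothing to the last union. Let $F=F^{(1)}\cup F^{(2)}\cup F^{(3)}$, again dropping pairs of neighbouring indices, with $$F^{(1)}=\{X_{3,l_3},X_{2,l_3}\}\cup\{X_{3,r_i}:i\ge3,\ \mathsf B_i\text{ an }\mathfrak f\text{-}\mathfrak{af}\text{ block}\},\qquad F^{(2)}=\{X_{r_2,l_i}: i\ne 2\},$$ $$F^{(3)}=\{X_{l_{\mathsf I},l_3}:\mathsf I\in\mathrm{sub}[\mathsf B_2]\}\cup\{X_{3,l_{\mathsf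 I}}:\mathsf I\in\mathrm{sub}[\mathsf B_i],\ i\ge3\},$$ and $\lambda=1$ on $F^{(1)}$, $\lambda=-1$ on $F^{(2)}$, $\lambda=1$ on the first part of $F^{(3)}$, and $\lambda=s-\ell+2$ on $X_{3,l_{\mathsf I}}$ if $\mathsf I$ is the $\ell$-th of the $s$ sub-blocks of $\mathsf B_i$, $i\ge 3$. **Theorem.** Let the variables and constants take values in a field of characteristic $0$ (unless stated otherwise). 1. $Y$ consists of $n-3$ allowed planar variables and contains $X_{3,l_3}$; for all constants $b,c$ and all values of the variables in $Y$ there is exactly one point of $H_n[\alpha]$ with these values. Hence the shift $X_{3,l_3}\to zX_{3,l_3}$, with the rest of $Y$ and $b,c$ fixed, defines $\hat X(z)\in H_n[\alpha]$ for every $X\in H_n[\alpha]$. 2. All elements of $F$ are allowed, $X_{3,l_3}\in F$, and $F$ is exactly the set of allowed variables that are deformed: $\lambda_d\neq0$ and $\hat X_d(z)=X_d-\lambda_d(1-z)X_{3,l_3}$ for $d\in F$, and $\hat X_d(z)=X_d$ for allowed $d\notin F$. With $z_d=1-\frac{X_d}{\lambda_dX_{3,l_3}}$ one has $\hat X_e(z_d)=X_e-\frac{\lambda_e}{\lambda_d}X_d$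 for $d,e\in F$ (if $X_{3,l_3}\ne 0$). 3. On $H_n[\alpha]$, $$A_n=\sum_{d\in F}\Big(\frac1{X_d}-\frac1{\lambda_dX_{3,l_3}}\Big)\hat A_L(z_d)\,\hat A_R(z_d),$$ where $\hat A_{L}(z_d)$, $\hat A_R(z_d)$ are the amplitudes of the two sub-polygons into which the diagonal $d$ cuts the $n$-gon, evaluated at $\hat X(z_d)$. The identity holds wherever all allowed $X_d$ are non-zero and $\hat X_e(z_d)\ne0$ for all distinct non-crossing $d,e\in F$ with $d\ne(3,l_3)$. 4. Over $\mathbb C$, at every point of $H_n[\alpha]$ where all allowed $X_d$ are non-zero, $z\,A_n[\hat X(z)]\to0$ as $z\to\infty$, and $\frac{z}{z-1}A_n[\hat X(z)]$ has residue $0$ at infinity. 5. Let $T\subseteq\{\text{allowed}\}\setminus F$ have $n-4$ elements. If $T$ is pairwise non-crossing and $d\in F$ crosses no element of $T$, then there is $e\in F$, $e\ne d$, that crosses no element of $T$, and $\lambda_e=-\lambda_d$. If $b,c$ are real and positive and the equations $X_t=0$ $(t\in T)$ cut out a line in $H_n[\alpha]$, then the edge $\{X\in\mathcal A_n[\alpha]:X_t=0\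 \forall t\in T\}$ is bounded. -/

import Mathlib

namespace BiColor

/-! Color orderings and their blocks -/

/-- A block of a color ordering: a single adjoint particle, or a fundamental / anti-fundamental
pair `(l, B₁, …, B_s, r)` enclosing a (possibly empty) list of sub-blocks. -/
inductive Block where
  | adj : Block
  | pair (subs : List Block) : Block

mutual
/-- Number of particles of a block. -/
def Block.size : Block → ℕ
  | .adj => 1
  | .pair bs => sizes bs + 2
/-- Number of particles of a list of blocks. -/
def sizes : List Block → ℕ
  | [] => 0
  | B :: bs => B.size + sizes bs
end

/-- Particles are labelled by their position `1, …, n` in the ordering. A placed block is a block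
whose leftmost particle has label `l`. -/
structure Placed where
  l : ℕ
  block : Block

/-- The first label to the right of the block. -/
def Placed.endpt (p : Placed) : ℕ := p.l + p.block.size

/-- The rightmost particle of the block (`r = l` for an adjoint particle). -/
def Placed.r (p : Placed) : ℕ := p.endpt - 1

/-- Whether the block is a fundamental / anti-fundamental one. -/
def Placed.isPair (p : Placed) : Bool :=
  match p.block with
  | .adj => false
  | .pair _ => true

/-- Blocks placed one after the other, starting at label `a`. -/
def place : ℕ → List Block → List Placed
  | _, [] => []
  | a, B :: bs => ⟨a, B⟩ :: place (a + B.size) bs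

/-- `sub[B]`: the (direct) sub-blocks of a block, in order. -/
def Placed.subs (p : Placed) : List Placed :=
  match p.block with
  | .adj => []
  | .pair bs => place (p.l + 1) bs

/-! Throughout, a list `α = [B₂, …, B_m]` of blocks stands for the color ordering
`[(1,2), B₂, …, B_m]`. -/

/-- The number `n` of particles of `[(1,2), B₂, …, B_m]`. -/
def numPts (α : List Block) : ℕ := sizes α + 2

/-- `B₂, …, B_m` with their labels. -/
def outer (α : List Block) : List Placed := place 3 α

mutual
/-- All pairs `(l, r)` occurring in a block at any depth. -/
def Block.pairs : Block → ℕ → List (ℕ × ℕ)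
  | .adj, _ => []
  | .pair bs, a => (a, a + sizes bs + 1) :: pairsList bs (a + 1)
/-- All pairs `(l, r)` occurring in a list of blocks at any depth. -/
def pairsList : List Block → ℕ → List (ℕ × ℕ)
  | [], _ => []
  | B :: bs, a => B.pairs a ++ pairsList bs (a + B.size)
end

/-- All fundamental / anti-fundamental pairs of the ordering. All of them have distinct flavors,
so a flavor is identified with its pair. -/
def flavors (α : List Block) : List (ℕ × ℕ) := (1, 2) :: pairsList α 3

/-! Planar variables and flavor conservation -/

/-- The chords of the convex polygon whose vertices are the elements of `S` in increasing
(cyclic) order: pairs `(i, j)`, `i < j`, of non-neighbouring vertices. -/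
def chords (S : Finset ℕ) : Finset (ℕ × ℕ) :=
  (S ×ˢ S).filter fun d =>
    d.1 < d.2 ∧ (∃ s ∈ S, d.1 < s ∧ s < d.2) ∧ (∃ s ∈ S, s < d.1 ∨ d.2 < s)

/-- The vertices of the `n`-gon; particle `i` is its edge from `i` to `i + 1`, with
`n + 1` identified with `1`. -/
def polygon (α : List Block) : Finset ℕ := Finset.Icc 1 (numPts α)

/-- The planar variables `X_{i,j} = (p_i + ⋯ + p_{j-1})²`, indexed by the chords of the `n`-gon. -/
def diagonals (α : List Block) : Finset (ℕ × ℕ) := chords (polygon α)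

/-- The unordered index pair `{a, b}` (with `n + 1 ≡ 1`) as a pair in increasing order. -/
def chord (n a b : ℕ) : ℕ × ℕ :=
  let a' := if a = n + 1 then 1 else a
  let b' := if b = n + 1 then 1 else b
  (min a' b', max a' b')

/-- Two chords cross in the interior of the polygon (the planar variables are incompatible). -/
def Crosses (d e : ℕ × ℕ) : Prop :=
  (d.1 < e.1 ∧ e.1 < d.2 ∧ d.2 < e.2) ∨ (e.1 < d.1 ∧ d.1 < e.2 ∧ e.2 < d.2)

instance (d e : ℕ × ℕ) : Decidable (Crosses d e) := by
  unfold Crosses; infer_instance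

/-- The coefficient, in the flavor symbol of particle `s`, of the flavor carried by the pair `p`. -/
def flavorSymbol (s : ℕ) (p : ℕ × ℕ) : ℤ :=
  if s = p.1 then 1 else if s = p.2 then -1 else 0

/-- Coefficient of the flavor of `p` in the total flavor of the particles `i, …, j - 1`. -/
def totalFlavor (d : ℕ × ℕ) (p : ℕ × ℕ) : ℤ :=
  ∑ s ∈ Finset.Ico d.1 d.2, flavorSymbol s p

/-- The channel `X_{i,j}` is allowed by flavor conservation: the total flavor of
`i, …, j - 1` is zero or a single term `± f_r`. -/
def FlavorAllowed (α : List Block) (d : ℕ × ℕ) : Prop :=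
  (∀ p ∈ flavors α, totalFlavor d p = 0) ∨
    ∃ p ∈ flavors α, (totalFlavor d p = 1 ∨ totalFlavor d p = -1) ∧
      ∀ q ∈ flavors α, q ≠ p → totalFlavor d q = 0

instance (α : List Block) (d : ℕ × ℕ) : Decidable (FlavorAllowed α d) := by
  unfold FlavorAllowed; infer_instance

/-- The planar variables allowed by flavor conservation. -/
def allowed (α : List Block) : Finset (ℕ × ℕ) :=
  (diagonals α).filter fun d => FlavorAllowed α d

/-! Amplitudes -/

/-- The planar cubic Feynman diagrams with external legs the edges of the polygon on `S ⊆ {1,…,n}`: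
triangulations of that polygon all of whose chords are allowed by flavor conservation. The edge of
this polygon from `a` to the next vertex `b` is the particle with momentum `p_a + ⋯ + p_{b-1}`. -/
def feynman (α : List Block) (S : Finset ℕ) : Finset (Finset (ℕ × ℕ)) :=
  (chords S ∩ allowed α).powerset.filter fun T =>
    T.card + 3 = S.card ∧ ∀ d ∈ T, ∀ e ∈ T, ¬ Crosses d e

/-- The amplitude of the polygon on `S`: the sum of its Feynman diagrams. For
`S = {1, …, n}` this is `A_n[α]`. -/
def amp {K : Type*} [Field K] (α : List Block) (S : Finset ℕ) (X : ℕ × ℕ → K) : K :=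
  ∑ T ∈ feynman α S, ∏ d ∈ T, (X d)⁻¹

/-- Vertices of the polygon on one side of the chord `d`. -/
def leftVertices (d : ℕ × ℕ) : Finset ℕ := Finset.Icc d.1 d.2

/-- Vertices of the polygon on the other side of the chord `d`. -/
def rightVertices (α : List Block) (d : ℕ × ℕ) : Finset ℕ :=
  Finset.Icc 1 d.1 ∪ Finset.Icc d.2 (numPts α)

/-! The subspace `H_n` and the open associahedron -/

/-- A set `{i, …, j - 1}` of consecutive particles, given as `(i, j)`. -/
abbrev Interval := ℕ × ℕ

/-- The set consisting of the single particle `k`. -/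
def single (k : ℕ) : Interval := (k, k + 1)

/-- The set of all particles of a block. -/
def Placed.interval (p : Placed) : Interval := (p.l, p.endpt)

/-! A pair `(I, J)` of intervals, `I` to the left of `J`, stands for the constraint
`-s_{I,J} = c_{I,J}`. The list `β` contains the blocks between the first block (whose right
particle is `r₁`) and the block that is being added. -/

/-- `C₁`: the constraints `-s_{q,l_i} = c`, `-s_{q,r_i} = c`, `-s_{q,I} = c` for `I ∈ sub[B_i]`,
without those for `s_{q,l_1}` and `s_{q,r_{m-1}}`. -/
def consC₁ (r₁ : ℕ) (β : List Placed) (q : Interval) : List (Interval × Interval) :=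
  ((single r₁ :: β.flatMap fun B =>
      single B.l :: single B.r :: B.subs.map Placed.interval).filter
    (fun I => I ≠ single ((β.map Placed.r).getLastD r₁))).map fun I => (I, q)

/-- `C₂`: the constraints `-s_{B_i,r_m} = c`, `2 ≤ i ≤ m - 1`. -/
def consC₂ (β : List Placed) (p : Placed) : List (Interval × Interval) :=
  β.map fun B => (B.interval, single p.r)

/-- `C₃ᵃ`: the constraint `-s_{l_m,r_m} = c` and `-s_{I,r_m} = c` for all sub-blocks `I` but the
last; only for blocks with sub-blocks. -/
def consC₃a (p : Placed) : List (Interval × Interval) :=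
  if p.subs.length = 0 then [] else
    (single p.l, single p.r) :: p.subs.dropLast.map fun I => (I.interval, single p.r)

/-- `C₃ᵇ`: the constraints `-s_{B_i,I} = c` for `2 ≤ i ≤ m - 1` and `I ∈ sub[B_m]`. -/
def consC₃b (β : List Placed) (p : Placed) : List (Interval × Interval) :=
  β.flatMap fun B => p.subs.map fun I => (B.interval, I.interval)

/-- The constraints `C₁ ∪ C₂ ∪ C₃` added together with the block `p`. -/
def consNew (r₁ : ℕ) (β : List Placed) (p : Placed) : List (Interval × Interval) :=
  consC₁ r₁ β p.interval ++
    match p.block with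
    | .adj => []
    | .pair _ => consC₂ β p ++ consC₃a p ++ consC₃b β p

mutual
/-- The constraints `H[(-L, l), B_1, …, B_s]` internal to a block `(l, B_1, …, B_s, r)`; the
first block has right particle `l`. -/
def Block.consInner : Block → ℕ → List (Interval × Interval)
  | .adj, _ => []
  | .pair bs, a => consAux bs a [] (a + 1)
/-- The constraints coming with the blocks of the list, the first of which starts at label `a`,
once the blocks `β` are present. -/
def consAux : List Block → ℕ → List Placed → ℕ → List (Interval × Interval)
  | [], _, _, _ => []
  | B :: bs, r₁, β, a =>
      consNew r₁ β ⟨a, B⟩ ++ B.consInner a ++ consAux bs r₁ (β ++ [⟨a, B⟩]) (a + B.size)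
end

/-- The constraints `H_n[(1,2), B₂, …, B_m]`. -/
def constraints (α : List Block) : List (Interval × Interval) := consAux α 2 [] 3

/-- The value of `X_{a,b}`, for `a`, `b` in any order and `n + 1 ≡ 1`. -/
def planar {K : Type*} (n : ℕ) (X : ℕ × ℕ → K) (a b : ℕ) : K := X (chord n a b)

/-- The Mandelstam variable `s_{I,J} = (P_I + P_J)² = P_I² + P_J² + 2 P_I · P_J` in terms of planar
variables: for `I = {i,…,j-1}` and `J = {k,…,l-1}` one has `P_I² = X_{i,j}`, `P_J² = X_{k,l}` and
`2 P_I · P_J = X_{i,l} + X_{j,k} - X_{i,k} - X_{j,l}`. -/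
def mandelstam {K : Type*} [Field K] (n : ℕ) (X : ℕ × ℕ → K) (h : Interval × Interval) : K :=
  planar n X h.1.1 h.1.2 + planar n X h.2.1 h.2.2 +
    (planar n X h.1.1 h.2.2 + planar n X h.1.2 h.2.1
      - planar n X h.1.1 h.2.1 - planar n X h.1.2 h.2.2)

/-- The points of kinematic space (functions on the planar variables, extended by
`X_{i,i+1} = p_i² = 0` and by zero to other index pairs) such that the planar variables forbidden
by flavor conservation have the constant values `b`, and `-s_{I,J} = c_{I,J}` for all
constraints in `H_n`. -/
def subspace {K : Type*} [Field K] (α : List Block) (b : ℕ × ℕ → K)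
    (c : Interval × Interval → K) : Set (ℕ × ℕ → K) :=
  {X | (∀ d, d ∉ diagonals α → X d = 0) ∧
       (∀ d ∈ diagonals α, ¬ FlavorAllowed α d → X d = b d) ∧
       ∀ h ∈ constraints α, -mandelstam (numPts α) X h = c h}

/-- The open associahedron: the points of the subspace at which all planar variables are
nonnegative. -/
def openAssociahedron (α : List Block) (b : ℕ × ℕ → ℝ)
    (c : Interval × Interval → ℝ) : Set (ℕ × ℕ → ℝ) :=
  {X | X ∈ subspace α b c ∧ ∀ d ∈ diagonals α, 0 ≤ X d}

/-! The preferred planar basis and the shift -/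

/-- `⋃ {X_{l_i,l_{i+1}}, X_{l_i,r_i}} ∪ ⋃_{i ≥ 4} {X_{l_2,l_i}}` for the first block `(l₁, r₁)`
and the further blocks `ps`. -/
def basisLevel (l₁ r₁ : ℕ) (ps : List Placed) : List (ℕ × ℕ) :=
  (l₁ :: ps.map Placed.l).zip (ps.map Placed.l ++ [l₁]) ++
    ((l₁, r₁) :: ps.map fun p => (p.l, p.r)) ++
    match ps with
    | [] => []
    | p :: rest => (rest.drop 1).map fun q => (p.l, q.l)

mutual
/-- `f[(r, l), B_1, …, B_s]` for a block `(l, B_1, …, B_s, r)`; empty for an adjoint particle. -/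
def Block.basis : Block → ℕ → List (ℕ × ℕ)
  | .adj, _ => []
  | .pair bs, a => basisLevel (a + sizes bs + 1) a (place (a + 1) bs) ++ basisList bs (a + 1)
/-- The union of the above over a list of blocks. -/
def basisList : List Block → ℕ → List (ℕ × ℕ)
  | [], _ => []
  | B :: bs, a => B.basis a ++ basisList bs (a + B.size)
end

/-- The planar variables among a list of index pairs; pairs of equal or adjacent
vertices are dropped. -/
def toDiagonals (α : List Block) (L : List (ℕ × ℕ)) : Finset (ℕ × ℕ) :=
  (L.map fun d => chord (numPts α) d.1 d.2).toFinset ∩ diagonals α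

/-- The preferred planar basis `f[(1,2), B₂, …, B_m]`. -/
def preferredBasis (α : List Block) : Finset (ℕ × ℕ) :=
  toDiagonals α (basisLevel 1 2 (outer α) ++ basisList α 3)

/-- The label `r₂` (equal to `3` if `B₂` is an adjoint particle). -/
def r₂ (α : List Block) : ℕ := ((outer α).map Placed.r).getD 0 0

/-- The label `l₃`. -/
def l₃ (α : List Block) : ℕ := ((outer α).map Placed.l).getD 1 0

/-- The shift variable `X_{3,l₃}`. -/
def shiftVar (α : List Block) : ℕ × ℕ := chord (numPts α) 3 (l₃ α)

/-- `F⁽¹⁾ = {X_{3,l₃}, X_{2,l₃}} ∪ ⋃_{i ≥ 3} {X_{3,r_i}}`, the union being over the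
fundamental / anti-fundamental blocks `B_i = (l_i, …, r_i)`. -/
def F₁ (α : List Block) : Finset (ℕ × ℕ) :=
  toDiagonals α ((3, l₃ α) :: (2, l₃ α) ::
    (((outer α).drop 1).filter Placed.isPair).map fun p => (3, p.r))

/-- `F⁽²⁾ = ⋃_{i ≠ 2} {X_{r₂,l_i}}`. -/
def F₂ (α : List Block) : Finset (ℕ × ℕ) :=
  toDiagonals α ((r₂ α, 1) :: ((outer α).drop 1).map fun p => (r₂ α, p.l))

/-- The first part `⋃_{I ∈ sub[B₂]} {X_{l_I,l₃}}` of `F⁽³⁾`. -/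
def F₃a (α : List Block) : Finset (ℕ × ℕ) :=
  toDiagonals α (((outer α).take 1).flatMap fun p => p.subs.map fun I => (I.l, l₃ α))

/-- The index pairs `(3, l_I)` for `I ∈ sub[B_i]`, `i ≥ 3`, together with
`Loc(B_{i_ℓ}) = s - ℓ + 2` for the `ℓ`-th of `s` sub-blocks (`ℓ = k + 1`). -/
def locList (α : List Block) : List ((ℕ × ℕ) × ℕ) :=
  ((outer α).drop 1).flatMap fun p =>
    p.subs.zipIdx.map fun Ik => ((3, Ik.1.l), p.subs.length - (Ik.2 + 1) + 2)

/-- The second part `⋃_{i ≥ 3} ⋃_{I ∈ sub[B_i]} {X_{3,l_I}}` of `F⁽³⁾`. -/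
def F₃b (α : List Block) : Finset (ℕ × ℕ) := toDiagonals α ((locList α).map Prod.fst)

/-- `F⁽³⁾`. -/
def F₃ (α : List Block) : Finset (ℕ × ℕ) := F₃a α ∪ F₃b α

/-- The set `F = F⁽¹⁾ ∪ F⁽²⁾ ∪ F⁽³⁾` of deformed propagators. -/
def deformed (α : List Block) : Finset (ℕ × ℕ) := F₁ α ∪ F₂ α ∪ F₃ α

/-- The prefactors `λ`: `1` on `F⁽¹⁾`, `-1` on `F⁽²⁾`, `1` on `X_{l_I,l₃}` with `I ∈ sub[B₂]` and
`Loc(I)` on `X_{3,l_I}` with `I ∈ sub[B_i]`, `i ≥ 3`. -/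
def lam (α : List Block) (d : ℕ × ℕ) : ℤ :=
  if d ∈ F₁ α then 1
  else if d ∈ F₂ α then -1
  else if d ∈ F₃a α then 1
  else (((locList α).lookup d).getD 0 : ℕ)

/-- `Xhat z` is the point of the subspace obtained from `X` by the shift
`X_{3,l₃} → z X_{3,l₃}`, all other variables of the preferred basis and all
constants `b`, `c` being kept fixed. -/
def IsShift {K : Type*} [Field K] (α : List Block) (b : ℕ × ℕ → K)
    (c : Interval × Interval → K) (X : ℕ × ℕ → K) (Xhat : K → ℕ × ℕ → K) : Prop :=
  ∀ z, Xhat z ∈ subspace α b c ∧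
    ∀ d ∈ preferredBasis α, Xhat z d = if d = shiftVar α then z * X d else X d

/-- The pole `z_d = 1 - X_d / (λ_d X_{3,l₃})` of a deformed propagator. -/
def pole {K : Type*} [Field K] (α : List Block) (X : ℕ × ℕ → K) (d : ℕ × ℕ) : K :=
  1 - X d / ((lam α d : K) * X (shiftVar α))

/-- The residue at infinity of `f`, which is `-(2πi)⁻¹ ∮ f(z) dz` over all sufficiently large
circles, is `w`. -/
def HasResidueAtInfinity (f : ℂ → ℂ) (w : ℂ) : Prop :=
  ∀ᶠ R : ℝ in Filter.atTop,
    CircleIntegrable f 0 R ∧ -(2 * Real.pi * Complex.I)⁻¹ * (∮ z in C(0, R), f z) = w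

end BiColor

namespace BiColor

/-! Non-crossing chords of a polygon -/

-- The ordering is read as a rooted tree. After renaming the vertex `1` of the polygon to `n + 1`,
-- every vertex `v ≥ 3` has a unique innermost enclosing pair, recorded by its left label `nd α v`.
-- The whole ordering counts as a pair with left label `2`, and the vertex `2` lies outside
-- everything. The flavor of a pair flows through `X_{u,v}` exactly when the pair encloses one of
-- `u`, `v` but not the other. So `X_{u,v}` is allowed iff the innermost pairs of `u` and `v` are
-- equal or parent and child (`flavorAllowed_iff_related`).
--
-- Coordinates. The allowed variables outside the preferred basis index the constraints
-- (`mem_constraints`). In `-s_{I,J}` for `constraintOf α u v`, the variable `X_{u,v}` has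
-- coefficient `1`, and the other five terms are constants, basis variables or variables that come
-- earlier in a lexicographic order (`isLead_constraintOf`). The system is therefore triangular, and
-- the basis values can be prescribed freely and determine the point (`existsUnique_mem_subspace`).
-- This holds over any field.
--
-- The shift. By uniqueness it suffices to exhibit one vector. The integer vector `shiftDir`, equal
-- to `λ` on `F` and `0` elsewhere, is `1` at `X_{3,l₃}`, vanishes on the rest of the basis, and is
-- annihilated by all constraints (`shiftMandelstam_constraintOf`). Hence `X̂(z) = X + (z - 1)
-- X_{3,l₃} λ`.
--
-- Infinity. Every triangulation has a triangle on the side `r₂` of the polygon, joining the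
-- vertices `r₂` and `l₃ = r₂ + 1`. Flavor conservation forces one of its other sides into `F`: a
-- chord ending at `l₃` with `λ = 1`, or one ending at `r₂` with `λ = -1`. So each diagram is
-- `O(1/z)`, and only diagrams with exactly one deformed chord contribute to the `1/z` term.
-- Flipping that chord in its quadrilateral gives the other deformed chord compatible with the same
-- `n - 4` undeformed chords, and it has the opposite `λ` (`exists_opposite`). The `1/z` terms
-- cancel in pairs (`sum_leadingCoeff`).
--
-- Recursion. This is algebra, diagram by diagram. With `a_d = X_d / λ_d` one has `X̂_e(z_d) = λ_e
-- (a_e - a_d)`, and the partial fraction expansion of `∏ 1/a_e` turns the residue terms of a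
-- diagram into the diagram itself, up to a multiple of its `1/z` coefficient (`sum_residues`). The
-- corrections sum to zero, and the diagrams through `d` factor into those of the two sub-polygons
-- (`sum_feynman_mem`).
--
-- Edges. An edge cut out by undeformed variables has direction `shiftDir`, which has both a
-- positive and a negative entry on the variables required to be nonnegative, so the edge is bounded
-- at both ends (`edge_bounded`).

lemma mem_chords {S : Finset ℕ} {d : ℕ × ℕ} : d ∈ chords S ↔ d.1 ∈ S ∧ d.2 ∈ S ∧ d.1 < d.2 ∧
    (∃ s ∈ S, d.1 < s ∧ s < d.2) ∧ (∃ s ∈ S, s < d.1 ∨ d.2 < s) := by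
  simp only [chords, Finset.mem_filter, Finset.mem_product, and_assoc]

lemma Crosses.symm {d e : ℕ × ℕ} (h : Crosses d e) : Crosses e d := by
  unfold Crosses at *; omega

lemma not_crosses_self (d : ℕ × ℕ) : ¬ Crosses d d := by
  unfold Crosses; omega

/-- Pairwise non-crossing sets of chords. -/
def NonCrossing (T : Finset (ℕ × ℕ)) : Prop := ∀ d ∈ T, ∀ e ∈ T, ¬ Crosses d e

lemma NonCrossing.mono {T U : Finset (ℕ × ℕ)} (h : NonCrossing U) (hTU : T ⊆ U) :
    NonCrossing T := fun d hd e he => h d (hTU hd) e (hTU he)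

lemma NonCrossing.insert {T : Finset (ℕ × ℕ)} {d : ℕ × ℕ} (h : NonCrossing T)
    (hd : ∀ e ∈ T, ¬ Crosses e d) : NonCrossing (insert d T) := by
  intro e he f hf
  rw [Finset.mem_insert] at he hf
  rcases he with rfl | he <;> rcases hf with rfl | hf
  · exact not_crosses_self _
  · exact fun hc => hd _ hf hc.symm
  · exact hd _ he
  · exact h _ he _ hf

/-- The vertices of `S` weakly between the ends of `d`. -/
def innerPart (S : Finset ℕ) (d : ℕ × ℕ) : Finset ℕ := S.filter fun s => d.1 ≤ s ∧ s ≤ d.2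

/-- The vertices of `S` not strictly between the ends of `d`. -/
def outerPart (S : Finset ℕ) (d : ℕ × ℕ) : Finset ℕ := S.filter fun s => s ≤ d.1 ∨ d.2 ≤ s

lemma mem_innerPart {S : Finset ℕ} {d : ℕ × ℕ} {s : ℕ} :
    s ∈ innerPart S d ↔ s ∈ S ∧ d.1 ≤ s ∧ s ≤ d.2 := by simp [innerPart]

lemma mem_outerPart {S : Finset ℕ} {d : ℕ × ℕ} {s : ℕ} :
    s ∈ outerPart S d ↔ s ∈ S ∧ (s ≤ d.1 ∨ d.2 ≤ s) := by simp [outerPart]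

/-- Only the two ends of the chord are counted twice. -/
lemma card_innerPart_add_card_outerPart {S : Finset ℕ} {d : ℕ × ℕ} (hd : d ∈ chords S) :
    (innerPart S d).card + (outerPart S d).card = S.card + 2 := by
  rw [mem_chords] at hd
  obtain ⟨h1, h2, h3, -, -⟩ := hd
  have hU : innerPart S d ∪ outerPart S d = S := by
    ext s; simp only [Finset.mem_union, mem_innerPart, mem_outerPart]
    constructor
    · tauto
    · intro hs; simp only [hs, true_and]; omega
  have hI : innerPart S d ∩ outerPart S d = {d.1, d.2} := by
    ext s; simp only [Finset.mem_inter, mem_innerPart, mem_outerPart, Finset.mem_insert,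
      Finset.mem_singleton]
    constructor
    · omega
    · rintro (rfl | rfl)
      · exact ⟨⟨h1, by omega⟩, h1, by omega⟩
      · exact ⟨⟨h2, by omega⟩, h2, by omega⟩
  have := Finset.card_union_add_card_inter (innerPart S d) (outerPart S d)
  rw [hU, hI, Finset.card_pair (by omega)] at this
  omega

lemma three_le_card_of_mem {S : Finset ℕ} {a b c : ℕ} (ha : a ∈ S) (hb : b ∈ S) (hc : c ∈ S)
    (hab : a ≠ b) (hac : a ≠ c) (hbc : b ≠ c) : 3 ≤ S.card := by
  have : ({a, b, c} : Finset ℕ).card = 3 := by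
    rw [Finset.card_insert_of_notMem (by simp [hab, hac]), Finset.card_pair hbc]
  rw [← this]
  apply Finset.card_le_card
  intro x hx
  simp only [Finset.mem_insert, Finset.mem_singleton] at hx
  rcases hx with rfl | rfl | rfl <;> assumption

lemma three_le_card_innerPart {S : Finset ℕ} {d : ℕ × ℕ} (hd : d ∈ chords S) :
    3 ≤ (innerPart S d).card := by
  rw [mem_chords] at hd
  obtain ⟨h1, h2, h3, ⟨s, hs, hs1, hs2⟩, -⟩ := hd
  exact three_le_card_of_mem (mem_innerPart.2 ⟨h1, by omega⟩) (mem_innerPart.2 ⟨h2, by omega⟩)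
    (mem_innerPart.2 ⟨hs, by omega⟩) (by omega) (by omega) (by omega)

lemma three_le_card_outerPart {S : Finset ℕ} {d : ℕ × ℕ} (hd : d ∈ chords S) :
    3 ≤ (outerPart S d).card := by
  rw [mem_chords] at hd
  obtain ⟨h1, h2, h3, -, ⟨s, hs, hs1⟩⟩ := hd
  exact three_le_card_of_mem (mem_outerPart.2 ⟨h1, by omega⟩) (mem_outerPart.2 ⟨h2, by omega⟩)
    (mem_outerPart.2 ⟨hs, by omega⟩) (by omega) (by omega) (by omega)

lemma chords_mono {S S' : Finset ℕ} (h : S ⊆ S') : chords S ⊆ chords S' := by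
  intro d
  simp only [mem_chords]
  rintro ⟨h1, h2, h3, ⟨s, hs, h4⟩, ⟨t, ht, h5⟩⟩
  exact ⟨h h1, h h2, h3, ⟨s, h hs, h4⟩, ⟨t, h ht, h5⟩⟩

lemma mem_chords_parts_of_not_crosses {S : Finset ℕ} {d e : ℕ × ℕ} (hd : d ∈ chords S)
    (he : e ∈ chords S) (hne : e ≠ d) (hc : ¬ Crosses d e) :
    e ∈ chords (innerPart S d) ∨ e ∈ chords (outerPart S d) := by
  rw [mem_chords] at hd he
  obtain ⟨h1, h2, h3, ⟨s, hs, hs1, hs2⟩, ⟨t, ht, ht1⟩⟩ := hd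
  obtain ⟨k1, k2, k3, ⟨s', hs', hs1', hs2'⟩, ⟨t', ht', ht1'⟩⟩ := he
  have hne' : e.1 ≠ d.1 ∨ e.2 ≠ d.2 := by
    by_contra hcon; push Not at hcon; exact hne (Prod.ext hcon.1 hcon.2)
  simp only [mem_chords, mem_innerPart, mem_outerPart]
  unfold Crosses at hc
  by_cases hin : d.1 ≤ e.1 ∧ e.2 ≤ d.2
  · left
    refine ⟨⟨k1, by omega⟩, ⟨k2, by omega⟩, k3, ⟨s', ⟨hs', by omega⟩, by omega⟩, ?_⟩
    rcases hne' with h | h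
    · exact ⟨d.1, ⟨h1, by omega⟩, by omega⟩
    · exact ⟨d.2, ⟨h2, by omega⟩, by omega⟩
  · right
    refine ⟨⟨k1, by omega⟩, ⟨k2, by omega⟩, k3, ?_, ?_⟩
    · by_cases hs'' : s' ≤ d.1 ∨ d.2 ≤ s'
      · exact ⟨s', ⟨hs', hs''⟩, by omega⟩
      · rcases hne' with h | h
        · by_cases h' : e.1 < d.1
          · exact ⟨d.1, ⟨h1, by omega⟩, by omega⟩
          · omega
        · by_cases h' : d.2 < e.2
          · exact ⟨d.2, ⟨h2, by omega⟩, by omega⟩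
          · exact ⟨d.1, ⟨h1, by omega⟩, by omega⟩
    · by_cases ht'' : t' ≤ d.1 ∨ d.2 ≤ t'
      · exact ⟨t', ⟨ht', ht''⟩, by omega⟩
      · by_cases h' : e.2 ≤ d.1
        · exact ⟨d.2, ⟨h2, by omega⟩, by omega⟩
        · exact ⟨d.1, ⟨h1, by omega⟩, by omega⟩

lemma not_mem_chords_innerPart (S : Finset ℕ) (d : ℕ × ℕ) : d ∉ chords (innerPart S d) := by
  simp only [mem_chords, mem_innerPart]
  rintro ⟨-, -, -, -, s, hs, h⟩
  omega

lemma not_mem_chords_outerPart (S : Finset ℕ) (d : ℕ × ℕ) : d ∉ chords (outerPart S d) := by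
  simp only [mem_chords, mem_outerPart]
  rintro ⟨-, -, -, ⟨s, hs, h⟩, -⟩
  omega

lemma disjoint_chords_parts {S : Finset ℕ} {d : ℕ × ℕ} :
    Disjoint (chords (innerPart S d)) (chords (outerPart S d)) := by
  rw [Finset.disjoint_left]
  intro e
  simp only [mem_chords, mem_innerPart, mem_outerPart]
  rintro ⟨⟨h1, h2⟩, ⟨h3, h4⟩, h5, ⟨s, ⟨hs, hs1⟩, hs2⟩, ⟨s', ⟨hs', hs1'⟩, hs2'⟩⟩
    ⟨⟨k1, k2⟩, ⟨k3, k4⟩, k5, ⟨t, ⟨ht, ht1⟩, ht2⟩, ⟨t', ⟨ht', ht1'⟩, ht2'⟩⟩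
  omega

lemma not_crosses_of_mem_parts {S : Finset ℕ} {d e f : ℕ × ℕ}
    (he : e ∈ chords (innerPart S d)) (hf : f ∈ chords (outerPart S d)) : ¬ Crosses e f := by
  simp only [mem_chords, mem_innerPart, mem_outerPart] at he hf
  unfold Crosses
  omega

lemma not_crosses_of_mem_innerPart {S : Finset ℕ} {d e : ℕ × ℕ}
    (he : e ∈ chords (innerPart S d)) : ¬ Crosses e d := by
  simp only [mem_chords, mem_innerPart] at he
  unfold Crosses
  omega

lemma not_crosses_of_mem_outerPart {S : Finset ℕ} {d e : ℕ × ℕ}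
    (he : e ∈ chords (outerPart S d)) : ¬ Crosses e d := by
  simp only [mem_chords, mem_outerPart] at he
  unfold Crosses
  omega

lemma innerPart_subset (S : Finset ℕ) (d : ℕ × ℕ) : innerPart S d ⊆ S := Finset.filter_subset _ _

lemma outerPart_subset (S : Finset ℕ) (d : ℕ × ℕ) : outerPart S d ⊆ S := Finset.filter_subset _ _

lemma erase_eq_union_parts {S : Finset ℕ} {T : Finset (ℕ × ℕ)} {d : ℕ × ℕ} (hT : T ⊆ chords S)
    (hc : NonCrossing T) (hd : d ∈ T) :
    T.erase d = (T ∩ chords (innerPart S d)) ∪ (T ∩ chords (outerPart S d)) := by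
  ext e
  simp only [Finset.mem_erase, Finset.mem_union, Finset.mem_inter]
  constructor
  · rintro ⟨hne, he⟩
    rcases mem_chords_parts_of_not_crosses (hT hd) (hT he) hne (hc d hd e he) with h | h
    · exact .inl ⟨he, h⟩
    · exact .inr ⟨he, h⟩
  · rintro (⟨he, h⟩ | ⟨he, h⟩)
    · exact ⟨fun h' => not_mem_chords_innerPart S d (h' ▸ h), he⟩
    · exact ⟨fun h' => not_mem_chords_outerPart S d (h' ▸ h), he⟩

lemma card_eq_card_parts {S : Finset ℕ} {T : Finset (ℕ × ℕ)} {d : ℕ × ℕ} (hT : T ⊆ chords S)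
    (hc : NonCrossing T) (hd : d ∈ T) :
    T.card = (T ∩ chords (innerPart S d)).card + (T ∩ chords (outerPart S d)).card + 1 := by
  have h := erase_eq_union_parts hT hc hd
  have h2 := congrArg Finset.card h
  rw [Finset.card_union_of_disjoint (disjoint_chords_parts.mono Finset.inter_subset_right
    Finset.inter_subset_right), Finset.card_erase_of_mem hd] at h2
  have := Finset.card_pos.2 ⟨d, hd⟩
  omega

/-- A non-crossing set of chords of a `k`-gon has at most `k - 3` elements. -/
lemma NonCrossing.card_add_three_le {S : Finset ℕ} {T : Finset (ℕ × ℕ)} (hc : NonCrossing T)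
    (hT : T ⊆ chords S) (hS : 3 ≤ S.card) : T.card + 3 ≤ S.card := by
  induction hk : S.card using Nat.strong_induction_on generalizing S T with
  | _ k ih =>
  -- A chord of `T` cuts the polygon into two smaller ones whose vertex numbers add up to `S.card +
  -- 2`. Two bounds with defect `3`, plus one for the chord itself, give the defect `3` again.
  rcases T.eq_empty_or_nonempty with rfl | ⟨d, hd⟩
  · simp; omega
  have h1 := card_eq_card_parts hT hc hd
  have h2 := card_innerPart_add_card_outerPart (hT hd)
  have h3 := three_le_card_innerPart (hT hd)
  have h4 := three_le_card_outerPart (hT hd)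
  have h5 := ih _ (by omega) (hc.mono Finset.inter_subset_left)
    (Finset.inter_subset_right (s₁ := T) (s₂ := chords (innerPart S d))) h3 rfl
  have h6 := ih _ (by omega) (hc.mono Finset.inter_subset_left)
    (Finset.inter_subset_right (s₁ := T) (s₂ := chords (outerPart S d))) h4 rfl
  omega

/-- A triangulation is a maximal non-crossing set of chords. -/
lemma NonCrossing.mem_of_not_crosses {S : Finset ℕ} {T : Finset (ℕ × ℕ)} (hc : NonCrossing T)
    (hT : T ⊆ chords S) (hcard : T.card + 3 = S.card) {d : ℕ × ℕ} (hd : d ∈ chords S)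
    (h : ∀ e ∈ T, ¬ Crosses e d) : d ∈ T := by
  by_contra hdT
  have := (hc.insert h).card_add_three_le (S := S) (by
    intro e he
    rcases Finset.mem_insert.1 he with rfl | he
    · exact hd
    · exact hT he) (by omega)
  rw [Finset.card_insert_of_notMem hdT] at this
  omega

/-! Feynman diagrams containing a given propagator -/

lemma mem_feynman {α : List Block} {S : Finset ℕ} {T : Finset (ℕ × ℕ)} :
    T ∈ feynman α S ↔ T ⊆ chords S ∧ T ⊆ allowed α ∧ T.card + 3 = S.card ∧ NonCrossing T := by
  simp only [feynman, Finset.mem_filter, Finset.mem_powerset, Finset.subset_inter_iff, NonCrossing]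
  tauto

/-- Factorization on a propagator: cutting along `d` is a bijection between triangulations through
`d` and pairs of triangulations of the two sides. Each half of a triangulation is again full,
because both halves obey the upper bound on non-crossing sets and the two bounds add up to the
actual number of chords. -/
lemma sum_feynman_mem {K : Type*} [Field K] (α : List Block) {S : Finset ℕ} {d : ℕ × ℕ}
    (hd : d ∈ chords S) (hα : d ∈ allowed α) (X : ℕ × ℕ → K) :
    ∑ T ∈ (feynman α S).filter (fun T => d ∈ T), ∏ e ∈ T.erase d, (X e)⁻¹ =
      amp α (innerPart S d) X * amp α (outerPart S d) X := by
  unfold amp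
  rw [Finset.sum_mul_sum, ← Finset.sum_product']
  have hcard := card_innerPart_add_card_outerPart hd
  have h3 := three_le_card_innerPart hd
  have h4 := three_le_card_outerPart hd
  refine Finset.sum_bij' (fun T _ => (T ∩ chords (innerPart S d), T ∩ chords (outerPart S d)))
    (fun P _ => insert d (P.1 ∪ P.2)) ?_ ?_ ?_ ?_ ?_
  · intro T hT
    obtain ⟨hT, hdT⟩ := Finset.mem_filter.1 hT
    obtain ⟨hS, hA, hC, hN⟩ := mem_feynman.1 hT
    have h1 := card_eq_card_parts hS hN hdT
    have h5 := (hN.mono (Finset.inter_subset_left (s₂ := chords (innerPart S d)))).card_add_three_le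
      Finset.inter_subset_right h3
    have h6 := (hN.mono (Finset.inter_subset_left (s₂ := chords (outerPart S d)))).card_add_three_le
      Finset.inter_subset_right h4
    simp only [Finset.mem_product, mem_feynman]
    exact ⟨⟨Finset.inter_subset_right, Finset.inter_subset_left.trans hA, by omega,
        hN.mono Finset.inter_subset_left⟩, Finset.inter_subset_right,
        Finset.inter_subset_left.trans hA, by omega, hN.mono Finset.inter_subset_left⟩
  · rintro ⟨A, B⟩ hP
    simp only [Finset.mem_product, mem_feynman] at hP
    obtain ⟨⟨a1, a2, a3, a4⟩, b1, b2, b3, b4⟩ := hP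
    simp only [Finset.mem_filter, mem_feynman, Finset.mem_insert_self, and_true]
    refine ⟨?_, ?_, ?_, ?_⟩
    · intro e he
      rcases Finset.mem_insert.1 he with rfl | he
      · exact hd
      rcases Finset.mem_union.1 he with he | he
      · exact chords_mono (innerPart_subset _ _) (a1 he)
      · exact chords_mono (outerPart_subset _ _) (b1 he)
    · intro e he
      rcases Finset.mem_insert.1 he with rfl | he
      · exact hα
      rcases Finset.mem_union.1 he with he | he
      · exact a2 he
      · exact b2 he
    · rw [Finset.card_insert_of_notMem, Finset.card_union_of_disjoint
        (disjoint_chords_parts.mono a1 b1)]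
      · omega
      · rw [Finset.mem_union]
        rintro (h | h)
        · exact not_mem_chords_innerPart S d (a1 h)
        · exact not_mem_chords_outerPart S d (b1 h)
    · apply NonCrossing.insert
      · intro e he f hf
        rcases Finset.mem_union.1 he with he | he <;> rcases Finset.mem_union.1 hf with hf | hf
        · exact a4 e he f hf
        · exact not_crosses_of_mem_parts (a1 he) (b1 hf)
        · exact fun h => not_crosses_of_mem_parts (a1 hf) (b1 he) h.symm
        · exact b4 e he f hf
      · intro e he
        rcases Finset.mem_union.1 he with he | he
        · exact not_crosses_of_mem_innerPart (a1 he)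
        · exact not_crosses_of_mem_outerPart (b1 he)
  · intro T hT
    obtain ⟨hT, hdT⟩ := Finset.mem_filter.1 hT
    obtain ⟨hS, hA, hC, hN⟩ := mem_feynman.1 hT
    simp only
    rw [← erase_eq_union_parts hS hN hdT, Finset.insert_erase hdT]
  · rintro ⟨A, B⟩ hP
    simp only [Finset.mem_product, mem_feynman] at hP
    obtain ⟨⟨a1, a2, a3, a4⟩, b1, b2, b3, b4⟩ := hP
    have hdis := Finset.disjoint_left.1 (disjoint_chords_parts (S := S) (d := d))
    have hi := not_mem_chords_innerPart S d
    have ho := not_mem_chords_outerPart S d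
    simp only [Prod.mk.injEq]
    constructor
    · ext e
      simp only [Finset.mem_inter, Finset.mem_insert, Finset.mem_union]
      constructor
      · rintro ⟨rfl | h | h, h'⟩
        · exact absurd h' hi
        · exact h
        · exact absurd (b1 h) (hdis h')
      · exact fun h => ⟨.inr (.inl h), a1 h⟩
    · ext e
      simp only [Finset.mem_inter, Finset.mem_insert, Finset.mem_union]
      constructor
      · rintro ⟨rfl | h | h, h'⟩
        · exact absurd h' ho
        · exact absurd h' (hdis (a1 h))
        · exact h
      · exact fun h => ⟨.inr (.inr h), b1 h⟩
  · intro T hT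
    obtain ⟨hT, hdT⟩ := Finset.mem_filter.1 hT
    obtain ⟨hS, hA, hC, hN⟩ := mem_feynman.1 hT
    rw [erase_eq_union_parts hS hN hdT, Finset.prod_union
      (disjoint_chords_parts.mono Finset.inter_subset_right Finset.inter_subset_right)]

/-! Triangles of a triangulation -/

lemma mem_diagonals {α : List Block} {d : ℕ × ℕ} : d ∈ diagonals α ↔
    1 ≤ d.1 ∧ d.2 ≤ numPts α ∧ d.1 + 2 ≤ d.2 ∧ ¬ (d.1 = 1 ∧ d.2 = numPts α) := by
  simp only [diagonals, polygon, mem_chords, Finset.mem_Icc]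
  constructor
  · rintro ⟨h1, h2, h3, ⟨s, hs⟩, ⟨t, ht⟩⟩
    omega
  · rintro ⟨h1, h2, h3, h4⟩
    refine ⟨by omega, by omega, by omega, ⟨d.1 + 1, by omega⟩, ?_⟩
    by_cases h : d.1 = 1
    · exact ⟨numPts α, by omega⟩
    · exact ⟨1, by omega⟩

/-- `d` is an edge of the `n`-gon or belongs to `T`. -/
def Linked (n : ℕ) (T : Finset (ℕ × ℕ)) (d : ℕ × ℕ) : Prop :=
  d ∈ T ∨ d.1 + 1 = d.2 ∨ (d.1 = 1 ∧ d.2 = n)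

section Triangles

variable {n : ℕ} {T : Finset (ℕ × ℕ)}

lemma Linked.not_crosses {d e : ℕ × ℕ} (h : Linked n T d) (hc : NonCrossing T)
    (hT : T ⊆ chords (Finset.Icc 1 n)) (he : e ∈ T) : ¬ Crosses e d := by
  rcases h with h | h
  · exact hc e he d h
  · have := hT he
    simp only [mem_chords, Finset.mem_Icc] at this
    unfold Crosses
    omega

lemma linked_of_not_crosses (hT : T ⊆ chords (Finset.Icc 1 n)) (hc : NonCrossing T)
    (hcard : T.card + 3 = n) {d : ℕ × ℕ} (h1 : 1 ≤ d.1) (h2 : d.1 < d.2) (h3 : d.2 ≤ n)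
    (h : ∀ e ∈ T, ¬ Crosses e d) : Linked n T d := by
  by_cases hd : d ∈ chords (Finset.Icc 1 n)
  · exact .inl (hc.mem_of_not_crosses hT (by simpa using hcard) hd h)
  · right
    by_contra hcon
    apply hd
    simp only [mem_chords, Finset.mem_Icc]
    refine ⟨by omega, by omega, h2, ⟨d.1 + 1, by omega⟩, ?_⟩
    by_cases h : d.1 = 1
    · exact ⟨n, by omega⟩
    · exact ⟨1, by omega⟩

/-- The apex of the triangle on the inner side of `(p, q)`. -/
lemma exists_inner_apex (hT : T ⊆ chords (Finset.Icc 1 n)) (hc : NonCrossing T)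
    (hcard : T.card + 3 = n) {p q : ℕ} (hp : 1 ≤ p) (hpq : p + 2 ≤ q) (hq : q ≤ n)
    (h : Linked n T (p, q)) :
    ∃ w, p < w ∧ w < q ∧ Linked n T (p, w) ∧ Linked n T (w, q) := by
  classical
  -- The apex is the last vertex before `q` joined to `p`. A chord of `T` crossing `(w, q)` but
  -- neither `(p, w)` nor `(p, q)` would have to start at `p`, against maximality.
  obtain ⟨w, hw, hmax⟩ := ((Finset.Ioo p q).filter fun w => Linked n T (p, w)).exists_max_image id
    ⟨p + 1, Finset.mem_filter.2 ⟨Finset.mem_Ioo.2 (by omega), .inr (.inl rfl)⟩⟩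
  simp only [Finset.mem_filter, Finset.mem_Ioo, id] at hw hmax
  refine ⟨w, hw.1.1, hw.1.2, hw.2, linked_of_not_crosses hT hc hcard (by simp; omega)
    (by simp; omega) (by simpa) ?_⟩
  intro e he hcr
  have h1 := h.not_crosses hc hT he
  have h2 := hw.2.not_crosses hc hT he
  have h3 := hmax e.2
  have h4 : e.1 = p → Linked n T (p, e.2) := fun h => .inl (by rw [← h]; exact he)
  unfold Crosses at *
  simp only at *
  by_cases h5 : e.1 = p
  · have := h3
    simp only [h4 h5, and_true] at this
    omega
  · omega

/-- The apex of the triangle on the outer side of `(p, q)`. -/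
lemma exists_outer_apex (hT : T ⊆ chords (Finset.Icc 1 n)) (hc : NonCrossing T)
    (hcard : T.card + 3 = n) {p q : ℕ} (hp : 1 ≤ p) (hpq : p < q) (hq : q ≤ n)
    (hne : ¬ (p = 1 ∧ q = n)) (h : Linked n T (p, q)) :
    (∃ w, 1 ≤ w ∧ w < p ∧ Linked n T (w, p) ∧ Linked n T (w, q)) ∨
      ∃ w, q < w ∧ w ≤ n ∧ Linked n T (p, w) ∧ Linked n T (q, w) := by
  classical
  -- If some vertex before `p` is joined to `q`, the apex is the largest such vertex. Otherwise it
  -- is the largest vertex after `q` that is joined to `q`.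
  by_cases hex : ∃ w, 1 ≤ w ∧ w < p ∧ Linked n T (w, q)
  · left
    obtain ⟨w0, hw0⟩ := hex
    obtain ⟨w, hw, hmax⟩ := ((Finset.Ico 1 p).filter
      fun w => Linked n T (w, q)).exists_max_image id ⟨w0, by simpa [and_assoc] using hw0⟩
    simp only [Finset.mem_filter, Finset.mem_Ico, id] at hw hmax
    refine ⟨w, hw.1.1, hw.1.2, linked_of_not_crosses hT hc hcard (by simp; omega)
      (by simp; omega) (by simp; omega) ?_, hw.2⟩
    intro e he hcr
    have h1 := h.not_crosses hc hT he
    have h2 := hw.2.not_crosses hc hT he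
    have h3 := hmax e.1
    have h4 : e.2 = q → Linked n T (e.1, q) := fun h => .inl (by rw [← h]; exact he)
    unfold Crosses at *
    simp only at *
    by_cases h5 : e.2 = q
    · simp only [h4 h5, and_true] at h3
      omega
    · omega
  · right
    push Not at hex
    -- For `q = n` the side `(1, n)` would join `q` to the vertex `1 < p`.
    have hqn : q < n := by
      by_contra hcon
      obtain rfl : q = n := by omega
      exact hex 1 le_rfl (by omega) (.inr (.inr ⟨rfl, rfl⟩))
    obtain ⟨w, hw, hmax⟩ := ((Finset.Ioc q n).filter
      fun w => Linked n T (q, w)).exists_max_image id ⟨q + 1, Finset.mem_filter.2 ⟨Finset.mem_Ioc.2 (by omega), .inr (.inl rfl)⟩⟩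
    simp only [Finset.mem_filter, Finset.mem_Ioc, id] at hw hmax
    refine ⟨w, hw.1.1, hw.1.2, linked_of_not_crosses hT hc hcard (by simp; omega)
      (by simp; omega) (by simp; omega) ?_, hw.2⟩
    intro e he hcr
    have h1 := h.not_crosses hc hT he
    have h2 := hw.2.not_crosses hc hT he
    have h3 := hmax e.2
    have h4 : e.1 = q → Linked n T (q, e.2) := fun h => .inl (by rw [← h]; exact he)
    have h6 : e.2 = q → Linked n T (e.1, q) := fun h => .inl (by rw [← h]; exact he)
    have h7 := hex e.1
    have h8 := hT he
    simp only [mem_chords, Finset.mem_Icc] at h8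
    unfold Crosses at *
    simp only at *
    by_cases h5 : e.1 = q
    · simp only [h4 h5, and_true] at h3
      omega
    · by_cases h9 : e.2 = q
      · exact h7 h8.1.1 (by omega) (h6 h9)
      · omega

/-- A chord that crosses none of the four sides of a quadrilateral can enter its interior only as
one of the two diagonals. This makes flips possible. -/
lemma not_crosses_flip (hT : T ⊆ chords (Finset.Icc 1 n)) (hc : NonCrossing T)
    {a b c d : ℕ} (hab : Linked n T (a, b)) (hbc : Linked n T (b, c)) (hcd : Linked n T (c, d))
    (had : Linked n T (a, d)) (h1 : a < b) (h2 : b < c) (h3 : c < d) {e : ℕ × ℕ} (he : e ∈ T) :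
    (e ≠ (a, c) → ¬ Crosses e (b, d)) ∧ (e ≠ (b, d) → ¬ Crosses e (a, c)) := by
  have k1 := hab.not_crosses hc hT he
  have k2 := hbc.not_crosses hc hT he
  have k3 := hcd.not_crosses hc hT he
  have k4 := had.not_crosses hc hT he
  have h8 := hT he
  simp only [mem_chords, Finset.mem_Icc] at h8
  unfold Crosses at *
  simp only [ne_eq, Prod.ext_iff] at *
  constructor <;> omega

end Triangles

end BiColor

namespace BiColor

/-! The tree of blocks -/

mutual
/-- The pair blocks `(a, bs, r)` of a block that starts at label `s`, at any depth, given by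
their left label `a` and the list `bs` of their sub-blocks. -/
def Block.levels : Block → ℕ → List (ℕ × List Block)
  | .adj, _ => []
  | .pair bs, s => (s, bs) :: levelsList bs (s + 1)
/-- The pair blocks of a list of blocks, at any depth. -/
def levelsList : List Block → ℕ → List (ℕ × List Block)
  | [], _ => []
  | B :: bs, s => B.levels s ++ levelsList bs (s + B.size)
end

mutual
/-- Position of the vertex `v` in the block starting at `s`: the left label `a` of the innermost
pair enclosing `v`, and the lists of the sub-blocks of that pair before and after `v`. -/
def Block.locate : Block → ℕ → ℕ → ℕ × List Block × List Block
  | .adj, s, _ => (s, [], [])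
  | .pair bs, s, v => locateList bs s [] v
/-- Position of the vertex `v` in the pair with left label `a` and sub-blocks `β ++ bs`. -/
def locateList : List Block → ℕ → List Block → ℕ → ℕ × List Block × List Block
  | [], a, β, _ => (a, β, [])
  | B :: bs, a, β, v =>
      if v ≤ a + 1 + sizes β then (a, β, B :: bs)
      else if v < a + 1 + sizes β + B.size then B.locate (a + 1 + sizes β) v
      else locateList bs a (β ++ [B]) v
end

lemma Block.size_pos (B : Block) : 0 < B.size := by
  cases B <;> simp [Block.size]

@[simp] lemma sizes_nil : sizes [] = 0 := by simp [sizes]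

@[simp] lemma sizes_cons (B : Block) (bs : List Block) : sizes (B :: bs) = B.size + sizes bs := by
  simp [sizes]

@[simp] lemma sizes_append (β γ : List Block) : sizes (β ++ γ) = sizes β + sizes γ := by
  induction β with
  | nil => simp
  | cons B β ih => simp [ih, add_assoc]

@[simp] lemma size_adj : Block.adj.size = 1 := by simp [Block.size]

@[simp] lemma size_pair (bs : List Block) : (Block.pair bs).size = sizes bs + 2 := by
  simp [Block.size]

mutual
lemma Block.levels_range : ∀ (B : Block) (s a : ℕ) (bs : List Block), (a, bs) ∈ B.levels s →
    s ≤ a ∧ a + 2 + sizes bs ≤ s + B.size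
  | .adj, s, a, bs, h => by simp [Block.levels] at h
  | .pair cs, s, a, bs, h => by
      simp only [Block.levels, List.mem_cons, Prod.mk.injEq] at h
      rcases h with ⟨rfl, rfl⟩ | h
      · simp; omega
      · have := levelsList_range cs (s + 1) a bs h
        simp only [size_pair]
        omega
lemma levelsList_range : ∀ (cs : List Block) (s a : ℕ) (bs : List Block),
    (a, bs) ∈ levelsList cs s → s ≤ a ∧ a + 2 + sizes bs ≤ s + sizes cs
  | [], s, a, bs, h => by simp [levelsList] at h
  | B :: cs, s, a, bs, h => by
      simp only [levelsList, List.mem_append] at h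
      rcases h with h | h
      · have := Block.levels_range B s a bs h
        simp only [sizes_cons]
        omega
      · have := levelsList_range cs _ a bs h
        simp only [sizes_cons]
        omega
end

mutual
-- The search may be restarted at any pair enclosing the vertex; uniqueness of positions rests on
-- this.
lemma Block.locate_of_mem : ∀ (B : Block) (s a : ℕ) (bs : List Block) (w : ℕ),
    (a, bs) ∈ B.levels s → a < w → w ≤ a + 1 + sizes bs →
    B.locate s w = locateList bs a [] w
  | .adj, s, a, bs, w, h, _, _ => by simp [Block.levels] at h
  | .pair cs, s, a, bs, w, h, h1, h2 => by
      simp only [Block.levels, List.mem_cons, Prod.mk.injEq] at h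
      rcases h with ⟨rfl, rfl⟩ | h
      · simp [Block.locate]
      · rw [Block.locate]
        exact locateList_of_mem cs s [] a bs w (by simpa using h) h1 h2
lemma locateList_of_mem : ∀ (cs : List Block) (s : ℕ) (β : List Block) (a : ℕ) (bs : List Block)
    (w : ℕ), (a, bs) ∈ levelsList cs (s + 1 + sizes β) → a < w → w ≤ a + 1 + sizes bs →
    locateList cs s β w = locateList bs a [] w
  | [], s, β, a, bs, w, h, _, _ => by simp [levelsList] at h
  | B :: cs, s, β, a, bs, w, h, h1, h2 => by
      simp only [levelsList, List.mem_append] at h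
      rw [locateList]
      rcases h with h | h
      · have := Block.levels_range B _ a bs h
        rw [if_neg (by omega), if_pos (by omega)]
        exact Block.locate_of_mem B _ a bs w h h1 h2
      · have := levelsList_range cs _ a bs h
        rw [if_neg (by have := B.size_pos; omega), if_neg (by omega)]
        refine locateList_of_mem cs s _ a bs w ?_ h1 h2
        simpa [add_assoc] using h
end

lemma locateList_append : ∀ (γ₁ γ₂ : List Block) (a : ℕ) (β : List Block),
    locateList (γ₁ ++ γ₂) a β (a + 1 + sizes (β ++ γ₁)) = (a, β ++ γ₁, γ₂)
  | [], γ₂, a, β => by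
      cases γ₂ <;> simp [locateList]
  | B :: γ₁, γ₂, a, β => by
      have := B.size_pos
      rw [List.cons_append, locateList, if_neg (by simp; omega), if_neg (by simp; omega)]
      have := locateList_append γ₁ γ₂ a (β ++ [B])
      simpa using this

mutual
lemma Block.locate_spec : ∀ (B : Block) (s v : ℕ), s < v → v < s + B.size →
    v = (B.locate s v).1 + 1 + sizes (B.locate s v).2.1 ∧
      ((B.locate s v).1, (B.locate s v).2.1 ++ (B.locate s v).2.2) ∈ B.levels s
  | .adj, s, v, h1, h2 => by simp at h2; omega
  | .pair cs, s, v, h1, h2 => by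
      rw [size_pair] at h2
      have := locateList_spec cs s [] v (by simp; omega) (by simp; omega)
      rw [Block.locate, Block.levels, List.mem_cons]
      refine ⟨this.1, ?_⟩
      rcases this.2 with h | h
      · left; ext1 <;> simp [h.1, h.2]
      · right; simpa using h
lemma locateList_spec : ∀ (cs : List Block) (a : ℕ) (β : List Block) (v : ℕ),
    a + 1 + sizes β ≤ v → v ≤ a + 1 + sizes β + sizes cs →
    v = (locateList cs a β v).1 + 1 + sizes (locateList cs a β v).2.1 ∧
      (((locateList cs a β v).1 = a ∧
        (locateList cs a β v).2.1 ++ (locateList cs a β v).2.2 = β ++ cs) ∨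
      ((locateList cs a β v).1, (locateList cs a β v).2.1 ++ (locateList cs a β v).2.2) ∈
        levelsList cs (a + 1 + sizes β))
  | [], a, β, v, h1, h2 => by
      simp [locateList] at *; omega
  | B :: cs, a, β, v, h1, h2 => by
      rw [locateList]
      rw [sizes_cons] at h2
      split_ifs with h3 h4
      · exact ⟨by simp; omega, .inl ⟨rfl, rfl⟩⟩
      · have := Block.locate_spec B (a + 1 + sizes β) v (by omega) h4
        exact ⟨this.1, .inr (by rw [levelsList, List.mem_append]; exact .inl this.2)⟩
      · have := locateList_spec cs a (β ++ [B]) v (by simp; omega) (by simp; omega)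
        refine ⟨this.1, ?_⟩
        rcases this.2 with h | h
        · left; exact ⟨h.1, by simpa using h.2⟩
        · right; rw [levelsList, List.mem_append]; right; simpa [add_assoc] using h
end

mutual
lemma Block.exists_parent : ∀ (B : Block) (s a : ℕ) (bs : List Block), (a, bs) ∈ B.levels s →
    (a = s ∧ B = .pair bs) ∨ ∃ a' γ₁ γ₂, (a', γ₁ ++ .pair bs :: γ₂) ∈ B.levels s ∧
      a = a' + 1 + sizes γ₁
  | .adj, s, a, bs, h => by simp [Block.levels] at h
  | .pair cs, s, a, bs, h => by
      simp only [Block.levels, List.mem_cons, Prod.mk.injEq] at h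
      rcases h with ⟨rfl, rfl⟩ | h
      · simp
      · right
        rcases exists_parent_list cs (s + 1) a bs h with ⟨γ₁, γ₂, rfl, h2⟩ | ⟨a', γ₁, γ₂, h1, h2⟩
        · exact ⟨s, γ₁, γ₂, by simp [Block.levels], h2⟩
        · exact ⟨a', γ₁, γ₂, by simp [Block.levels, h1], h2⟩
lemma exists_parent_list : ∀ (cs : List Block) (s a : ℕ) (bs : List Block),
    (a, bs) ∈ levelsList cs s →
    (∃ γ₁ γ₂, cs = γ₁ ++ .pair bs :: γ₂ ∧ a = s + sizes γ₁) ∨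
      ∃ a' γ₁ γ₂, (a', γ₁ ++ .pair bs :: γ₂) ∈ levelsList cs s ∧ a = a' + 1 + sizes γ₁
  | [], s, a, bs, h => by simp [levelsList] at h
  | B :: cs, s, a, bs, h => by
      simp only [levelsList, List.mem_append] at h ⊢
      rcases h with h | h
      · rcases Block.exists_parent B s a bs h with ⟨rfl, rfl⟩ | ⟨a', γ₁, γ₂, h1, h2⟩
        · exact .inl ⟨[], cs, by simp⟩
        · exact .inr ⟨a', γ₁, γ₂, .inl h1, h2⟩
      · rcases exists_parent_list cs _ a bs h with ⟨γ₁, γ₂, rfl, h2⟩ | ⟨a', γ₁, γ₂, h1, h2⟩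
        · exact .inl ⟨B :: γ₁, γ₂, by simp, by simp; omega⟩
        · exact .inr ⟨a', γ₁, γ₂, .inr h1, h2⟩
end

lemma mem_levelsList_append : ∀ (γ₁ γ₂ bs : List Block) (s : ℕ),
    (s + sizes γ₁, bs) ∈ levelsList (γ₁ ++ .pair bs :: γ₂) s
  | [], γ₂, bs, s => by simp [levelsList, Block.levels]
  | B :: γ₁, γ₂, bs, s => by
      have := mem_levelsList_append γ₁ γ₂ bs (s + B.size)
      simp only [List.cons_append, levelsList, List.mem_append, sizes_cons]
      right
      rwa [add_assoc] at this

mutual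
lemma Block.mem_levels_trans : ∀ (B : Block) (s a : ℕ) (γ₁ γ₂ bs : List Block),
    (a, γ₁ ++ .pair bs :: γ₂) ∈ B.levels s → (a + 1 + sizes γ₁, bs) ∈ B.levels s
  | .adj, s, a, γ₁, γ₂, bs, h => by simp [Block.levels] at h
  | .pair cs, s, a, γ₁, γ₂, bs, h => by
      simp only [Block.levels, List.mem_cons, Prod.mk.injEq] at h ⊢
      right
      rcases h with ⟨rfl, rfl⟩ | h
      · exact mem_levelsList_append _ _ _ _
      · exact mem_levelsList_trans cs _ a γ₁ γ₂ bs h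
lemma mem_levelsList_trans : ∀ (cs : List Block) (s a : ℕ) (γ₁ γ₂ bs : List Block),
    (a, γ₁ ++ .pair bs :: γ₂) ∈ levelsList cs s → (a + 1 + sizes γ₁, bs) ∈ levelsList cs s
  | [], s, a, γ₁, γ₂, bs, h => by simp [levelsList] at h
  | B :: cs, s, a, γ₁, γ₂, bs, h => by
      simp only [levelsList, List.mem_append] at h ⊢
      rcases h with h | h
      · exact .inl (Block.mem_levels_trans B _ _ _ _ _ h)
      · exact .inr (mem_levelsList_trans cs _ _ _ _ _ h)
end

/-- The pairs of the ordering, the first of which, standing for the whole ordering, has left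
label `2`. -/
def levels (α : List Block) : List (ℕ × List Block) := (2, α) :: levelsList α 3

/-- The vertex `v` lies in the pair with left label `a`, between its sub-blocks `β` and `γ`. -/
def At (α : List Block) (v a : ℕ) (β γ : List Block) : Prop :=
  (a, β ++ γ) ∈ levels α ∧ v = a + 1 + sizes β

lemma levels_range {α : List Block} {a : ℕ} {bs : List Block} (h : (a, bs) ∈ levels α) :
    2 ≤ a ∧ a + sizes bs ≤ numPts α := by
  simp only [levels, List.mem_cons, Prod.mk.injEq, numPts] at *
  rcases h with ⟨rfl, rfl⟩ | h
  · omega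
  · have := levelsList_range _ _ _ _ h
    omega

/-- Position of the vertex `v` in the ordering. -/
def locate (α : List Block) (v : ℕ) : ℕ × List Block × List Block := locateList α 2 [] v

lemma locate_of_mem {α : List Block} {a : ℕ} {bs : List Block} (h : (a, bs) ∈ levels α) {w : ℕ}
    (h1 : a < w) (h2 : w ≤ a + 1 + sizes bs) : locate α w = locateList bs a [] w := by
  simp only [levels, List.mem_cons, Prod.mk.injEq] at h
  rcases h with ⟨rfl, rfl⟩ | h
  · rfl
  · exact locateList_of_mem α 2 [] a bs w (by simpa using h) h1 h2

/-- Positions are unique, so `nd`, `nx`, `pv`, `en` and `rest` can be read off from any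
decomposition of a level into the blocks before and after the vertex. -/
lemma At.locate {α : List Block} {v a : ℕ} {β γ : List Block} (h : At α v a β γ) :
    locate α v = (a, β, γ) := by
  obtain ⟨h, rfl⟩ := h
  rw [locate_of_mem h (by omega) (by simp)]
  simpa using locateList_append β γ a []

lemma at_locate {α : List Block} {v : ℕ} (h1 : 3 ≤ v) (h2 : v ≤ numPts α + 1) :
    At α v (locate α v).1 (locate α v).2.1 (locate α v).2.2 := by
  have := locateList_spec α 2 [] v (by simpa) (by simp [numPts] at *; omega)
  refine ⟨?_, this.1⟩
  rw [levels, List.mem_cons]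
  rcases this.2 with h | h
  · left; ext1
    · exact h.1
    · exact h.2
  · right; simpa [locate] using h

lemma exists_parent {α : List Block} {a : ℕ} {bs : List Block} (h : (a, bs) ∈ levels α)
    (ha : a ≠ 2) : ∃ a' γ₁ γ₂, At α a a' γ₁ (.pair bs :: γ₂) := by
  simp only [levels, List.mem_cons, Prod.mk.injEq, ha, false_and, false_or] at h
  rcases exists_parent_list _ _ _ _ h with ⟨γ₁, γ₂, h1, h2⟩ | ⟨a', γ₁, γ₂, h1, h2⟩
  · exact ⟨2, γ₁, γ₂, by simp [levels, h1], h2⟩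
  · exact ⟨a', γ₁, γ₂, by simp [levels, h1], h2⟩

lemma At.mem_levels {α : List Block} {v a : ℕ} {β γ bs : List Block}
    (h : At α v a β (.pair bs :: γ)) : (v, bs) ∈ levels α := by
  obtain ⟨h, rfl⟩ := h
  simp only [levels, List.mem_cons, Prod.mk.injEq] at h ⊢
  right
  rcases h with ⟨rfl, rfl⟩ | h
  · exact mem_levelsList_append _ _ _ _
  · exact mem_levelsList_trans _ _ _ _ _ _ h

/-- The left label of the innermost pair enclosing the vertex `v`. -/
def nd (α : List Block) (v : ℕ) : ℕ := if v ≤ 2 then 0 else (locate α v).1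

/-- The vertex following `v` in its pair. -/
def nx (α : List Block) (v : ℕ) : ℕ :=
  match (locate α v).2.2 with
  | [] => v + 1
  | B :: _ => v + B.size

/-- The vertex preceding `v` in its pair; the left label of that pair if `v` is its first
vertex. -/
def pv (α : List Block) (v : ℕ) : ℕ :=
  match (locate α v).2.1.getLast? with
  | none => v - 1
  | some B => v - B.size

/-- The right label of the pair with left label `a`. -/
def en (α : List Block) (a : ℕ) : ℕ := a + 1 + sizes (locate α (a + 1)).2.2

/-- The number of sub-blocks following the vertex `v` in its pair. -/
def rest (α : List Block) (v : ℕ) : ℕ := (locate α v).2.2.length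

-- Neighbouring vertices on a level of the tree

section

variable {α : List Block}

lemma At.range {v a : ℕ} {β γ : List Block} (h : At α v a β γ) :
    2 ≤ a ∧ a < v ∧ v + sizes γ ≤ numPts α + 1 := by
  have := levels_range h.1
  have := h.2
  simp only [sizes_append] at *
  omega

lemma At.nd_eq {v a : ℕ} {β γ : List Block} (h : At α v a β γ) : nd α v = a := by
  have := h.range
  rw [nd, if_neg (by omega), h.locate]

lemma At.rest_eq {v a : ℕ} {β γ : List Block} (h : At α v a β γ) : rest α v = γ.length := by
  rw [rest, h.locate]

lemma At.nx_eq {v a : ℕ} {β γ : List Block} {B : Block} (h : At α v a β (B :: γ)) :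
    nx α v = v + B.size := by
  rw [nx, h.locate]

lemma At.nx_eq_of_nil {v a : ℕ} {β : List Block} (h : At α v a β []) : nx α v = v + 1 := by
  rw [nx, h.locate]

lemma At.pv_eq {v a : ℕ} {β γ : List Block} {B : Block} (h : At α v a (β ++ [B]) γ) :
    pv α v = a + 1 + sizes β := by
  have := h.2
  rw [pv, h.locate]
  simp at *; omega

lemma At.pv_eq_of_nil {v a : ℕ} {γ : List Block} (h : At α v a [] γ) : pv α v = a := by
  have := h.2
  rw [pv, h.locate]
  simp at *; omega

lemma At.succ {v a : ℕ} {β γ : List Block} {B : Block} (h : At α v a β (B :: γ)) :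
    At α (v + B.size) a (β ++ [B]) γ :=
  ⟨by simpa using h.1, by rw [h.2]; simp; omega⟩

lemma At.first {v a : ℕ} {β γ : List Block} (h : At α v a β γ) : At α (a + 1) a [] (β ++ γ) :=
  ⟨h.1, by simp⟩

lemma At.en_eq {v a : ℕ} {β γ : List Block} (h : At α v a β γ) : en α a = v + sizes γ := by
  rw [en, h.first.locate, h.2]
  simp; omega

lemma en_eq_of_mem {a : ℕ} {bs : List Block} (h : (a, bs) ∈ levels α) :
    en α a = a + 1 + sizes bs := by
  have : At α (a + 1) a [] bs := ⟨h, by simp⟩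
  rw [this.en_eq]

lemma exists_at {v : ℕ} (h1 : 3 ≤ v) (h2 : v ≤ numPts α + 1) : ∃ β γ, At α v (nd α v) β γ := by
  rw [nd, if_neg (by omega)]
  exact ⟨_, _, at_locate h1 h2⟩

lemma two_le_nd {v : ℕ} (h1 : 3 ≤ v) (h2 : v ≤ numPts α + 1) : 2 ≤ nd α v := by
  obtain ⟨β, γ, h⟩ := exists_at h1 h2
  exact h.range.1

lemma nd_lt {v : ℕ} (h1 : 3 ≤ v) (h2 : v ≤ numPts α + 1) : nd α v < v := by
  obtain ⟨β, γ, h⟩ := exists_at h1 h2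
  exact h.range.2.1

lemma le_en_nd {v : ℕ} (h1 : 3 ≤ v) (h2 : v ≤ numPts α + 1) :
    v ≤ en α (nd α v) ∧ en α (nd α v) ≤ numPts α + 1 := by
  obtain ⟨β, γ, h⟩ := exists_at h1 h2
  rw [h.en_eq]
  have := h.range
  omega

lemma en_two : en α 2 = numPts α + 1 := by
  rw [en_eq_of_mem (bs := α) (by simp [levels]), numPts]; omega

lemma nd_two : nd α 2 = 0 := by simp [nd]

lemma nd_three : nd α 3 = 2 :=
  At.nd_eq (β := []) (γ := α) ⟨by simp [levels], by simp⟩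

lemma nd_last : nd α (numPts α + 1) = 2 :=
  At.nd_eq (β := α) (γ := []) ⟨by simp [levels], by simp [numPts]; omega⟩

lemma nx_of_ne {v : ℕ} (h1 : 3 ≤ v) (h2 : v ≤ numPts α + 1) (h : v ≠ en α (nd α v)) :
    v < nx α v ∧ nx α v ≤ en α (nd α v) ∧ nd α (nx α v) = nd α v ∧ pv α (nx α v) = v ∧
      rest α v = rest α (nx α v) + 1 := by
  obtain ⟨β, γ, hv⟩ := exists_at h1 h2
  rcases γ with _ | ⟨B, γ⟩
  · rw [hv.en_eq] at h
    simp at h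
  · have := B.size_pos
    rw [hv.nx_eq, hv.succ.nd_eq, hv.succ.pv_eq, hv.rest_eq, hv.succ.rest_eq, hv.en_eq,
      ← hv.2]
    simp only [sizes_cons, List.length_cons, and_true]
    omega

/-- The default value `v + 1` makes `(v, nx α v)` the single particle `r` when `v` is the last
vertex of its pair, so that constraints with `J = r` and with `J` a sub-block share one formula. -/
lemma nx_of_eq {v : ℕ} (h1 : 3 ≤ v) (h2 : v ≤ numPts α + 1) (h : v = en α (nd α v)) :
    nx α v = v + 1 ∧ rest α v = 0 := by
  obtain ⟨β, γ, hv⟩ := exists_at h1 h2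
  rcases γ with _ | ⟨B, γ⟩
  · exact ⟨hv.nx_eq_of_nil, by simp [hv.rest_eq]⟩
  · have := B.size_pos
    rw [hv.en_eq] at h
    simp at h; omega

lemma pv_of_ne {v : ℕ} (h1 : 3 ≤ v) (h2 : v ≤ numPts α + 1) (h : v ≠ nd α v + 1) :
    nd α v < pv α v ∧ pv α v < v ∧ nd α (pv α v) = nd α v ∧ nx α (pv α v) = v := by
  obtain ⟨β, γ, hv⟩ := exists_at h1 h2
  rcases List.eq_nil_or_concat β with rfl | ⟨β, B, rfl⟩
  · have := hv.2
    simp at this; omega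
  · rw [List.concat_eq_append] at hv
    have hv' : At α (nd α v + 1 + sizes β) (nd α v) β (B :: γ) := ⟨by simpa using hv.1, rfl⟩
    have := hv.2
    have := B.size_pos
    rw [hv.pv_eq, hv'.nd_eq, hv'.nx_eq]
    simp at *; omega

/-- Dually, at the first vertex of a pair `(pv α v, v)` is the single particle `l`. -/
lemma pv_of_eq {v : ℕ} (h1 : 3 ≤ v) (h2 : v ≤ numPts α + 1) (h : v = nd α v + 1) :
    pv α v = nd α v := by
  obtain ⟨β, γ, hv⟩ := exists_at h1 h2
  rcases List.eq_nil_or_concat β with rfl | ⟨β, B, rfl⟩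
  · exact hv.pv_eq_of_nil
  · have := hv.2
    have := B.size_pos
    simp at *; omega

/-- `a` is the left label of a pair. -/
def IsLabel (α : List Block) (a : ℕ) : Prop := ∃ bs, (a, bs) ∈ levels α

lemma isLabel_two : IsLabel α 2 := ⟨α, by simp [levels]⟩

lemma isLabel_nd {v : ℕ} (h1 : 3 ≤ v) (h2 : v ≤ numPts α + 1) : IsLabel α (nd α v) := by
  obtain ⟨β, γ, hv⟩ := exists_at h1 h2
  exact ⟨_, hv.1⟩

lemma IsLabel.range {a : ℕ} (h : IsLabel α a) : 2 ≤ a ∧ a < en α a ∧ en α a ≤ numPts α + 1 := by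
  obtain ⟨bs, h⟩ := h
  have := levels_range h
  rw [en_eq_of_mem h]
  omega

lemma IsLabel.nd_succ {a : ℕ} (h : IsLabel α a) : nd α (a + 1) = a := by
  obtain ⟨bs, h⟩ := h
  exact At.nd_eq (β := []) (γ := bs) ⟨h, by simp⟩

lemma IsLabel.nd_en {a : ℕ} (h : IsLabel α a) : nd α (en α a) = a := by
  obtain ⟨bs, h⟩ := h
  rw [en_eq_of_mem h]
  exact At.nd_eq (β := bs) (γ := []) ⟨by simpa using h, by simp⟩

/-- A pair other than the outermost one is a block on the level of its parent. Its left label is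
therefore a vertex of that level, and the next vertex there lies just behind its right label. -/
lemma IsLabel.nx_eq {a : ℕ} (h : IsLabel α a) (ha : a ≠ 2) :
    nx α a = en α a + 1 ∧ a ≠ en α (nd α a) := by
  obtain ⟨bs, h⟩ := h
  obtain ⟨a', γ₁, γ₂, h'⟩ := exists_parent h ha
  rw [h'.nx_eq, en_eq_of_mem h, h'.nd_eq, h'.en_eq]
  simp; omega

lemma isLabel_of_nx {v : ℕ} (h1 : 3 ≤ v) (h2 : v ≤ numPts α + 1) (h : nx α v ≠ v + 1) :
    IsLabel α v := by
  obtain ⟨β, γ, hv⟩ := exists_at h1 h2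
  rcases γ with _ | ⟨B, γ⟩
  · exact absurd hv.nx_eq_of_nil h
  · rw [hv.nx_eq] at h
    rcases B with _ | bs
    · simp at h
    · exact ⟨bs, hv.mem_levels⟩

lemma locateList_label_le {cs : List Block} {a w : ℕ} (h1 : a < w) (h2 : w ≤ a + 1 + sizes cs) :
    a ≤ (locateList cs a [] w).1 := by
  have := (locateList_spec cs a [] w (by simpa) (by simpa)).2
  rcases this with h | h
  · exact h.1.ge
  · have := levelsList_range _ _ _ _ h
    simp at this; omega

/-- Vertices enclosed by a pair have their innermost pair inside of it. -/
lemma IsLabel.le_nd {a w : ℕ} (h : IsLabel α a) (h1 : a < w) (h2 : w ≤ en α a) : a ≤ nd α w := by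
  have h3 := h.range
  obtain ⟨bs, h⟩ := h
  rw [en_eq_of_mem h] at h2
  rw [nd, if_neg (by omega), locate_of_mem h h1 h2]
  exact locateList_label_le h1 h2

end

end BiColor

namespace BiColor

section

variable {α : List Block}

/-! Nesting of the pairs -/

lemma IsLabel.nd_lt {a : ℕ} (h : IsLabel α a) : nd α a < a := by
  have := h.range
  rcases eq_or_ne a 2 with rfl | h2
  · simp [nd_two]
  · exact BiColor.nd_lt (by omega) (by omega)

/-- Pairs are nested or disjoint. If the innermost pair of `w` is not `a` itself, its left label is
again enclosed by `a` and is smaller than `w`, so induction applies to its parent, which ends later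
than it does. -/
lemma en_nd_le (n : ℕ) : ∀ {a w : ℕ}, w ≤ n → IsLabel α a → a < w → w ≤ en α a →
    en α (nd α w) ≤ en α a := by
  induction n with
  | zero => intro a w h1; omega
  | succ n ih =>
    intro a w h1 ha h2 h3
    have := ha.range
    have h4 := ha.le_nd h2 h3
    rcases eq_or_lt_of_le h4 with h5 | h5
    · rw [← h5]
    · have hw := isLabel_nd (α := α) (v := w) (by omega) (by omega)
      have h6 := BiColor.nd_lt (α := α) (v := w) (by omega) (by omega)
      have h7 := ih (by omega) ha h5 (by omega)
      have h8 := hw.nx_eq (by omega)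
      have := nx_of_ne (α := α) (v := nd α w) (by omega) (by omega) h8.2
      omega

lemma IsLabel.en_nd_le {a w : ℕ} (ha : IsLabel α a) (h1 : a < w) (h2 : w ≤ en α a) :
    en α (nd α w) ≤ en α a := BiColor.en_nd_le w le_rfl ha h1 h2

lemma IsLabel.en_lt_en_nd {a : ℕ} (ha : IsLabel α a) (h2 : a ≠ 2) :
    en α a < en α (nd α a) := by
  have := ha.range
  have h8 := ha.nx_eq h2
  have := nx_of_ne (α := α) (v := a) (by omega) (by omega) h8.2
  omega

/-- A vertex strictly between `pv α v` and `v` is enclosed by the pair that starts at `pv α v`, and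
so lies on a deeper level. -/
lemma le_pv {x v : ℕ} (hx : 3 ≤ x) (hv : v ≤ numPts α + 1) (h : nd α x = nd α v) (hlt : x < v) :
    x ≤ pv α v := by
  by_contra hcon
  have h0 := BiColor.nd_lt (α := α) hx (by omega)
  have := two_le_nd (α := α) (v := v) (by omega) hv
  have h1 := pv_of_ne (α := α) (v := v) (by omega) hv (by omega)
  have h2 := isLabel_of_nx (α := α) (v := pv α v) (by omega) (by omega) (by omega)
  have h3 := h2.nx_eq (by omega)
  have h4 := h2.le_nd (w := x) (by omega) (by omega)
  omega

lemma nx_le {x v : ℕ} (hx : 3 ≤ x) (hv : v ≤ numPts α + 1) (h : nd α x = nd α v) (hlt : x < v) :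
    nx α x ≤ v := by
  by_contra hcon
  have h0 := le_en_nd (α := α) (v := v) (by omega) hv
  have h1 := nx_of_ne (α := α) (v := x) (by omega) (by omega) (by rw [h]; omega)
  have h2 := isLabel_of_nx (α := α) (v := x) (by omega) (by omega) (by omega)
  have h3 := h2.nx_eq (by
    have := two_le_nd (α := α) (v := x) (by omega) (by omega)
    have := BiColor.nd_lt (α := α) (v := x) (by omega) (by omega)
    omega)
  have h4 := h2.le_nd (w := v) (by omega) (by omega)
  have h5 := BiColor.nd_lt (α := α) (v := x) (by omega) (by omega)
  omega

/-- A vertex of a child of the pair of `v`. -/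
lemma nd_le_pv {u v : ℕ} (hu : 3 ≤ u) (hv : v ≤ numPts α + 1) (h : nd α (nd α u) = nd α v)
    (hlt : u < v) : 3 ≤ nd α u ∧ IsLabel α (nd α u) ∧ nd α u ≤ pv α v ∧
      nx α (nd α u) = en α (nd α u) + 1 ∧ nx α (nd α u) ≤ v ∧
      (nd α u < pv α v → en α (nd α u) < pv α v) := by
  have h1 := two_le_nd (α := α) (v := v) (by omega) hv
  have h2 := BiColor.nd_lt (α := α) hu (by omega)
  have h3 : 3 ≤ nd α u := by
    by_contra hcon
    have := two_le_nd (α := α) hu (by omega)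
    have h4 : nd α u = 2 := by omega
    rw [h4, nd_two] at h
    omega
  have h4 := isLabel_nd (α := α) hu (by omega)
  have h5 := h4.nx_eq (by omega)
  refine ⟨h3, h4, le_pv h3 hv h (by omega), h5.1, nx_le h3 hv h (by omega), fun h6 => ?_⟩
  have h8 := BiColor.nd_lt (α := α) h3 (by omega)
  have h7 := pv_of_ne (α := α) (v := v) (by omega) hv (by omega)
  have := nx_le (α := α) (v := pv α v) h3 (by omega) (by omega) h6
  omega

/-! The constraints, indexed by the planar variables that they determine -/

/-- The pairs of vertices whose planar variable is determined by a constraint. -/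
def NonBasic (α : List Block) (u v : ℕ) : Prop :=
  2 ≤ u ∧ 3 ≤ v ∧ v ≤ numPts α + 1 ∧
    ((nd α u = nd α v ∧ nd α v + 1 < u ∧ u < pv α v) ∨
      (nd α (nd α u) = nd α v ∧ u < v ∧ nd α u < pv α v) ∨
      (nd α (nd α u) = nd α v ∧ nd α u = pv α v ∧ u + 1 < v) ∨
      (u = nd α v ∧ v ≠ u + 1 ∧ v ≠ en α u) ∨
      (nd α u = nd α (nd α v) ∧ u < nd α v))

/-- The constraint determining the planar variable `X_{u,v}`. -/
def constraintOf (α : List Block) (u v : ℕ) : Interval × Interval :=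
  if nd α u = nd α (nd α v) then ((u, if u = nd α v then u + 1 else nx α u), (v, nx α v))
  else if nd α u = nd α v ∨ nd α u < pv α v then
    ((if nd α u = nd α v then u - 1 else pv α u, u), (pv α v, v))
  else ((pv α u, u), (v - 1, v))

lemma place_append (β γ : List Block) (s : ℕ) :
    place s (β ++ γ) = place s β ++ place (s + sizes β) γ := by
  induction β generalizing s with
  | nil => simp [place]
  | cons B β ih => simp [place, ih, add_assoc]

lemma mem_place {s : ℕ} {β : List Block} {p : Placed} :
    p ∈ place s β ↔ ∃ β₁ B β₂, β = β₁ ++ B :: β₂ ∧ p = ⟨s + sizes β₁, B⟩ := by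
  constructor
  · intro h
    induction β generalizing s with
    | nil => simp [place] at h
    | cons B β ih =>
      rw [place, List.mem_cons] at h
      rcases h with rfl | h
      · exact ⟨[], B, β, by simp⟩
      · obtain ⟨β₁, C, β₂, rfl, rfl⟩ := ih h
        exact ⟨B :: β₁, C, β₂, by simp [add_assoc]⟩
  · rintro ⟨β₁, B, β₂, rfl, rfl⟩
    simp [place_append, place]

mutual
-- The recursive rule (iv) is unrolled: at every pair, however deep, the constraints are those of
-- adding its sub-blocks one by one, its left particle `a` playing the role of `r₁`.
lemma Block.mem_consInner : ∀ (B : Block) (s : ℕ) (h : Interval × Interval),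
    h ∈ B.consInner s ↔ ∃ a γ₁ C γ₂, (a, γ₁ ++ C :: γ₂) ∈ B.levels s ∧
      h ∈ consNew a (place (a + 1) γ₁) ⟨a + 1 + sizes γ₁, C⟩
  | .adj, s, h => by simp [Block.consInner, Block.levels]
  | .pair cs, s, h => by
      rw [Block.consInner]
      have := mem_consAux cs s [] h
      simp only [place, List.nil_append, sizes_nil, add_zero] at this
      rw [this, Block.levels]
      constructor
      · rintro (⟨γ₁, C, γ₂, rfl, h⟩ | ⟨a, γ₁, C, γ₂, h1, h⟩)
        · exact ⟨s, γ₁, C, γ₂, by simp, h⟩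
        · exact ⟨a, γ₁, C, γ₂, List.mem_cons_of_mem _ h1, h⟩
      · rintro ⟨a, γ₁, C, γ₂, h1, h⟩
        simp only [List.mem_cons, Prod.mk.injEq] at h1
        rcases h1 with ⟨rfl, rfl⟩ | h1
        · exact .inl ⟨γ₁, C, γ₂, rfl, h⟩
        · exact .inr ⟨a, γ₁, C, γ₂, h1, h⟩
lemma mem_consAux : ∀ (bs : List Block) (a : ℕ) (β : List Block) (h : Interval × Interval),
    h ∈ consAux bs a (place (a + 1) β) (a + 1 + sizes β) ↔
      (∃ γ₁ B γ₂, bs = γ₁ ++ B :: γ₂ ∧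
        h ∈ consNew a (place (a + 1) (β ++ γ₁)) ⟨a + 1 + sizes (β ++ γ₁), B⟩) ∨
      ∃ a' γ₁ B γ₂, (a', γ₁ ++ B :: γ₂) ∈ levelsList bs (a + 1 + sizes β) ∧
        h ∈ consNew a' (place (a' + 1) γ₁) ⟨a' + 1 + sizes γ₁, B⟩
  | [], a, β, h => by simp [consAux, levelsList]
  | B :: bs, a, β, h => by
      rw [consAux, List.mem_append, List.mem_append, Block.mem_consInner B]
      have h1 : place (a + 1) β ++ [⟨a + 1 + sizes β, B⟩] = place (a + 1) (β ++ [B]) := by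
        simp [place_append, place]
      have h2 : a + 1 + sizes β + B.size = a + 1 + sizes (β ++ [B]) := by simp [add_assoc]
      rw [h1, h2, mem_consAux bs a (β ++ [B]) h, levelsList, ← h2]
      constructor
      · rintro ((h | ⟨a', γ₁, C, γ₂, h1, h⟩) | (⟨γ₁, C, γ₂, rfl, h⟩ | ⟨a', γ₁, C, γ₂, h1, h⟩))
        · exact .inl ⟨[], B, bs, rfl, by simpa using h⟩
        · exact .inr ⟨a', γ₁, C, γ₂, List.mem_append_left _ h1, h⟩
        · exact .inl ⟨B :: γ₁, C, γ₂, rfl, by simpa using h⟩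
        · exact .inr ⟨a', γ₁, C, γ₂, List.mem_append_right _ h1, h⟩
      · rintro (⟨γ₁, C, γ₂, h1, h⟩ | ⟨a', γ₁, C, γ₂, h1, h⟩)
        · rcases γ₁ with _ | ⟨B', γ₁⟩
          · simp only [List.nil_append, List.cons.injEq] at h1
            obtain ⟨rfl, rfl⟩ := h1
            exact .inl (.inl (by simpa using h))
          · simp only [List.cons_append, List.cons.injEq] at h1
            obtain ⟨rfl, rfl⟩ := h1
            exact .inr (.inl ⟨γ₁, C, γ₂, rfl, by simpa using h⟩)
        · rcases List.mem_append.1 h1 with h1 | h1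
          · exact .inl (.inr ⟨a', γ₁, C, γ₂, h1, h⟩)
          · exact .inr (.inr ⟨a', γ₁, C, γ₂, h1, h⟩)
end

lemma mem_constraints_iff {h : Interval × Interval} : h ∈ constraints α ↔
    ∃ v a β B γ, At α v a β (B :: γ) ∧ h ∈ consNew a (place (a + 1) β) ⟨v, B⟩ := by
  have := mem_consAux α 2 [] h
  simp only [place, List.nil_append, sizes_nil, add_zero] at this
  rw [constraints, this]
  constructor
  · rintro (⟨γ₁, B, γ₂, h1, h⟩ | ⟨a', γ₁, B, γ₂, h1, h⟩)
    · exact ⟨_, 2, γ₁, B, γ₂, ⟨by simp [levels, h1], rfl⟩, h⟩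
    · exact ⟨_, a', γ₁, B, γ₂, ⟨by simp [levels, h1], rfl⟩, h⟩
  · rintro ⟨v, a, β, B, γ, ⟨h1, rfl⟩, h⟩
    simp only [levels, List.mem_cons, Prod.mk.injEq] at h1
    rcases h1 with ⟨rfl, h1⟩ | h1
    · exact .inl ⟨β, B, γ, h1.symm, h⟩
    · exact .inr ⟨a, β, B, γ, h1, h⟩

lemma At.split {u v a : ℕ} {β γ β' γ' : List Block} (hu : At α u a β' γ') (hv : At α v a β γ)
    (h : u ≤ v) : ∃ δ, β = β' ++ δ ∧ γ' = δ ++ γ := by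
  have h1 := hu.first.locate
  rw [hv.first.locate] at h1
  simp only [Prod.mk.injEq, true_and] at h1
  have h2 := hu.2
  have h3 := hv.2
  rcases List.append_eq_append_iff.1 h1 with ⟨δ, h4, h5⟩ | ⟨δ, h4, h5⟩
  · rcases δ with _ | ⟨B, δ⟩
    · exact ⟨[], by simpa using h4.symm, by simpa using h5.symm⟩
    · have := B.size_pos
      rw [h4] at h2
      simp at h2
      omega
  · exact ⟨δ, h4, h5⟩

lemma At.eq_of_label {u v a : ℕ} {β γ β' γ' : List Block} (hu : At α u a β' γ')
    (hv : At α v a β γ) : β' ++ γ' = β ++ γ := by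
  have h1 := hu.first.locate
  rw [hv.first.locate] at h1
  simp only [Prod.mk.injEq, true_and] at h1
  exact h1.symm

/-- The right particle excluded in (i) is always the one directly left of the new block: `r_{k-1}`,
or `r₁ = a` if no block has been added yet. -/
lemma getLastD_place (β : List Block) (a : ℕ) :
    (((place (a + 1) β).map Placed.r).getLastD a) = a + sizes β := by
  rcases List.eq_nil_or_concat β with rfl | ⟨β, B, rfl⟩
  · simp [place]
  · have := B.size_pos
    simp [place_append, place, Placed.r, Placed.endpt]
    omega

lemma mem_consC₁ {v a : ℕ} {β γ : List Block} {q : Interval} (hv : At α v a β γ)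
    {h : Interval × Interval} : h ∈ consC₁ a (place (a + 1) β) q ↔ h.2 = q ∧ h.1 ≠ (v - 1, v) ∧
      (h.1 = (a, a + 1) ∨ ∃ p ∈ place (a + 1) β, h.1 = (p.l, p.l + 1) ∨ h.1 = (p.r, p.r + 1) ∨
        ∃ I ∈ p.subs, h.1 = I.interval) := by
  have hr := hv.range
  have h2 : single (a + sizes β) = (v - 1, v) := by
    rw [hv.2]; simp [single]; omega
  obtain ⟨h1, h3⟩ := h
  simp only [consC₁, getLastD_place, h2, List.mem_map, List.mem_filter, List.mem_cons,
    List.mem_flatMap, Prod.mk.injEq, decide_eq_true_eq]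
  constructor
  · rintro ⟨I, ⟨h4, h5⟩, rfl, rfl⟩
    refine ⟨rfl, h5, ?_⟩
    rcases h4 with h4 | ⟨p, hp, h4⟩
    · exact .inl h4
    · refine .inr ⟨p, hp, ?_⟩
      rcases h4 with h4 | h4 | ⟨I, hI, h4⟩
      · exact .inl h4
      · exact .inr (.inl h4)
      · exact .inr (.inr ⟨I, hI, h4.symm⟩)
  · rintro ⟨rfl, h5, h4⟩
    refine ⟨h1, ⟨?_, h5⟩, rfl, rfl⟩
    rcases h4 with h4 | ⟨p, hp, h4⟩
    · exact .inl h4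
    · refine .inr ⟨p, hp, ?_⟩
      rcases h4 with h4 | h4 | ⟨I, hI, h4⟩
      · exact .inl h4
      · exact .inr (.inl h4)
      · exact .inr (.inr ⟨I, hI, h4.symm⟩)

end

end BiColor

-- Every imposed constraint is some `constraintOf α u v`

namespace BiColor

section

variable {α : List Block}

lemma At.of_mem {a : ℕ} {β γ : List Block} {B : Block} (h : (a, β ++ B :: γ) ∈ levels α) :
    At α (a + 1 + sizes β) a β (B :: γ) := ⟨h, rfl⟩

/-- Here `v` lies one level below `u`, and `u`, `v` are the left ends of `I` and `J`. In the other
two cases they are the right ends. -/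
lemma constraintOf_of_parent {u v : ℕ} (h : nd α u = nd α (nd α v)) :
    constraintOf α u v = ((u, if u = nd α v then u + 1 else nx α u), (v, nx α v)) := by
  rw [constraintOf, if_pos h]

/-- Constraints with a common right block. -/
lemma constraintOf_of_lt {u v : ℕ} (hv : 3 ≤ v) (hv' : v ≤ numPts α + 1)
    (h : nd α u = nd α v ∨ nd α (nd α u) = nd α v ∧ nd α u < pv α v) :
    constraintOf α u v = ((if nd α u = nd α v then u - 1 else pv α u, u), (pv α v, v)) := by
  have h1 := (isLabel_nd hv hv').nd_lt
  have h2 : nd α u ≠ nd α (nd α v) := by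
    rcases h with h | h
    · omega
    · intro h3
      have := two_le_nd hv hv'
      have := nd_lt hv hv'
      rw [h3] at h
      rcases Nat.lt_or_ge (nd α (nd α v)) 3 with h4 | h4
      · have : nd α (nd α (nd α v)) = 0 := by rw [nd, if_pos (by omega)]
        omega
      · have := nd_lt (α := α) h4 (by omega)
        omega
  rw [constraintOf, if_neg h2, if_pos (by tauto)]

/-- Here `u` lies inside the block that ends at `v`, and `J` is the right particle of that block:
the constraints `s_{l_k,r_k}` and `s_{I,r_k}` of (iii). -/
lemma constraintOf_of_eq {u v : ℕ} (hv : 3 ≤ v) (hv' : v ≤ numPts α + 1)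
    (h' : nd α u = pv α v) (hne : v ≠ nd α v + 1) :
    constraintOf α u v = ((pv α u, u), (v - 1, v)) := by
  have h1 := (isLabel_nd hv hv').nd_lt
  have h2 := pv_of_ne hv hv' hne
  rw [constraintOf, if_neg (by omega), if_neg (by omega)]

/-- The families correspond to the cases of `NonBasic`. In (i), `I = r₁` gives `u = nd α v`; `I =
r_i` or an adjoint particle gives `u` and `v` on one level; and `I = l_i` or a sub-block gives `u`
inside an earlier block. The constraints `s_{B_i,r_k}` and `s_{B_i,I}` give `v` one level below `u`,
while `s_{l_k,r_k}` and `s_{I,r_k}` give `nd α u = pv α v`. -/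
lemma exists_constraintOf_of_mem {x a : ℕ} {β γ : List Block} {B : Block}
    (hx : At α x a β (B :: γ)) {h : Interval × Interval}
    (hh : h ∈ consNew a (place (a + 1) β) ⟨x, B⟩) :
    ∃ u v, NonBasic α u v ∧ h = constraintOf α u v := by
  have hxr := hx.range
  have hBs := B.size_pos
  have hv := hx.succ
  have hvr := hv.range
  have hxn := hx.nd_eq
  have hvn := hv.nd_eq
  have hvp := hv.pv_eq
  rw [← hx.2] at hvp
  have hxx := hx.nx_eq
  have hlab : IsLabel α a := ⟨_, hx.1⟩
  have hxen := hx.en_eq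
  simp only [sizes_cons] at hxr hxen
  have hp : ∀ p ∈ place (a + 1) β, ∃ β₁ β₂, β = β₁ ++ p.block :: β₂ ∧ p.l = a + 1 + sizes β₁ ∧
      At α p.l a β₁ (p.block :: (β₂ ++ B :: γ)) ∧ p.endpt + sizes β₂ = x := by
    intro p hp
    obtain ⟨β₁, C, β₂, rfl, rfl⟩ := mem_place.1 hp
    refine ⟨β₁, β₂, rfl, rfl, ⟨by simpa using hx.1, rfl⟩, ?_⟩
    have := hx.2
    simp [Placed.endpt] at *
    omega
  rw [consNew, List.mem_append] at hh
  rcases hh with hh | hh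
  · rw [mem_consC₁ hx] at hh
    obtain ⟨I, J⟩ := h
    obtain ⟨rfl, h1, hI⟩ := hh
    simp only [Placed.interval, Placed.endpt] at *
    rcases hI with rfl | ⟨p, hp', hI⟩
    · refine ⟨a, x, ⟨by omega, by omega, by omega, .inr (.inr (.inr (.inl ⟨hxn.symm, ?_, ?_⟩)))⟩, ?_⟩
      · rintro rfl
        exact h1 (by simp)
      · omega
      · rw [constraintOf_of_parent (by rw [hxn]), hxx, if_pos hxn.symm]
    · obtain ⟨β₁, β₂, h2, h3, hpa, h4⟩ := hp p hp'
      have hpr := hpa.range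
      have hps := hpa.succ
      have hpos := p.block.size_pos
      have hpsn := hps.nd_eq
      have hpn := hpa.nd_eq
      -- The last particle of an earlier block, whether `r_i` or an adjoint particle. The excluded
      -- interval `(x - 1, x)` is exactly what would make `u = pv α v`, a basis variable.
      have hS : ∀ I : Interval, I ≠ (x - 1, x) →
          I = (p.l + p.block.size - 1, p.l + p.block.size) → ∃ u v, NonBasic α u v ∧
          (I, (x, x + B.size)) = constraintOf α u v := by
        intro I h1 hI
        have : p.l + p.block.size ≠ x := by
          rintro h; rw [h] at hI; exact h1 hI
        refine ⟨p.l + p.block.size, x + B.size, ⟨by omega, by omega, by omega, .inl (by omega)⟩, ?_⟩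
        rw [constraintOf_of_lt (by omega) (by omega) (by omega), if_pos (by omega), hvp, hI]
      rcases hI with hI | hI | ⟨q, hq, hI⟩
      · rcases hb : p.block with _ | bs
        · apply hS I h1
          rw [hI, hb]
          simp
        · rw [hb] at hpa
          have hl : IsLabel α p.l := ⟨_, hpa.mem_levels⟩
          have hl' := hl.nd_succ
          have hl'' := pv_of_eq (α := α) (v := p.l + 1) (by omega) (by omega) (by omega)
          refine ⟨p.l + 1, x + B.size, ⟨by omega, by omega, by omega,
            .inr (.inl ⟨by rw [hl', hpn, hvn], by omega, by omega⟩)⟩, ?_⟩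
          rw [constraintOf_of_lt (by omega) (by omega) (.inr ⟨by rw [hl', hpn, hvn], by omega⟩),
            if_neg (by omega), hvp, hI, hl'', hl']
      · apply hS I h1
        rw [hI, Placed.r, Placed.endpt, Nat.sub_add_cancel (by omega)]
      · rcases hb : p.block with _ | bs
        · simp [Placed.subs, hb] at hq
        · rw [Placed.subs, hb] at hq
          rw [hb] at hpa h4 hpos
          obtain ⟨c₁, C, c₂, rfl, rfl⟩ := mem_place.1 hq
          have hqa := At.of_mem hpa.mem_levels
          have hqs := hqa.succ
          have hCs := C.size_pos
          have hqn := hqs.nd_eq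
          have hqp := hqs.pv_eq
          have hqr := hqa.range
          simp only [sizes_append, sizes_cons, size_pair] at *
          refine ⟨p.l + 1 + sizes c₁ + C.size, x + B.size,
            ⟨by omega, by omega, by omega,
              .inr (.inl ⟨by rw [hqn, hpn, hvn], by omega, by omega⟩)⟩, ?_⟩
          rw [constraintOf_of_lt (by omega) (by omega) (.inr ⟨by rw [hqn, hpn, hvn], by omega⟩),
            if_neg (by omega), hvp, hI, hqp]
  · rcases B with _ | bs
    · simp at hh
    have hl : IsLabel α x := ⟨_, hx.mem_levels⟩
    have henx := en_eq_of_mem hx.mem_levels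
    -- Rule (ii) and the constraints `s_{B_i,I}` of (iii) at once: `J` is the sub-block starting at
    -- `w`, or `r_k` when `w` is the last vertex.
    have hA : ∀ p ∈ place (a + 1) β, ∀ w, nd α w = x → x < w → w ≤ en α x →
        ∃ u v, NonBasic α u v ∧ (p.interval, (w, nx α w)) = constraintOf α u v := by
      intro p hp' w hw h1 h2
      obtain ⟨β₁, β₂, -, h3, hpa, h4⟩ := hp p hp'
      have hpn := hpa.nd_eq
      have hpr := hpa.range
      have hpx := hpa.nx_eq
      have := p.block.size_pos
      simp only [size_pair, Placed.endpt] at *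
      refine ⟨p.l, w, ⟨by omega, by omega, by omega, .inr (.inr (.inr (.inr ⟨?_, by omega⟩)))⟩, ?_⟩
      · rw [hw]; omega
      · rw [constraintOf_of_parent (by rw [hw]; omega), if_neg (by omega), Placed.interval,
          Placed.endpt, hpx]
    -- Here `w` is the right end of `I`, where `I` is `l_k` or a sub-block. The condition `w < en α
    -- x` says that `I` is not the last sub-block.
    have hD : ∀ w, nd α w = x → x < w → w < en α x →
        ∃ u v, NonBasic α u v ∧ ((pv α w, w), (en α x, en α x + 1)) = constraintOf α u v := by
      intro w hw h1 h2
      simp only [size_pair] at *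
      refine ⟨w, x + (sizes bs + 2), ⟨by omega, by omega, by omega, .inr (.inr (.inl
        ⟨by rw [hw]; omega, by omega, by omega⟩))⟩, ?_⟩
      rw [constraintOf_of_eq (by omega) (by omega) (by omega) (by omega), henx,
        show x + (sizes bs + 2) = x + 1 + sizes bs + 1 by omega, Nat.add_sub_cancel]
    simp only [List.mem_append] at hh
    rcases hh with (hh | hh) | hh
    · simp only [consC₂, List.mem_map] at hh
      obtain ⟨p, hp', rfl⟩ := hh
      have h2 := nx_of_eq (α := α) (v := en α x) (by omega) (by simp at hvr; omega)
        (by rw [hl.nd_en])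
      have := hA p hp' (en α x) hl.nd_en (by omega) le_rfl
      rw [h2.1] at this
      simpa [single, Placed.r, Placed.endpt, henx, add_assoc, add_comm, add_left_comm] using this
    · rw [consC₃a] at hh
      split_ifs at hh with h1
      · simp at hh
      · have hs : 0 < sizes bs := by
          rcases bs with _ | ⟨C, bs⟩
          · simp [Placed.subs, place] at h1
          · have := C.size_pos
            simp; omega
        have hr : single (Placed.r ⟨x, .pair bs⟩) = (en α x, en α x + 1) := by
          simp [single, Placed.r, Placed.endpt, henx]; omega
        rw [hr] at hh
        rw [List.mem_cons] at hh
        rcases hh with rfl | hh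
        · have := pv_of_eq (α := α) (v := x + 1) (by omega) (by omega) (by rw [hl.nd_succ])
          have := hD (x + 1) hl.nd_succ (by omega) (by omega)
          simpa [*, hl.nd_succ, single] using this
        · simp only [List.mem_map] at hh
          obtain ⟨q, hq, rfl⟩ := hh
          rcases List.eq_nil_or_concat bs with rfl | ⟨bs, D, rfl⟩
          · simp at hs
          · simp only [Placed.subs, List.concat_eq_append, place_append, place,
              List.dropLast_concat] at hq
            obtain ⟨c₁, C, c₂, rfl, rfl⟩ := mem_place.1 hq
            have hm := hx.mem_levels
            have hqa : At α (x + 1 + sizes c₁) x c₁ (C :: (c₂ ++ [D])) := ⟨by simpa using hm, rfl⟩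
            have hCs := C.size_pos
            have hDs := D.size_pos
            simp at henx
            have := hD _ hqa.succ.nd_eq (by omega) (by omega)
            rw [hqa.succ.pv_eq] at this
            exact this
    · simp only [consC₃b, List.mem_flatMap, List.mem_map, Placed.subs] at hh
      obtain ⟨p, hp', q, hq, rfl⟩ := hh
      obtain ⟨c₁, C, c₂, rfl, rfl⟩ := mem_place.1 hq
      have hqa := At.of_mem hx.mem_levels
      have hCs := C.size_pos
      simp at henx
      have := hA p hp' _ hqa.nd_eq (by omega) (by omega)
      rw [hqa.nx_eq] at this
      exact this

end

end BiColor

-- Every `constraintOf α u v` is imposed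

namespace BiColor

section

variable {α : List Block}

lemma IsLabel.exists_at {a : ℕ} (h : IsLabel α a) (ha : 3 ≤ a) :
    ∃ β bs γ, At α a (nd α a) β (.pair bs :: γ) ∧ (a, bs) ∈ levels α := by
  obtain ⟨bs, h⟩ := h
  obtain ⟨a', γ₁, γ₂, h'⟩ := exists_parent h (by omega)
  exact ⟨γ₁, bs, γ₂, by rwa [h'.nd_eq], h⟩

lemma exists_at_pv {v : ℕ} (h1 : 3 ≤ v) (h2 : v ≤ numPts α + 1) (h : v ≠ nd α v + 1) :
    ∃ β B γ, At α (pv α v) (nd α v) β (B :: γ) ∧ v = pv α v + B.size ∧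
      At α v (nd α v) (β ++ [B]) γ := by
  obtain ⟨β, γ, hv⟩ := exists_at h1 h2
  rcases List.eq_nil_or_concat β with rfl | ⟨β, B, rfl⟩
  · have := hv.2
    simp at this; omega
  · rw [List.concat_eq_append] at hv
    have := hv.2
    refine ⟨β, B, γ, ⟨by simpa using hv.1, hv.pv_eq⟩, ?_, hv⟩
    rw [hv.pv_eq]; simp at this; omega

lemma mem_place_of_at {a x y : ℕ} {β γ β' γ' : List Block} {C : Block}
    (hx : At α x a β γ) (hy : At α y a β' (C :: γ')) (h : y < x) :
    (⟨y, C⟩ : Placed) ∈ place (a + 1) β ∧ y + C.size ≤ x := by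
  obtain ⟨δ, h1, h2⟩ := hy.split hx h.le
  rcases δ with _ | ⟨D, δ⟩
  · have h3 := hx.2
    rw [h1] at h3
    have := hy.2
    simp at h3
    omega
  · simp only [List.cons_append, List.cons.injEq] at h2
    obtain ⟨rfl, rfl⟩ := h2
    refine ⟨mem_place.2 ⟨β', C, δ, h1, by rw [hy.2]⟩, ?_⟩
    rw [hx.2, hy.2, h1]
    simp; omega

lemma mem_subs_of_at {y u : ℕ} {bs c₁ c₂ : List Block} {D : Block} (hy : (y, bs) ∈ levels α)
    (hu : At α u y c₁ (D :: c₂)) : (⟨u, D⟩ : Placed) ∈ place (y + 1) bs := by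
  have h0 : At α (y + 1) y [] bs := ⟨hy, by simp⟩
  have h1 := hu.eq_of_label h0
  exact mem_place.2 ⟨c₁, D, c₂, h1.symm, by rw [hu.2]⟩

lemma constraintOf_mem {u v : ℕ} (h : NonBasic α u v) : constraintOf α u v ∈ constraints α := by
  obtain ⟨hu, hv, hv', h⟩ := h
  have h1 := nd_lt hv hv'
  have h2 := two_le_nd hv hv'
  rw [mem_constraints_iff]
  rcases h with ⟨h3, h4, h5⟩ | ⟨h3, h4, h5⟩ | ⟨h3, h4, h5⟩ | ⟨h3, h4, h5⟩ | ⟨h3, h4⟩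
  · have hne : v ≠ nd α v + 1 := fun h => by
      have := pv_of_eq hv hv' h
      omega
    have hp := pv_of_ne hv hv' hne
    obtain ⟨β, B, γ, hx, hB, -⟩ := exists_at_pv hv hv' hne
    obtain ⟨β', B', γ', hy, hB', -⟩ := exists_at_pv (α := α) (v := u) (by omega) (by omega) (by omega)
    have := B'.size_pos
    rw [h3] at hy
    refine ⟨_, _, β, B, γ, hx, ?_⟩
    rw [constraintOf_of_lt hv hv' (.inl h3), if_pos h3]
    refine List.mem_append_left _ ((mem_consC₁ hx).2 ⟨?_, ?_, .inr ⟨_, (mem_place_of_at hx hy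
      (by omega)).1, .inr (.inl ?_)⟩⟩)
    · simp [Placed.interval, Placed.endpt, ← hB]
    · simp only [ne_eq, Prod.mk.injEq]; omega
    · simp only [Placed.r, Placed.endpt, ← hB', Prod.mk.injEq, true_and]
      omega
  · have hu3 : 3 ≤ u := by
      by_contra hcon
      have : u = 2 := by omega
      rw [this, nd_two, nd, if_pos (by omega)] at h3
      omega
    have hk := nd_le_pv hu3 hv' h3 h4
    have hne : v ≠ nd α v + 1 := fun h => by
      have := pv_of_eq hv hv' h
      have := nd_lt (α := α) hk.1 (by omega)
      omega
    obtain ⟨β, B, γ, hx, hB, -⟩ := exists_at_pv hv hv' hne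
    obtain ⟨β', bs, γ', hy, hbs⟩ := hk.2.1.exists_at hk.1
    rw [h3] at hy
    refine ⟨_, _, β, B, γ, hx, ?_⟩
    have h8 := nd_lt (α := α) hk.1 (by omega)
    have h9 := le_en_nd (α := α) hu3 (by omega)
    rw [constraintOf_of_lt hv hv' (.inr ⟨h3, h5⟩), if_neg (by omega)]
    refine List.mem_append_left _ ((mem_consC₁ hx).2 ⟨?_, ?_, .inr ⟨_, (mem_place_of_at hx hy
      (by omega)).1, ?_⟩⟩)
    · simp [Placed.interval, Placed.endpt, ← hB]
    · simp only [ne_eq, Prod.mk.injEq]; omega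
    · by_cases h10 : u = nd α u + 1
      · left
        rw [pv_of_eq hu3 (by omega) h10]
        exact Prod.ext rfl h10
      · right; right
        obtain ⟨c₁, D, c₂, hz, hD, -⟩ := exists_at_pv (α := α) hu3 (by omega) h10
        refine ⟨_, mem_subs_of_at hbs hz, ?_⟩
        exact Prod.ext rfl hD
  · have hu3 : 3 ≤ u := by
      by_contra hcon
      have : u = 2 := by omega
      rw [this, nd_two, nd, if_pos (by omega)] at h3
      omega
    have hk := nd_le_pv hu3 hv' h3 (by omega)
    have hne : v ≠ nd α v + 1 := fun h => by
      have := pv_of_eq hv hv' h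
      have := nd_lt (α := α) hk.1 (by omega)
      omega
    have hpv := pv_of_ne hv hv' hne
    obtain ⟨β, bs, γ, hx, hbs⟩ := hk.2.1.exists_at hk.1
    have hnx := hx.nx_eq
    rw [constraintOf_of_eq hv hv' h4 hne]
    refine ⟨_, _, β, _, γ, hx, List.mem_append_right _ (List.mem_append_left _
      (List.mem_append_right _ ?_))⟩
    have hr : (v - 1, v) = single (Placed.r ⟨nd α u, .pair bs⟩) := by
      rw [h4, hpv.2.2.2] at hnx
      simp only [single, Placed.r, Placed.endpt, Prod.mk.injEq]
      omega
    have h9 := nd_lt (α := α) hu3 (by omega)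
    rw [hr, consC₃a, if_neg]
    · rw [List.mem_cons]
      by_cases h10 : u = nd α u + 1
      · left
        rw [pv_of_eq hu3 (by omega) h10]
        exact Prod.ext (Prod.ext rfl h10) rfl
      · right
        obtain ⟨c₁, D, c₂, hz, hD, hz'⟩ := exists_at_pv (α := α) hu3 (by omega) h10
        refine List.mem_map.2 ⟨⟨pv α u, D⟩, ?_, Prod.ext (Prod.ext rfl hD.symm) rfl⟩
        have h0 : At α (nd α u + 1) (nd α u) [] bs := ⟨hbs, by simp⟩
        have h11 := hz'.eq_of_label h0
        -- Were `I` the last sub-block, `u` would be the last vertex of its pair and `u + 1 = v`. So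
        -- `I` survives `dropLast`.
        rcases List.eq_nil_or_concat c₂ with rfl | ⟨c₂, D', rfl⟩
        · rw [← h4, hnx] at hpv
          have := hz'.en_eq
          simp [en_eq_of_mem hbs] at this hpv
          omega
        · rw [List.nil_append, List.concat_eq_append] at h11
          simp only [Placed.subs]
          rw [← h11, ← List.append_assoc, place_append, place, place, List.dropLast_concat]
          exact mem_place.2 ⟨c₁, D, c₂, by simp, by rw [hz.2]⟩
    · intro h11
      rcases bs with _ | ⟨C, bs⟩
      · rw [← h4, hnx] at hpv
        simp at hpv
        omega
      · simp [Placed.subs, place] at h11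
  · obtain ⟨β, γ, hx⟩ := exists_at hv hv'
    rcases γ with _ | ⟨B, γ⟩
    · have := hx.en_eq
      simp at this
      rw [h3] at h5
      omega
    rw [constraintOf_of_parent (by rw [h3]), if_pos h3, h3]
    refine ⟨_, _, β, B, γ, hx, List.mem_append_left _ ((mem_consC₁ hx).2 ⟨?_, ?_, .inl rfl⟩)⟩
    · rw [hx.nx_eq]; rfl
    · simp only [ne_eq, Prod.mk.injEq]; omega
  · have hlab := isLabel_nd hv hv'
    have h6 := hlab.nd_lt
    obtain ⟨β, bs, γ, hx, hbs⟩ := hlab.exists_at (by omega)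
    have hu3 : 3 ≤ u := by
      by_contra hcon
      have h7 : u = 2 := by omega
      rw [h7, nd_two] at h3
      have := hx.range
      omega
    obtain ⟨β', γ', hy⟩ := exists_at (α := α) hu3 (by omega)
    rw [h3] at hy
    have hne : u ≠ en α (nd α u) := by
      rw [h3]
      have := le_en_nd (α := α) (v := nd α v) (by omega) (by omega)
      omega
    rcases γ' with _ | ⟨C, γ'⟩
    · have := hy.en_eq
      rw [h3] at hne
      simp at this
      omega
    have hp := (mem_place_of_at hx hy h4).1
    rw [constraintOf_of_parent h3, if_neg (by omega), hy.nx_eq]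
    obtain ⟨c₁, c₂, hw⟩ := exists_at hv hv'
    refine ⟨_, _, β, _, γ, hx, List.mem_append_right _ ?_⟩
    -- With no block behind `v`, the interval `J` is the right particle and the constraint comes
    -- from (ii). Otherwise `J` is the sub-block at `v` and it comes from (iii).
    rcases c₂ with _ | ⟨D, c₂⟩
    · refine List.mem_append_left _ (List.mem_append_left _ (List.mem_map.2 ⟨_, hp, ?_⟩))
      have := hw.en_eq
      rw [en_eq_of_mem hbs] at this
      rw [hw.nx_eq_of_nil]
      simp only [Placed.interval, Placed.endpt, single, Placed.r, size_pair, Prod.mk.injEq,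
        true_and]
      simp at this
      omega
    · refine List.mem_append_right _ (List.mem_flatMap.2 ⟨_, hp, List.mem_map.2
        ⟨_, mem_subs_of_at hbs hw, ?_⟩⟩)
      rw [hw.nx_eq]
      rfl

lemma mem_constraints {h : Interval × Interval} :
    h ∈ constraints α ↔ ∃ u v, NonBasic α u v ∧ h = constraintOf α u v := by
  constructor
  · intro hh
    obtain ⟨v, a, β, B, γ, hx, hh⟩ := mem_constraints_iff.1 hh
    exact exists_constraintOf_of_mem hx hh
  · rintro ⟨u, v, h, rfl⟩
    exact constraintOf_mem h

end

end BiColor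

namespace BiColor

section

variable {α : List Block}

/-! Coordinates: the vertex `1` is relabelled `n + 1`, so that the vertices are `2, …, n + 1` -/

lemma chord_comm (n a b : ℕ) : chord n a b = chord n b a := by
  simp only [chord, min_comm, max_comm]

lemma chord_of_lt {n u v : ℕ} (h : u < v) (hv : v ≤ n) : chord n u v = (u, v) := by
  simp only [chord]
  rw [if_neg (by omega), if_neg (by omega), min_eq_left h.le, max_eq_right h.le]

lemma chord_last {n u : ℕ} (h : 1 ≤ u) (hu : u ≤ n) : chord n u (n + 1) = (1, u) := by
  simp only [chord]
  rw [if_neg (by omega), if_true, min_eq_right h, max_eq_left h]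

lemma chord_eq {n u v : ℕ} (h : u < v) (hu : 2 ≤ u) (hv : v ≤ n + 1) :
    chord n u v = if v = n + 1 then (1, u) else (u, v) := by
  split_ifs with h'
  · subst h'
    exact chord_last (by omega) (by omega)
  · exact chord_of_lt h (by omega)

lemma chord_mem_diagonals {u v : ℕ} (h : u ≤ v) (hu : 2 ≤ u) (hv : v ≤ numPts α + 1) :
    chord (numPts α) u v ∈ diagonals α ↔ u + 2 ≤ v ∧ ¬ (u = 2 ∧ v = numPts α + 1) := by
  rw [mem_diagonals]
  simp only [chord]
  have : 2 ≤ numPts α := by simp [numPts]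
  split_ifs <;> omega

lemma exists_chord {d : ℕ × ℕ} (hd : d ∈ diagonals α) : ∃ u v, 2 ≤ u ∧ u + 2 ≤ v ∧
    v ≤ numPts α + 1 ∧ ¬ (u = 2 ∧ v = numPts α + 1) ∧ d = chord (numPts α) u v := by
  rw [mem_diagonals] at hd
  by_cases h : d.1 = 1
  · refine ⟨d.2, numPts α + 1, by omega, by omega, by omega, by omega, ?_⟩
    rw [chord_last (by omega) (by omega)]
    exact Prod.ext h rfl
  · refine ⟨d.1, d.2, by omega, by omega, by omega, by omega, ?_⟩
    rw [chord_of_lt (by omega) (by omega)]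

lemma chord_injective {n u v u' v' : ℕ} (h : u < v) (hu : 2 ≤ u) (hv : v ≤ n + 1)
    (h' : u' < v') (hu' : 2 ≤ u') (hv' : v' ≤ n + 1) (he : chord n u v = chord n u' v') :
    u = u' ∧ v = v' := by
  rw [chord_eq h hu hv, chord_eq h' hu' hv'] at he
  split_ifs at he <;> simp only [Prod.mk.injEq] at he <;> omega

/-! Flavor conservation in terms of the tree of blocks -/

mutual
lemma Block.mem_pairs : ∀ (B : Block) (s : ℕ) (p : ℕ × ℕ), p ∈ B.pairs s ↔
    ∃ a bs, (a, bs) ∈ B.levels s ∧ p = (a, a + 1 + sizes bs)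
  | .adj, s, p => by simp [Block.pairs, Block.levels]
  | .pair cs, s, p => by
      simp only [Block.pairs, Block.levels, List.mem_cons, mem_pairsList cs, Prod.mk.injEq]
      constructor
      · rintro (rfl | ⟨a, bs, h1, h2⟩)
        · exact ⟨s, cs, .inl ⟨rfl, rfl⟩, Prod.ext rfl (by simp; omega)⟩
        · exact ⟨a, bs, .inr h1, h2⟩
      · rintro ⟨a, bs, ⟨rfl, rfl⟩ | h1, h2⟩
        · left; rw [h2]; exact Prod.ext rfl (by simp; omega)
        · exact .inr ⟨a, bs, h1, h2⟩
lemma mem_pairsList : ∀ (cs : List Block) (s : ℕ) (p : ℕ × ℕ), p ∈ pairsList cs s ↔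
    ∃ a bs, (a, bs) ∈ levelsList cs s ∧ p = (a, a + 1 + sizes bs)
  | [], s, p => by simp [pairsList, levelsList]
  | B :: cs, s, p => by
      simp only [pairsList, levelsList, List.mem_append, Block.mem_pairs B, mem_pairsList cs]
      constructor
      · rintro (⟨a, bs, h1, h2⟩ | ⟨a, bs, h1, h2⟩)
        · exact ⟨a, bs, .inl h1, h2⟩
        · exact ⟨a, bs, .inr h1, h2⟩
      · rintro ⟨a, bs, h1 | h1, h2⟩
        · exact .inl ⟨a, bs, h1, h2⟩
        · exact .inr ⟨a, bs, h1, h2⟩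
end

lemma mem_flavors {p : ℕ × ℕ} :
    p ∈ flavors α ↔ p = (1, 2) ∨ ∃ a, IsLabel α a ∧ 3 ≤ a ∧ p = (a, en α a) := by
  rw [flavors, List.mem_cons, mem_pairsList]
  refine or_congr Iff.rfl ⟨?_, ?_⟩
  · rintro ⟨a, bs, h, rfl⟩
    have h' : (a, bs) ∈ levels α := by simp [levels, h]
    exact ⟨a, ⟨bs, h'⟩, (levelsList_range _ _ _ _ h).1, by rw [en_eq_of_mem h']⟩
  · rintro ⟨a, ⟨bs, h⟩, h3, rfl⟩
    refine ⟨a, bs, ?_, by rw [en_eq_of_mem h]⟩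
    simp only [levels, List.mem_cons, Prod.mk.injEq] at h
    rcases h with h | h
    · omega
    · exact h

/-- The number of left labels minus right labels in `[d.1, d.2)` telescopes to whether `d.2` is
enclosed by the pair minus whether `d.1` is. -/
lemma totalFlavor_eq {d p : ℕ × ℕ} (hp : p.1 < p.2) (hd : d.1 < d.2) :
    totalFlavor d p = (if p.1 < d.2 ∧ d.2 ≤ p.2 then 1 else 0) -
      (if p.1 < d.1 ∧ d.1 ≤ p.2 then 1 else 0) := by
  have h : ∀ s, flavorSymbol s p = (if s = p.1 then 1 else 0) - (if s = p.2 then 1 else 0) := by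
    intro s
    unfold flavorSymbol
    split_ifs <;> first | rfl | omega
  simp only [totalFlavor, h, Finset.sum_sub_distrib, Finset.sum_ite_eq', Finset.mem_Ico]
  split_ifs <;> first | rfl | omega

/-- Each flavor occurs with coefficient `0` or `±1`, so the condition only says that at most one
flavor flows through the channel. -/
lemma flavorAllowed_iff {d : ℕ × ℕ} (hd : d.1 < d.2) : FlavorAllowed α d ↔
    ∀ p ∈ flavors α, ∀ q ∈ flavors α, totalFlavor d p ≠ 0 → totalFlavor d q ≠ 0 → p = q := by
  have hp : ∀ p ∈ flavors α, totalFlavor d p = 0 ∨ totalFlavor d p = 1 ∨ totalFlavor d p = -1 := by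
    intro p hp
    rw [totalFlavor_eq _ hd]
    · split_ifs <;> simp
    · rcases mem_flavors.1 hp with rfl | ⟨a, h1, -, rfl⟩
      · simp
      · exact h1.range.2.1
  constructor
  · rintro (h | ⟨r, hr, h1, h2⟩) p hp q hq hp0 hq0
    · exact absurd (h p hp) hp0
    · have h3 : p = r := by
        by_contra h; exact hp0 (h2 p hp h)
      have h4 : q = r := by
        by_contra h; exact hq0 (h2 q hq h)
      rw [h3, h4]
  · intro h
    by_cases h0 : ∃ p ∈ flavors α, totalFlavor d p ≠ 0
    · obtain ⟨p, hpf, hp0⟩ := h0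
      refine .inr ⟨p, hpf, by have := hp p hpf; tauto, fun q hq hqp => ?_⟩
      by_contra hq0
      exact hqp (h q hq p hpf hq0 hp0)
    · push Not at h0
      exact .inl h0

/-- The vertex `v` is enclosed by the pair with left label `a`. -/
def Enclosed (α : List Block) (a v : ℕ) : Prop := a < v ∧ v ≤ en α a

/-- The flavor `(1, 2)` belongs to the root: it separates the vertex `2` from `3, …, n + 1`, which
are the vertices enclosed by the label `2`. -/
lemma totalFlavor_ne_zero_iff {a s t : ℕ} (ha : IsLabel α a) (hs : 2 ≤ s) (hst : s < t)
    (ht : t ≤ numPts α + 1) :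
    totalFlavor (chord (numPts α) s t) (if a = 2 then (1, 2) else (a, en α a)) ≠ 0 ↔
      ¬ (Enclosed α a s ↔ Enclosed α a t) := by
  have hr := ha.range
  have h2 : a ≠ 2 → en α a < numPts α + 1 := fun h => by
    have h3 := ha.en_lt_en_nd h
    have := le_en_nd (α := α) (v := a) (by omega) (by omega)
    omega
  have h3 := en_two (α := α)
  rw [totalFlavor_eq (by split_ifs <;> simp; omega)
    (by rw [chord_eq hst hs ht]; split_ifs <;> simp <;> omega), chord_eq hst hs ht]
  unfold Enclosed
  by_cases ha2 : a = 2
  · subst ha2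
    rw [h3]
    simp only [if_true]
    split_ifs <;> simp only [ne_eq, not_true_eq_false, not_false_eq_true, true_iff, false_iff,
      not_not, sub_self, sub_zero, zero_sub, neg_eq_zero, one_ne_zero] <;> omega
  · specialize h2 ha2
    simp only [ha2, if_false]
    split_ifs <;> simp only [ne_eq, not_true_eq_false, not_false_eq_true, true_iff, false_iff,
      not_not, sub_self, sub_zero, zero_sub, neg_eq_zero, one_ne_zero] <;> omega

lemma flavorAllowed_chord_iff {s t : ℕ} (hs : 2 ≤ s) (hst : s < t) (ht : t ≤ numPts α + 1) :
    FlavorAllowed α (chord (numPts α) s t) ↔ ∀ a b, IsLabel α a → IsLabel α b →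
      ¬ (Enclosed α a s ↔ Enclosed α a t) → ¬ (Enclosed α b s ↔ Enclosed α b t) → a = b := by
  rw [flavorAllowed_iff (by rw [chord_eq hst hs ht]; split_ifs <;> simp <;> omega)]
  have key : ∀ a, IsLabel α a → (if a = 2 then (1, 2) else (a, en α a)) ∈ flavors α := by
    intro a ha
    rw [mem_flavors]
    have := ha.range
    split_ifs with h
    · exact .inl rfl
    · exact .inr ⟨a, ha, by omega, rfl⟩
  have key2 : ∀ p ∈ flavors α, ∃ a, IsLabel α a ∧ p = if a = 2 then (1, 2) else (a, en α a) := by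
    intro p hp
    rcases mem_flavors.1 hp with rfl | ⟨a, h1, h3, rfl⟩
    · exact ⟨2, isLabel_two, by simp⟩
    · exact ⟨a, h1, by rw [if_neg (by omega)]⟩
  constructor
  · intro h a b ha hb h1 h2
    have := h _ (key a ha) _ (key b hb) ((totalFlavor_ne_zero_iff ha hs hst ht).2 h1)
      ((totalFlavor_ne_zero_iff hb hs hst ht).2 h2)
    have := ha.range
    have := hb.range
    split_ifs at * <;> simp only [Prod.mk.injEq] at * <;> omega
  · intro h p hp q hq h1 h2
    obtain ⟨a, ha, rfl⟩ := key2 p hp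
    obtain ⟨b, hb, rfl⟩ := key2 q hq
    rw [h a b ha hb ((totalFlavor_ne_zero_iff ha hs hst ht).1 h1)
      ((totalFlavor_ne_zero_iff hb hs hst ht).1 h2)]

lemma Enclosed.le_nd {a v : ℕ} (ha : IsLabel α a) (h : Enclosed α a v) : a ≤ nd α v :=
  ha.le_nd h.1 h.2

lemma enclosed_nd {v : ℕ} (h1 : 3 ≤ v) (h2 : v ≤ numPts α + 1) : Enclosed α (nd α v) v :=
  ⟨nd_lt h1 h2, (le_en_nd h1 h2).1⟩

lemma enclosed_iff {a v : ℕ} (ha : IsLabel α a) (h1 : 3 ≤ v) (h2 : v ≤ numPts α + 1) :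
    Enclosed α a v ↔ a = nd α v ∨ Enclosed α a (nd α v) := by
  have h3 := nd_lt h1 h2
  have h4 := le_en_nd h1 h2
  constructor
  · intro h
    rcases eq_or_lt_of_le (h.le_nd ha) with h5 | h5
    · exact .inl h5
    · exact .inr ⟨h5, by have := h.2; omega⟩
  · rintro (rfl | h)
    · exact enclosed_nd h1 h2
    · have h5 := ha.range
      have h6 := h.1
      have h7 := ha.en_nd_le h.1 h.2
      have h8 := (isLabel_nd h1 h2).en_lt_en_nd (by omega)
      exact ⟨by omega, by omega⟩

lemma not_enclosed_two {a : ℕ} (ha : IsLabel α a) : ¬ Enclosed α a 2 := by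
  have := ha.range
  unfold Enclosed
  omega

/-- Two vertices whose innermost pairs are equal or parent and child. -/
def Related (α : List Block) (u v : ℕ) : Prop :=
  nd α u = nd α v ∨ nd α (nd α u) = nd α v ∨ nd α u = nd α (nd α v)

/-- The pairs enclosing `v` are `nd α v` and the pairs enclosing the vertices of its parent level,
such as `u`. Only `nd α v` can separate the two. -/
lemma eq_nd_of_not_enclosed_iff {a u v : ℕ} (ha : IsLabel α a) (hu : 2 ≤ u)
    (hu' : u ≤ numPts α + 1) (hv : 3 ≤ v) (hv' : v ≤ numPts α + 1)
    (h : nd α u = nd α (nd α v)) (hne : ¬ (Enclosed α a u ↔ Enclosed α a v)) : a = nd α v := by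
  by_contra hcon
  apply hne
  rw [enclosed_iff ha hv hv']
  simp only [hcon, false_or]
  have h1 := two_le_nd hv hv'
  have h2 := nd_lt hv hv'
  rcases eq_or_lt_of_le hu with rfl | hu
  · rw [nd_two] at h
    have h4 : nd α v = 2 := by
      by_contra h3
      have := two_le_nd (α := α) (v := nd α v) (by omega) (by omega)
      omega
    rw [h4]
  · have h5 := two_le_nd (α := α) hu hu'
    have h6 : 3 ≤ nd α v := by
      by_contra h3
      have h4 : nd α v = 2 := by omega
      rw [h4, nd_two] at h
      omega
    rw [enclosed_iff ha hu hu', enclosed_iff ha h6 (by omega), h]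

/-- The pair `nd α s` separates `s` from `t`, hence is the only one that does. So `nd α t` encloses
`s`, and the parent of `nd α s` encloses `t`; comparing labels, that parent is `nd α t`. -/
lemma related_of_not_enclosed {s t : ℕ} (hs : 3 ≤ s) (hs' : s ≤ numPts α + 1) (ht : 3 ≤ t)
    (ht' : t ≤ numPts α + 1) (hst : nd α s ≠ nd α t)
    (h : ∀ a b, IsLabel α a → IsLabel α b →
      ¬ (Enclosed α a s ↔ Enclosed α a t) → ¬ (Enclosed α b s ↔ Enclosed α b t) → a = b)
    (hne : ¬ Enclosed α (nd α s) t) : nd α (nd α s) = nd α t := by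
  have hls := isLabel_nd hs hs'
  have hlt := isLabel_nd ht ht'
  have e1 := enclosed_nd hs hs'
  have e2 := enclosed_nd ht ht'
  have h1 : Enclosed α (nd α t) s := by
    by_contra hcon
    exact hst (h _ _ hls hlt (by tauto) (by tauto))
  rw [enclosed_iff hlt hs hs'] at h1
  have h1' := h1.resolve_left (Ne.symm hst)
  have h2 := hlt.range
  have h3 := h1'.1
  have h4 := nd_lt hs hs'
  have h5 := nd_lt (α := α) (v := nd α s) (by omega) (by omega)
  have hlss := isLabel_nd (α := α) (v := nd α s) (by omega) (by omega)
  refine le_antisymm ?_ (h1'.le_nd hlt)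
  apply Enclosed.le_nd hlss
  by_contra hcon
  have h6 : Enclosed α (nd α (nd α s)) s := by
    rw [enclosed_iff hlss hs hs']
    exact .inr (enclosed_nd (by omega) (by omega))
  have := h _ _ hls hlss (by tauto) (by tauto)
  omega

/-- The pairs enclosing a vertex form the chain of ancestors of its innermost pair. The channel is
allowed when the chains of `s` and `t` differ in at most one member. -/
lemma flavorAllowed_iff_related {s t : ℕ} (hs : 2 ≤ s) (hst : s < t) (ht : t ≤ numPts α + 1) :
    FlavorAllowed α (chord (numPts α) s t) ↔ Related α s t := by
  rw [flavorAllowed_chord_iff hs hst ht]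
  have ht2 := two_le_nd (α := α) (v := t) (by omega) ht
  have ht3 := nd_lt (α := α) (v := t) (by omega) ht
  have hlt := isLabel_nd (α := α) (v := t) (by omega) ht
  constructor
  · intro h
    rcases eq_or_lt_of_le hs with rfl | hs3
    · right; right
      have h1 := h 2 (nd α t) isLabel_two hlt
        (by have := not_enclosed_two (isLabel_two (α := α))
            have : Enclosed α 2 t := ⟨by omega, by rw [en_two]; omega⟩
            tauto)
        (by have := not_enclosed_two hlt
            have := enclosed_nd (α := α) (v := t) (by omega) ht
            tauto)
      rw [← h1, nd_two]
    · by_cases h1 : nd α s = nd α t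
      · exact .inl h1
      by_cases h2 : Enclosed α (nd α s) t
      · by_cases h3 : Enclosed α (nd α t) s
        · have := h2.le_nd (isLabel_nd hs3 (by omega))
          have := h3.le_nd hlt
          omega
        · right; right
          refine (related_of_not_enclosed (by omega) ht hs3 (by omega) (Ne.symm h1) ?_ h3).symm
          intro a b ha hb h4 h5
          exact h a b ha hb (by tauto) (by tauto)
      · right; left
        exact related_of_not_enclosed hs3 (by omega) (by omega) ht h1 h h2
  · rintro (h | h | h) a b ha hb h1 h2
    · have h3 : 3 ≤ s := by
        by_contra hcon
        have : s = 2 := by omega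
        rw [this, nd_two] at h
        omega
      rw [enclosed_iff ha h3 (by omega), enclosed_iff ha (by omega) ht, h] at h1
      exact absurd Iff.rfl h1
    · have h3 : 3 ≤ s := by
        by_contra hcon
        have : s = 2 := by omega
        rw [this, nd_two, nd, if_pos (by omega)] at h
        omega
      rw [eq_nd_of_not_enclosed_iff ha (by omega) ht h3 (by omega) h.symm (by tauto),
        eq_nd_of_not_enclosed_iff hb (by omega) ht h3 (by omega) h.symm (by tauto)]
    · rw [eq_nd_of_not_enclosed_iff ha hs (by omega) (by omega) ht h h1,
        eq_nd_of_not_enclosed_iff hb hs (by omega) (by omega) ht h h2]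

/-- The pairs of vertices of the planar variables. -/
def IsDiag (α : List Block) (u v : ℕ) : Prop :=
  2 ≤ u ∧ u + 2 ≤ v ∧ v ≤ numPts α + 1 ∧ ¬ (u = 2 ∧ v = numPts α + 1)

lemma IsDiag.mem {u v : ℕ} (h : IsDiag α u v) : chord (numPts α) u v ∈ diagonals α := by
  unfold IsDiag at h
  exact (chord_mem_diagonals (by omega) h.1 h.2.2.1).2 ⟨h.2.1, h.2.2.2⟩

lemma mem_diagonals_iff {d : ℕ × ℕ} :
    d ∈ diagonals α ↔ ∃ u v, IsDiag α u v ∧ d = chord (numPts α) u v := by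
  constructor
  · intro h
    obtain ⟨u, v, h1, h2, h3, h4, h5⟩ := exists_chord h
    exact ⟨u, v, ⟨h1, h2, h3, h4⟩, h5⟩
  · rintro ⟨u, v, h, rfl⟩
    exact h.mem

lemma IsDiag.chord_eq_iff {u v u' v' : ℕ} (h : IsDiag α u v) (h' : IsDiag α u' v') :
    chord (numPts α) u v = chord (numPts α) u' v' ↔ u = u' ∧ v = v' := by
  unfold IsDiag at h h'
  constructor
  · exact chord_injective (by omega) (by omega) (by omega) (by omega) (by omega) (by omega)
  · rintro ⟨rfl, rfl⟩; rfl

lemma IsDiag.flavorAllowed_iff {u v : ℕ} (h : IsDiag α u v) :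
    FlavorAllowed α (chord (numPts α) u v) ↔ Related α u v := by
  unfold IsDiag at h
  exact flavorAllowed_iff_related h.1 (by omega) (by omega)

lemma IsDiag.mem_allowed_iff {u v : ℕ} (h : IsDiag α u v) :
    chord (numPts α) u v ∈ allowed α ↔ Related α u v := by
  rw [allowed, Finset.mem_filter, h.flavorAllowed_iff]
  exact and_iff_right h.mem

lemma mem_allowed_iff {d : ℕ × ℕ} :
    d ∈ allowed α ↔ ∃ u v, IsDiag α u v ∧ Related α u v ∧ d = chord (numPts α) u v := by
  constructor
  · intro h
    obtain ⟨u, v, h1, rfl⟩ := mem_diagonals_iff.1 (Finset.mem_filter.1 h).1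
    exact ⟨u, v, h1, h1.mem_allowed_iff.1 h, rfl⟩
  · rintro ⟨u, v, h1, h2, rfl⟩
    exact h1.mem_allowed_iff.2 h2

end

end BiColor

namespace BiColor

section

variable {α : List Block}

/-! The preferred basis -/

/-- The pairs of vertices of the variables of the preferred basis. -/
def Basic (α : List Block) (u v : ℕ) : Prop :=
  (nd α u = nd α v ∧ (u = pv α v ∨ u = nd α v + 1)) ∨ (u = nd α v ∧ v = en α u)

lemma Basic.related {u v : ℕ} (h : Basic α u v) : Related α u v := by
  unfold Basic Related at *
  rcases h with h | h
  · exact .inl h.1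
  · right; right; rw [h.1]

lemma NonBasic.isDiag {u v : ℕ} (h : NonBasic α u v) : IsDiag α u v := by
  obtain ⟨hu, hv, hv', h⟩ := h
  have h1 := nd_lt hv hv'
  have h2 := two_le_nd hv hv'
  have h6 := le_en_nd hv hv'
  have h0 := nd_two (α := α)
  have h7 := en_two (α := α)
  have h8 : v = nd α v + 1 → pv α v = nd α v := pv_of_eq hv hv'
  have h9 := fun h => pv_of_ne (α := α) hv hv' h
  refine ⟨hu, ?_, hv', ?_⟩
  · rcases h with ⟨h3, h4, h5⟩ | ⟨h3, h4, h5⟩ | ⟨h3, h4, h5⟩ | ⟨h3, h4, h5⟩ | ⟨h3, h4⟩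
    · omega
    · have hu3 : 3 ≤ u := by
        by_contra hcon
        have : u = 2 := by omega
        rw [this, nd_two, nd, if_pos (by omega)] at h3
        omega
      have := nd_le_pv hu3 hv' h3 h4
      have := le_en_nd (α := α) hu3 (by omega)
      by_cases v = nd α v + 1 <;> omega
    · omega
    · omega
    · omega
  · rintro ⟨rfl, rfl⟩
    have h0' : nd α 0 = 0 := by simp [nd]
    rw [nd_last] at *
    rw [nd_two] at h
    rw [h0'] at h
    omega

lemma related_iff {u v : ℕ} (h : IsDiag α u v) : Related α u v ↔ Basic α u v ∨ NonBasic α u v := by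
  obtain ⟨hu, huv, hv', h⟩ := h
  have h1 := nd_lt (α := α) (v := v) (by omega) hv'
  have h2 := two_le_nd (α := α) (v := v) (by omega) hv'
  constructor
  · intro hr
    by_cases hA : nd α u = nd α (nd α v)
    · have hle : u ≤ nd α v := by
        by_contra hcon
        have h3 : 3 ≤ nd α v := by
          by_contra h4
          have h5 : nd α v = 2 := by omega
          have := two_le_nd (α := α) (v := u) (by omega) (by omega)
          rw [hA, h5, nd_two] at this
          omega
        have h4 := isLabel_nd (α := α) (v := v) (by omega) hv'
        have h5 := h4.le_nd (w := u) (by omega) (by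
          have := (le_en_nd (α := α) (v := v) (by omega) hv').1
          omega)
        have := h4.nd_lt
        omega
      by_cases h3 : u = nd α v
      · by_cases h4 : v = en α u
        · exact .inl (.inr ⟨h3, h4⟩)
        · exact .inr ⟨hu, by omega, hv', .inr (.inr (.inr (.inl ⟨h3, by omega, h4⟩)))⟩
      · exact .inr ⟨hu, by omega, hv', .inr (.inr (.inr (.inr ⟨hA, by omega⟩)))⟩
    · have hu3 : 3 ≤ u := by
        by_contra hcon
        have h3 : u = 2 := by omega
        have h0 : nd α 0 = 0 := by simp [nd]
        unfold Related at hr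
        rw [h3, nd_two, h0] at hr
        rw [h3, nd_two] at hA
        omega
      rcases hr with hr | hr | hr
      · have h3 := le_pv hu3 hv' hr (by omega)
        by_cases h4 : u = nd α v + 1 ∨ u = pv α v
        · exact .inl (.inl ⟨hr, by tauto⟩)
        · have := nd_lt (α := α) hu3 (by omega)
          exact .inr ⟨hu, by omega, hv', .inl ⟨hr, by omega, by omega⟩⟩
      · have hk := nd_le_pv hu3 hv' hr (by omega)
        by_cases h4 : nd α u = pv α v
        · exact .inr ⟨hu, by omega, hv', .inr (.inr (.inl ⟨hr, h4, by omega⟩))⟩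
        · exact .inr ⟨hu, by omega, hv', .inr (.inl ⟨hr, by omega, by omega⟩)⟩
      · exact absurd hr hA
  · rintro (h | h)
    · exact h.related
    · obtain ⟨-, -, -, h⟩ := h
      unfold Related
      rcases h with h | h | h | h | h
      · exact .inl h.1
      · exact .inr (.inl h.1)
      · exact .inr (.inl h.1)
      · right; right; rw [← h.1]
      · exact .inr (.inr h.1)

lemma NonBasic.not_basic {u v : ℕ} (h : NonBasic α u v) : ¬ Basic α u v := by
  obtain ⟨hu, hv, hv', h⟩ := h
  have h1 := nd_lt hv hv'
  have h2 := two_le_nd hv hv'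
  have h6 := (isLabel_nd hv hv').nd_lt
  unfold Basic
  rcases h with ⟨h3, h4, h5⟩ | ⟨h3, h4, h5⟩ | ⟨h3, h4, h5⟩ | ⟨h3, h4, h5⟩ | ⟨h3, h4⟩
  · rintro (⟨-, h7⟩ | ⟨h7, -⟩) <;> omega
  · rintro (⟨h7, -⟩ | ⟨h7, -⟩)
    · rw [h7] at h3; omega
    · rw [h7] at h3
      rcases Nat.lt_or_ge (nd α v) 3 with h8 | h8
      · have h9 : nd α v = 2 := by omega
        have h0 : nd α 0 = 0 := by simp [nd]
        rw [h9, nd_two, h0] at h3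
        omega
      · have := (isLabel_nd (α := α) h8 (by omega)).nd_lt
        omega
  · rintro (⟨h7, -⟩ | ⟨h7, -⟩)
    · rw [h7] at h3; omega
    · rw [h7] at h4
      have : v = nd α v + 1 → pv α v = nd α v := pv_of_eq hv hv'
      have := fun h => pv_of_ne (α := α) hv hv' h
      omega
  · rintro (⟨h7, -⟩ | ⟨-, h7⟩)
    · rw [h3] at h7; omega
    · exact h5 h7
  · rintro (⟨h7, -⟩ | ⟨h7, -⟩) <;> omega

mutual
lemma Block.mem_basis : ∀ (B : Block) (s : ℕ) (d : ℕ × ℕ), d ∈ B.basis s ↔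
    ∃ a bs, (a, bs) ∈ B.levels s ∧ d ∈ basisLevel (a + 1 + sizes bs) a (place (a + 1) bs)
  | .adj, s, d => by simp [Block.basis, Block.levels]
  | .pair cs, s, d => by
      simp only [Block.basis, Block.levels, List.mem_append, List.mem_cons, mem_basisList cs,
        Prod.mk.injEq]
      constructor
      · rintro (h | ⟨a, bs, h1, h2⟩)
        · exact ⟨s, cs, .inl ⟨rfl, rfl⟩, by rwa [add_right_comm]⟩
        · exact ⟨a, bs, .inr h1, h2⟩
      · rintro ⟨a, bs, ⟨rfl, rfl⟩ | h1, h2⟩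
        · left; rwa [add_right_comm]
        · exact .inr ⟨a, bs, h1, h2⟩
lemma mem_basisList : ∀ (cs : List Block) (s : ℕ) (d : ℕ × ℕ), d ∈ basisList cs s ↔
    ∃ a bs, (a, bs) ∈ levelsList cs s ∧ d ∈ basisLevel (a + 1 + sizes bs) a (place (a + 1) bs)
  | [], s, d => by simp [basisList, levelsList]
  | B :: cs, s, d => by
      simp only [basisList, levelsList, List.mem_append, Block.mem_basis B, mem_basisList cs]
      constructor
      · rintro (⟨a, bs, h1, h2⟩ | ⟨a, bs, h1, h2⟩)
        · exact ⟨a, bs, .inl h1, h2⟩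
        · exact ⟨a, bs, .inr h1, h2⟩
      · rintro ⟨a, bs, h1 | h1, h2⟩
        · exact .inl ⟨a, bs, h1, h2⟩
        · exact .inr ⟨a, bs, h1, h2⟩
end

/-- The left end of the edge or diagonal closing the polygon of the pair with left label `a`. -/
def closing (α : List Block) (a : ℕ) : ℕ := if a = 2 then 1 else en α a

/-- The basis closes the outermost level with `l₁ = 1` and the inner levels with their right label.
Since `n + 1 ≡ 1`, both are the last vertex of the level. -/
lemma chord_closing (a x : ℕ) :
    chord (numPts α) (closing α a) x = chord (numPts α) (en α a) x := by
  unfold closing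
  split_ifs with h
  · subst h
    simp [chord, en_two]
  · rfl

lemma mem_preferredBasis_iff_levels {d : ℕ × ℕ} : d ∈ preferredBasis α ↔ d ∈ diagonals α ∧
    ∃ a bs, (a, bs) ∈ levels α ∧
      ∃ e ∈ basisLevel (closing α a) a (place (a + 1) bs), chord (numPts α) e.1 e.2 = d := by
  rw [preferredBasis, toDiagonals, Finset.mem_inter, and_comm]
  refine and_congr_right fun _ => ?_
  simp only [List.mem_toFinset, List.mem_map, List.mem_append, mem_basisList]
  constructor
  · rintro ⟨e, h | ⟨a, bs, h1, h2⟩, h3⟩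
    · exact ⟨2, α, by simp [levels], e, by simpa [closing, outer] using h, h3⟩
    · have h' : (a, bs) ∈ levels α := by simp [levels, h1]
      have := levelsList_range _ _ _ _ h1
      refine ⟨a, bs, h', e, ?_, h3⟩
      rwa [closing, if_neg (by omega), en_eq_of_mem h']
  · rintro ⟨a, bs, h, e, h2, h3⟩
    refine ⟨e, ?_, h3⟩
    have h' := h
    simp only [levels, List.mem_cons, Prod.mk.injEq] at h
    rcases h with ⟨rfl, rfl⟩ | h
    · left; simpa [closing, outer] using h2
    · right
      have := levelsList_range _ _ _ _ h
      rw [closing, if_neg (by omega), en_eq_of_mem h'] at h2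
      exact ⟨a, bs, h, h2⟩

lemma mem_zip_place (bs : List Block) (c s z : ℕ) (d : ℕ × ℕ) :
    d ∈ (c :: (place s bs).map Placed.l).zip ((place s bs).map Placed.l ++ [z]) ↔
      (bs = [] ∧ d = (c, z)) ∨ (bs ≠ [] ∧ d = (c, s)) ∨ ∃ γ₁ B γ₂, bs = γ₁ ++ B :: γ₂ ∧
        d = (s + sizes γ₁, if γ₂ = [] then z else s + sizes γ₁ + B.size) := by
  induction bs generalizing c s with
  | nil => simp [place]
  | cons B bs ih =>
    simp only [place, List.map_cons, List.cons_append, List.zip_cons_cons, List.mem_cons, ih]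
    constructor
    · rintro (h | ⟨rfl, rfl⟩ | ⟨h1, rfl⟩ | ⟨γ₁, C, γ₂, rfl, rfl⟩)
      · exact .inr (.inl ⟨by simp, h⟩)
      · exact .inr (.inr ⟨[], B, [], by simp⟩)
      · exact .inr (.inr ⟨[], B, bs, by simp [h1]⟩)
      · exact .inr (.inr ⟨B :: γ₁, C, γ₂, by simp [add_assoc]⟩)
    · rintro (h | ⟨-, h⟩ | ⟨γ₁, C, γ₂, h1, rfl⟩)
      · simp at h
      · exact .inl h
      · right
        rcases γ₁ with _ | ⟨B', γ₁⟩
        · simp only [List.nil_append, List.cons.injEq] at h1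
          obtain ⟨rfl, rfl⟩ := h1
          by_cases h2 : bs = []
          · exact .inl ⟨h2, by simp [h2]⟩
          · exact .inr (.inl ⟨h2, by simp [h2]⟩)
        · simp only [List.cons_append, List.cons.injEq] at h1
          obtain ⟨rfl, rfl⟩ := h1
          exact .inr (.inr ⟨γ₁, C, γ₂, rfl, by simp [add_assoc]⟩)

lemma mem_basisLevel {l r s : ℕ} {bs : List Block} {d : ℕ × ℕ} :
    d ∈ basisLevel l r (place s bs) ↔ (bs = [] ∧ d = (l, l)) ∨ (bs ≠ [] ∧ d = (l, s)) ∨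
      (∃ γ₁ B γ₂, bs = γ₁ ++ B :: γ₂ ∧
        d = (s + sizes γ₁, if γ₂ = [] then l else s + sizes γ₁ + B.size)) ∨ d = (l, r) ∨
      (∃ p ∈ place s bs, d = (p.l, p.r)) ∨
      ∃ B C γ₁ D γ₂, bs = B :: C :: (γ₁ ++ D :: γ₂) ∧ d = (s, s + sizes (B :: C :: γ₁)) := by
  unfold basisLevel
  rw [List.mem_append, List.mem_append, mem_zip_place]
  have h1 : d ∈ (l, r) :: (place s bs).map (fun p => (p.l, p.r)) ↔
      d = (l, r) ∨ ∃ p ∈ place s bs, d = (p.l, p.r) := by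
    simp only [List.mem_cons, List.mem_map, eq_comm (a := d)]
  have h2 : (d ∈ match place s bs with
      | [] => []
      | p :: rest => (rest.drop 1).map fun q : Placed => (p.l, q.l)) ↔
      ∃ B C γ₁ D γ₂, bs = B :: C :: (γ₁ ++ D :: γ₂) ∧ d = (s, s + sizes (B :: C :: γ₁)) := by
    rcases bs with _ | ⟨B, _ | ⟨C, bs⟩⟩
    · simp [place]
    · simp [place]
    · simp only [place, List.drop_one, List.tail_cons, List.mem_map, mem_place]
      constructor
      · rintro ⟨q, ⟨γ₁, D, γ₂, rfl, rfl⟩, rfl⟩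
        exact ⟨B, C, γ₁, D, γ₂, rfl, by simp [add_assoc]⟩
      · rintro ⟨B', C', γ₁, D, γ₂, h, rfl⟩
        simp only [List.cons.injEq] at h
        obtain ⟨rfl, rfl, rfl⟩ := h
        exact ⟨_, ⟨γ₁, D, γ₂, rfl, rfl⟩, by simp [add_assoc]⟩
  refine (or_congr (or_congr Iff.rfl h1) h2).trans ?_
  simp only [or_assoc]

lemma mem_preferredBasis_iff {d : ℕ × ℕ} : d ∈ preferredBasis α ↔
    ∃ u v, IsDiag α u v ∧ Basic α u v ∧ d = chord (numPts α) u v := by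
  rw [mem_preferredBasis_iff_levels]
  have hI : ∀ {u v}, u ≤ v → 2 ≤ u → v ≤ numPts α + 1 → chord (numPts α) u v ∈ diagonals α →
      IsDiag α u v := fun h h1 h2 h3 => by
    have := (chord_mem_diagonals h h1 h2).1 h3
    exact ⟨h1, this.1, h2, this.2⟩
  constructor
  · rintro ⟨hd, a, bs, hl, e, he, rfl⟩
    have hlab : IsLabel α a := ⟨bs, hl⟩
    have hr := hlab.range
    have hen := en_eq_of_mem hl
    rw [mem_basisLevel] at he
    rcases he with ⟨rfl, rfl⟩ | ⟨hne, rfl⟩ | ⟨γ₁, B, γ₂, rfl, rfl⟩ | rfl | ⟨p, hp, rfl⟩ |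
      ⟨B, C, γ₁, D, γ₂, rfl, rfl⟩
    · rw [chord_closing, chord_comm, chord_closing] at hd
      have := hI le_rfl (by omega) (by omega) hd
      unfold IsDiag at this
      omega
    · rw [chord_closing, chord_comm] at hd ⊢
      have := hI (by omega) (by omega) (by omega) hd
      exact ⟨_, _, this, .inl ⟨by rw [hlab.nd_en, hlab.nd_succ], .inr (by rw [hlab.nd_en])⟩, rfl⟩
    · have hx := At.of_mem hl
      have hxr := hx.range
      have h1 : chord (numPts α) (a + 1 + sizes γ₁)
          (if γ₂ = [] then closing α a else a + 1 + sizes γ₁ + B.size) =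
          chord (numPts α) (a + 1 + sizes γ₁) (a + 1 + sizes γ₁ + B.size) := by
        split_ifs with h
        · rw [chord_comm, chord_closing, chord_comm, hen, h]
          simp [add_assoc]
        · rfl
      simp only [h1] at hd ⊢
      simp only [sizes_cons] at hxr
      have := hI (by omega) (by omega) (by omega) hd
      exact ⟨_, _, this, .inl ⟨by rw [hx.nd_eq, hx.succ.nd_eq], .inl (by rw [hx.succ.pv_eq])⟩, rfl⟩
    · rw [chord_closing, chord_comm] at hd ⊢
      have := hI (by omega) (by omega) (by omega) hd
      exact ⟨_, _, this, .inr ⟨by rw [hlab.nd_en], rfl⟩, rfl⟩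
    · obtain ⟨γ₁, B, γ₂, rfl, rfl⟩ := mem_place.1 hp
      have hx := At.of_mem hl
      have hxr := hx.range
      rcases B with _ | cs
      · simp only [Placed.r, Placed.endpt, size_adj, Nat.add_sub_cancel] at hd
        have := hI le_rfl (by omega) (by omega) hd
        unfold IsDiag at this
        omega
      · have hl' : IsLabel α (a + 1 + sizes γ₁) := ⟨_, hx.mem_levels⟩
        have h2 : Placed.r ⟨a + 1 + sizes γ₁, .pair cs⟩ = en α (a + 1 + sizes γ₁) := by
          rw [en_eq_of_mem hx.mem_levels]
          simp [Placed.r, Placed.endpt]; omega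
        rw [h2] at hd ⊢
        have := hl'.range
        dsimp only at hd ⊢
        have := hI (by omega) (by omega) (by omega) hd
        exact ⟨_, _, this, .inr ⟨by rw [hl'.nd_en], rfl⟩, rfl⟩
    · have hx : At α (a + 1 + sizes (B :: C :: γ₁)) a (B :: C :: γ₁) (D :: γ₂) :=
        ⟨by simpa using hl, rfl⟩
      have := hx.range
      have := hI (by omega) (by omega) (by omega) hd
      exact ⟨_, _, this, .inl ⟨by rw [hx.nd_eq, hlab.nd_succ], .inr (by rw [hx.nd_eq])⟩, rfl⟩
  · rintro ⟨u, v, hd, h, rfl⟩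
    refine ⟨hd.mem, ?_⟩
    obtain ⟨h1, h2, h3, h4⟩ := hd
    obtain ⟨β, γ, hv⟩ := exists_at (α := α) (v := v) (by omega) h3
    have hnd := nd_lt (α := α) (v := v) (by omega) h3
    refine ⟨nd α v, β ++ γ, hv.1, ?_⟩
    have key : ∀ B β', β = β' ++ [B] → u = pv α v →
        ∃ e ∈ basisLevel (closing α (nd α v)) (nd α v) (place (nd α v + 1) (β ++ γ)),
          chord (numPts α) e.1 e.2 = chord (numPts α) u v := by
      rintro B β' rfl rfl
      refine ⟨_, mem_basisLevel.2 (.inr (.inr (.inl ⟨β', B, γ, by simp, rfl⟩))), ?_⟩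
      rw [hv.pv_eq]
      split_ifs with h6
      · subst h6
        have := hv.en_eq
        simp at this
        rw [chord_comm, chord_closing, chord_comm, this]
      · congr 1
        have := hv.2
        simp at this ⊢
        omega
    rcases h with ⟨h5, h6⟩ | ⟨h5, h6⟩
    · have hne : v ≠ nd α v + 1 := by
        rcases h6 with h6 | h6
        · intro h7
          rw [pv_of_eq (by omega) h3 h7] at h6
          have := (isLabel_nd (α := α) (v := v) (by omega) h3).nd_lt
          rw [← h6] at this
          omega
        · omega
      rcases List.eq_nil_or_concat β with rfl | ⟨β', B, rfl⟩
      · have := hv.2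
        simp at this
        omega
      rw [List.concat_eq_append] at *
      rcases h6 with h6 | h6
      · exact key B β' rfl h6
      · rcases β' with _ | ⟨C, _ | ⟨D, β'⟩⟩
        · refine key B [] rfl ?_
          rw [hv.pv_eq, h6]
          simp
        all_goals
          rcases γ with _ | ⟨G, γ⟩
          · refine ⟨_, mem_basisLevel.2 (.inr (.inl ⟨by simp, rfl⟩)), ?_⟩
            have := hv.en_eq
            simp at this
            rw [chord_closing, this, h6, chord_comm]
          · refine ⟨(nd α v + 1, v), mem_basisLevel.2 (.inr (.inr (.inr (.inr (.inr ?_))))), ?_⟩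
            · first
              | exact ⟨C, B, [], G, γ, by simp, Prod.ext rfl hv.2⟩
              | exact ⟨C, D, β' ++ [B], G, γ, by simp, Prod.ext rfl hv.2⟩
            · rw [h6]
    · refine ⟨_, mem_basisLevel.2 (.inr (.inr (.inr (.inl rfl)))), ?_⟩
      rw [chord_closing, chord_comm, ← h5, ← h6]

lemma basis_subset_allowed : preferredBasis α ⊆ allowed α := by
  intro d hd
  obtain ⟨u, v, h1, h2, rfl⟩ := mem_preferredBasis_iff.1 hd
  exact h1.mem_allowed_iff.2 h2.related

lemma mem_allowed_sdiff_basis {d : ℕ × ℕ} : d ∈ allowed α \ preferredBasis α ↔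
    ∃ u v, NonBasic α u v ∧ d = chord (numPts α) u v := by
  rw [Finset.mem_sdiff, mem_allowed_iff, mem_preferredBasis_iff]
  constructor
  · rintro ⟨⟨u, v, h1, h2, rfl⟩, h3⟩
    refine ⟨u, v, ?_, rfl⟩
    rcases (related_iff h1).1 h2 with h4 | h4
    · exact absurd ⟨u, v, h1, h4, rfl⟩ h3
    · exact h4
  · rintro ⟨u, v, h, rfl⟩
    refine ⟨⟨u, v, h.isDiag, (related_iff h.isDiag).2 (.inr h), rfl⟩, ?_⟩
    rintro ⟨u', v', h1, h2, h3⟩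
    obtain ⟨rfl, rfl⟩ := (h.isDiag.chord_eq_iff h1).1 h3
    exact h.not_basic h2

/-- The pair of vertices of a basis element, indexed by the particles. -/
def basisPair (α : List Block) (x : ℕ) : ℕ × ℕ :=
  if x = en α (nd α x) then (nd α x, x + 1)
  else if x = nd α x + 1 then (nd α x, en α (nd α x))
  else (nd α x + 1, nx α x)

lemma basisPair_spec {x : ℕ} (h1 : 4 ≤ x) (h2 : x ≤ numPts α) :
    IsDiag α (basisPair α x).1 (basisPair α x).2 ∧
      Basic α (basisPair α x).1 (basisPair α x).2 := by
  have h3 := two_le_nd (α := α) (v := x) (by omega) (by omega)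
  have h4 := nd_lt (α := α) (v := x) (by omega) (by omega)
  have h5 := le_en_nd (α := α) (v := x) (by omega) (by omega)
  have hl := isLabel_nd (α := α) (v := x) (by omega) (by omega)
  have h2e := en_two (α := α)
  unfold basisPair IsDiag Basic
  split_ifs with h6 h7
  · have hne : nd α x ≠ 2 := by
      intro h; rw [h] at h6; omega
    have h8 := hl.nx_eq hne
    have h9 := nx_of_ne (α := α) (v := nd α x) (by omega) (by omega) h8.2
    rw [h8.1, ← h6] at h9
    simp only
    refine ⟨⟨by omega, by omega, by omega, by omega⟩, .inl ⟨by omega, by omega⟩⟩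
  · have h8 := hl.nd_en
    simp only
    refine ⟨⟨by omega, by omega, by omega, by omega⟩, .inr ⟨by omega, by simp⟩⟩
  · have h8 := hl.nd_succ
    have h9 := nx_of_ne (α := α) (v := x) (by omega) (by omega) h6
    simp only
    refine ⟨⟨by omega, by omega, by omega, by omega⟩, .inl ⟨by omega, by omega⟩⟩

lemma basisPair_injective {x y : ℕ} (hx : 4 ≤ x) (hx' : x ≤ numPts α) (hy : 4 ≤ y)
    (hy' : y ≤ numPts α) (h : basisPair α x = basisPair α y) : x = y := by
  have main : ∀ x, 4 ≤ x → x ≤ numPts α → 2 ≤ nd α x ∧ nd α x < x ∧ x ≤ en α (nd α x) ∧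
      nd α (en α (nd α x)) = nd α x ∧ nd α (nd α x + 1) = nd α x ∧ nd α (nd α x) < nd α x ∧
      (x = en α (nd α x) → nd α (nd α x) = nd α (x + 1) ∧ pv α (x + 1) = nd α x) ∧
      (x ≠ en α (nd α x) → nd α (nx α x) = nd α x ∧ pv α (nx α x) = x) := by
    intro x h1 h2
    have hl := isLabel_nd (α := α) (v := x) (by omega) (by omega)
    have h5 := le_en_nd (α := α) (v := x) (by omega) (by omega)
    refine ⟨two_le_nd (by omega) (by omega), nd_lt (by omega) (by omega),
      h5.1, hl.nd_en, hl.nd_succ, hl.nd_lt, fun h => ?_, fun h => ?_⟩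
    · have hne : nd α x ≠ 2 := by
        intro h'; rw [h', en_two] at h; omega
      have h8 := hl.nx_eq hne
      have h9 := nx_of_ne (α := α) (v := nd α x) (by have := hl.range; omega)
        (by have := hl.range; omega) h8.2
      rw [h8.1, ← h] at h9
      omega
    · have := nx_of_ne (α := α) (v := x) (by omega) (by omega) h
      omega
  have h1 := main x hx hx'
  have h2 := main y hy hy'
  unfold basisPair at h
  split_ifs at h <;> simp only [Prod.mk.injEq] at h <;> grind

lemma basisPair_surjective {u v : ℕ} (h : IsDiag α u v) (h' : Basic α u v) :
    ∃ x, 4 ≤ x ∧ x ≤ numPts α ∧ basisPair α x = (u, v) := by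
  obtain ⟨hu, huv, hv', hne⟩ := h
  have h1 := nd_lt (α := α) (v := v) (by omega) hv'
  have h2 := two_le_nd (α := α) (v := v) (by omega) hv'
  have hl := isLabel_nd (α := α) (v := v) (by omega) hv'
  have h5 := le_en_nd (α := α) (v := v) (by omega) hv'
  have h2e := en_two (α := α)
  rcases h' with ⟨h6, h7⟩ | ⟨h6, h7⟩
  · have hu3 : 3 ≤ u := by
      by_contra hcon
      have : u = 2 := by omega
      rw [this, nd_two] at h6
      omega
    have h8 := nd_lt (α := α) hu3 (by omega)
    have hp := pv_of_ne (α := α) (v := v) (by omega) hv' (by omega)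
    by_cases h9 : u = pv α v
    · have hlu := isLabel_of_nx (α := α) hu3 (by omega) (by rw [h9, hp.2.2.2]; omega)
      have h10 := hlu.nx_eq (by omega)
      rw [h9, hp.2.2.2, ← h9] at h10
      refine ⟨v - 1, by omega, by omega, ?_⟩
      have h11 : v - 1 = en α u := by omega
      have h12 := hlu.nd_en
      rw [basisPair, h11, h12, if_pos rfl, ← h10.1]
    · have h10 : u = nd α v + 1 := by tauto
      have h11 := le_pv hu3 hv' h6 (by omega)
      refine ⟨pv α v, by omega, by omega, ?_⟩
      rw [basisPair, hp.2.2.1, if_neg (by omega), if_neg (by omega), hp.2.2.2, ← h10]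
  · have := hl.nd_succ
    have h3 : nd α v ≠ 2 := by
      intro h; rw [h] at h6; rw [h6, h2e] at h7; exact hne ⟨h6, h7⟩
    refine ⟨u + 1, by omega, by omega, ?_⟩
    rw [basisPair, h6, this, if_neg (by rw [← h6, ← h7]; omega), if_pos rfl, ← h6, ← h7]

lemma card_preferredBasis (h : 3 ≤ numPts α) : (preferredBasis α).card + 3 = numPts α := by
  -- There is one basis variable for each of the vertices `4, …, n`. The vertex `3` would give `(2,
  -- n + 1)`, a side of the polygon.
  have : (Finset.Icc 4 (numPts α)).card = (preferredBasis α).card := by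
    refine Finset.card_bij
      (fun x _ => chord (numPts α) (basisPair α x).1 (basisPair α x).2) ?_ ?_ ?_
    · intro x hx
      rw [Finset.mem_Icc] at hx
      have := basisPair_spec hx.1 hx.2
      exact mem_preferredBasis_iff.2 ⟨_, _, this.1, this.2, rfl⟩
    · intro x hx y hy hxy
      rw [Finset.mem_Icc] at hx hy
      have := ((basisPair_spec hx.1 hx.2).1.chord_eq_iff (basisPair_spec hy.1 hy.2).1).1 hxy
      exact basisPair_injective hx.1 hx.2 hy.1 hy.2 (Prod.ext this.1 this.2)
    · intro d hd
      obtain ⟨u, v, h1, h2, rfl⟩ := mem_preferredBasis_iff.1 hd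
      obtain ⟨x, hx, hx', h3⟩ := basisPair_surjective h1 h2
      exact ⟨x, Finset.mem_Icc.2 ⟨hx, hx'⟩, by rw [h3]⟩
  rw [← this, Nat.card_Icc]
  omega

end

end BiColor

namespace BiColor

/-! Triangular systems of equations -/

/-- A triangular system of equations has a unique solution. -/
lemma existsUnique_of_triangular {ι K : Type*} [AddCommGroup K] (A : Finset ι) (ρ : ι → ℕ)
    (M : ι → (ι → K) → K)
    (hM : ∀ d ∈ A, ∀ X X' : ι → K, (∀ e, e ∉ A ∨ ρ e < ρ d → X e = X' e) →
      M d X - X d = M d X' - X' d)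
    (t X₀ : ι → K) : ∃! X : ι → K, (∀ e ∉ A, X e = X₀ e) ∧ ∀ d ∈ A, M d X = t d := by
  classical
  have ex : ∀ k, ∃ X : ι → K, (∀ e ∉ A, X e = X₀ e) ∧ ∀ d ∈ A, ρ d < k → M d X = t d := by
    intro k
    induction k with
    | zero => exact ⟨X₀, fun _ _ => rfl, fun _ _ h => absurd h (Nat.not_lt_zero _)⟩
    | succ k ih =>
      obtain ⟨X, h1, h2⟩ := ih
      -- All coordinates of rank `k` are corrected at once. This does not disturb `M d X - X d` for
      -- `d` of rank at most `k`, which only sees coordinates of lower rank and those outside `A`.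
      let X' : ι → K := fun d => if d ∈ A ∧ ρ d = k then t d - (M d X - X d) else X d
      have hX' : ∀ d, ¬ (d ∈ A ∧ ρ d = k) → X' d = X d := fun d h => if_neg h
      have h3 : ∀ d ∈ A, ρ d ≤ k → M d X' - X' d = M d X - X d := by
        intro d hd hk
        refine hM d hd _ _ fun e he => hX' e ?_
        rintro ⟨h4, h5⟩
        rcases he with he | he
        · exact he h4
        · omega
      refine ⟨X', fun e he => by rw [hX' e (fun h => he h.1), h1 e he], fun d hd hk => ?_⟩
      have h4 := h3 d hd (by omega)
      rcases Nat.lt_or_ge (ρ d) k with h5 | h5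
      · rw [hX' d (by omega), sub_left_inj] at h4
        rw [h4, h2 d hd h5]
      · have h6 : X' d = t d - (M d X - X d) := if_pos ⟨hd, by omega⟩
        rw [sub_eq_iff_eq_add.1 h4, h6]
        abel
  obtain ⟨X, h1, h2⟩ := ex (A.sup ρ + 1)
  refine ⟨X, ⟨h1, fun d hd => h2 d hd (Nat.lt_succ_of_le (Finset.le_sup hd))⟩, ?_⟩
  rintro X' ⟨h3, h4⟩
  have main : ∀ k, ∀ d ∈ A, ρ d = k → X' d = X d := by
    intro k
    induction k using Nat.strong_induction_on with
    | _ k ih =>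
      intro d hd hk
      have := hM d hd X' X (fun e he => by
        by_cases heA : e ∈ A
        · exact ih _ (by have := he.resolve_left (by simpa using heA); omega) e heA rfl
        · rw [h1 e heA, h3 e heA])
      rw [h4 d hd, h2 d hd (Nat.lt_succ_of_le (Finset.le_sup hd))] at this
      exact sub_right_injective this
  funext d
  by_cases hd : d ∈ A
  · exact main _ d hd rfl
  · rw [h1 d hd, h3 d hd]

-- Triangularity of the constraints

section

variable {α : List Block}

lemma not_nonBasic_pv {u : ℕ} (h1 : 3 ≤ u) (h2 : u ≤ numPts α + 1) : ¬ NonBasic α (pv α u) u := by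
  intro h
  by_cases h3 : u = nd α u + 1
  · have := h.isDiag
    rw [pv_of_eq h1 h2 h3] at this
    unfold IsDiag at this
    omega
  · exact h.not_basic (.inl ⟨(pv_of_ne h1 h2 h3).2.2.1, .inl rfl⟩)

lemma not_nonBasic_edge {u v : ℕ} (h : v ≤ u + 1) : ¬ NonBasic α u v := by
  intro h'
  have := h'.isDiag
  unfold IsDiag at this
  omega

/-- A variable with `v` on the level of `u` or above it does not have `v` one level below `u`, so
the case distinction in `rank` is sharp. -/
lemma nd_ne_of_related {u v : ℕ} (hv : 3 ≤ v) (hv' : v ≤ numPts α + 1)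
    (h : nd α u = nd α v ∨ nd α (nd α u) = nd α v) : nd α u ≠ nd α (nd α v) := by
  have h1 := (isLabel_nd hv hv').nd_lt
  have h4 := two_le_nd hv hv'
  have h5 := nd_lt hv hv'
  rcases h with h | h
  · omega
  · intro h3
    rw [h3] at h
    rcases Nat.lt_or_ge (nd α (nd α v)) 3 with h4 | h4
    · have : nd α (nd α (nd α v)) = 0 := by rw [nd, if_pos (by omega)]
      omega
    · have := nd_lt (α := α) h4 (by omega)
      omega

/-- The vertex before a vertex that is not the first one of its pair. -/
lemma nd_pred {u : ℕ} (h1 : 3 ≤ u) (h2 : u ≤ numPts α + 1) (h : u ≠ nd α u + 1) :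
    nd α (u - 1) = nd α u ∨ nd α (nd α (u - 1)) = nd α u := by
  have hp := pv_of_ne h1 h2 h
  have h3 := two_le_nd h1 h2
  by_cases h4 : pv α u = u - 1
  · left; rw [← h4]; exact hp.2.2.1
  · right
    have hl := isLabel_of_nx (α := α) (v := pv α u) (by omega) (by omega) (by omega)
    have := hl.nx_eq (by omega)
    have h5 : u - 1 = en α (pv α u) := by omega
    rw [h5, hl.nd_en]
    exact hp.2.2.1

/-- Lexicographic rank. -/
def lexRank (B k s t : ℕ) : ℕ := (k * B + s) * B + t

lemma lexRank_lt {B k s t k' s' t' : ℕ} (hs : s < B) (ht : t < B)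
    (h : k < k' ∨ (k = k' ∧ (s < s' ∨ (s = s' ∧ t < t')))) :
    lexRank B k s t < lexRank B k' s' t' := by
  unfold lexRank
  have key : ∀ {x y t t' : ℕ}, t < B → x < y → x * B + t < y * B + t' := by
    intro x y t t' ht hxy
    calc x * B + t < x * B + B := by omega
      _ = (x + 1) * B := by ring
      _ ≤ y * B := Nat.mul_le_mul_right _ hxy
      _ ≤ y * B + t' := Nat.le_add_right _ _
  rcases h with h | ⟨rfl, h | ⟨rfl, h⟩⟩
  · exact key ht (key hs h)
  · exact key ht (by omega)
  · omega

/-- The order in which the constraints determine the planar variables. -/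
def rank (α : List Block) (u v : ℕ) : ℕ :=
  if nd α u = nd α (nd α v) then
    lexRank (numPts α + 2) (en α (nd α v) + 1) (numPts α + 2 - v) (numPts α + 1 - u)
  else lexRank (numPts α + 2) v 0 u

/-- `X_{x,y}` is a constant or is determined before `X_{u,v}`. -/
def Lower (α : List Block) (u v x y : ℕ) : Prop :=
  2 ≤ x ∧ x ≤ y ∧ y ≤ numPts α + 1 ∧ (NonBasic α x y → rank α x y < rank α u v)

/-- The six planar variables of the constraint are `X_{u,v}`, with coefficient `1`, and lower
ones. -/
def IsLead (α : List Block) (u v : ℕ) (h : Interval × Interval) : Prop :=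
  Lower α u v h.1.1 h.1.2 ∧ Lower α u v h.2.1 h.2.2 ∧ Lower α u v h.1.1 h.2.2 ∧
    Lower α u v h.1.2 h.2.1 ∧
    ((h.1.1 = u ∧ h.2.1 = v ∧ Lower α u v h.1.2 h.2.2) ∨
      (h.1.2 = u ∧ h.2.2 = v ∧ Lower α u v h.1.1 h.2.1))

lemma lower_of_not {u v x y : ℕ} (h1 : 2 ≤ x) (h2 : x ≤ y) (h3 : y ≤ numPts α + 1)
    (h : ¬ NonBasic α x y) : Lower α u v x y := ⟨h1, h2, h3, fun h' => absurd h' h⟩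

lemma three_le_of_nd_nd {u v : ℕ} (hu : 2 ≤ u) (hv : 3 ≤ v) (hv' : v ≤ numPts α + 1)
    (h : nd α (nd α u) = nd α v) : 3 ≤ u := by
  by_contra hcon
  have h2 := two_le_nd hv hv'
  have : u = 2 := by omega
  rw [this, nd_two, nd, if_pos (by omega)] at h
  omega

/-- Variables whose right end is not on a deeper level are determined in the order of `v`, then of
`u`. -/
lemma lower_of_related {u v x y : ℕ} (hv' : v ≤ numPts α + 1)
    (hA : nd α u ≠ nd α (nd α v)) (h3 : 2 ≤ x) (h4 : x ≤ y) (h5 : 3 ≤ y) (h6 : y ≤ v)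
    (h7 : nd α x = nd α y ∨ nd α (nd α x) = nd α y) (h8 : y < v ∨ x < u) : Lower α u v x y := by
  refine ⟨h3, h4, by omega, fun _ => ?_⟩
  rw [rank, rank, if_neg hA, if_neg (nd_ne_of_related h5 (by omega) h7)]
  exact lexRank_lt (by omega) (by omega) (by omega)

/-- A variable with `v` inside a child pair is ranked at the vertex `en α (nd α v) + 1` just behind
that pair. The middle entry `n + 2 - v` is positive there and `0` for variables on one level, so
even `y = en α (nd α v) + 1` comes before. -/
lemma lower_of_nd_eq {u v x y : ℕ} (hv' : v ≤ numPts α + 1) (hA : nd α u = nd α (nd α v))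
    (h3 : 2 ≤ x) (h4 : x ≤ y) (h5 : 3 ≤ y) (h6 : y ≤ en α (nd α v) + 1)
    (h7 : y ≤ numPts α + 1) (h8 : nd α x = nd α y) : Lower α u v x y := by
  refine ⟨h3, h4, by omega, fun _ => ?_⟩
  rw [rank, rank, if_pos hA, if_neg (nd_ne_of_related h5 (by omega) (.inl h8))]
  exact lexRank_lt (by omega) (by omega) (by omega)

/-- Inside one child pair the order is reversed, since the constraint expresses `X_{u,v}` through
variables with `nx α u` or `nx α v` in place of `u` or `v`. -/
lemma lower_of_parent {u v x y : ℕ} (hA : nd α u = nd α (nd α v)) (h3 : 2 ≤ x) (h4 : x ≤ y)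
    (h5 : v ≤ y) (h6 : nd α y = nd α v) (h7 : y ≤ numPts α + 1)
    (h8 : nd α x = nd α (nd α v)) (h9 : v < y ∨ u < x) : Lower α u v x y := by
  refine ⟨h3, h4, by omega, fun _ => ?_⟩
  rw [rank, rank, if_pos hA, h6, if_pos h8]
  exact lexRank_lt (by omega) (by omega) (by omega)

lemma lower_nx {u v x : ℕ} (h1 : 3 ≤ x) (h2 : x ≤ numPts α + 1) (h : x ≠ en α (nd α x)) :
    Lower α u v x (nx α x) := by
  have hx := nx_of_ne h1 h2 h
  have hE := le_en_nd h1 h2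
  refine lower_of_not (by omega) (by omega) (by omega) ?_
  have := not_nonBasic_pv (α := α) (u := nx α x) (by omega) (by omega)
  rwa [hx.2.2.2.1] at this

lemma pv_of_nd_nd {u a : ℕ} (h1 : 3 ≤ u) (h2 : u ≤ numPts α + 1) (h : nd α (nd α u) = a) :
    2 ≤ pv α u ∧ pv α u < u ∧ ((nd α (pv α u) = nd α u ∧ nd α (nd α (pv α u)) = a) ∨
      (pv α u = nd α u ∧ nd α (pv α u) = a)) := by
  have h5 := nd_lt h1 h2
  have h6 := two_le_nd h1 h2
  by_cases h7 : u = nd α u + 1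
  · have := pv_of_eq h1 h2 h7
    exact ⟨by omega, by omega, .inr ⟨this, by rw [this, h]⟩⟩
  · have := pv_of_ne h1 h2 h7
    exact ⟨by omega, by omega, .inl ⟨this.2.2.1, by rw [this.2.2.1, h]⟩⟩

/-- `J` is the block that ends at `v`, and `X_{u,v}` joins the right ends. The squares of `I` and
`J` are masses, basis variables or constants; the remaining variables end at `pv α v < v`, or at `v`
with a smaller left end. -/
lemma isLead_of_lt_pv {u v : ℕ} (hu : 2 ≤ u) (hv : 3 ≤ v) (hv' : v ≤ numPts α + 1)
    (h3 : (nd α u = nd α v ∧ nd α v + 1 < u ∧ u < pv α v) ∨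
      (nd α (nd α u) = nd α v ∧ u < v ∧ nd α u < pv α v)) :
    IsLead α u v (constraintOf α u v) := by
  have h1 := nd_lt hv hv'
  have h2 := two_le_nd hv hv'
  have hu3 : 3 ≤ u := by
    rcases h3 with h3 | h3
    · omega
    · exact three_le_of_nd_nd hu hv hv' h3.1
  have hlt : u < pv α v := by
    rcases h3 with h3 | h3
    · omega
    · have := nd_le_pv hu3 hv' h3.1 h3.2.1
      have := le_en_nd (α := α) hu3 (by omega)
      omega
  have hne : v ≠ nd α v + 1 := fun h => by
    have := pv_of_eq hv hv' h
    rcases h3 with h3 | h3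
    · omega
    · have := nd_le_pv hu3 hv' h3.1 h3.2.1
      have := (nd_le_pv hu3 hv' h3.1 h3.2.1).2.1.nd_lt
      omega
  have hp := pv_of_ne hv hv' hne
  have hrel : nd α u = nd α v ∨ nd α (nd α u) = nd α v := h3.imp And.left And.left
  have hnA := nd_ne_of_related hv hv' hrel
  rw [constraintOf_of_lt hv hv' (h3.imp And.left fun h => ⟨h.1, h.2.2⟩)]
  have hp1 : ∃ p, (if nd α u = nd α v then u - 1 else pv α u) = p ∧ 2 ≤ p ∧ p < u ∧
      (nd α p = nd α v ∨ nd α (nd α p) = nd α v) ∧ ¬ NonBasic α p u := by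
    refine ⟨_, rfl, ?_⟩
    split_ifs with h4
    · refine ⟨by omega, by omega, ?_, not_nonBasic_edge (by omega)⟩
      have := (isLabel_nd (α := α) hu3 (by omega)).nd_lt
      rw [← h4]
      exact nd_pred hu3 (by omega) (by omega)
    · obtain ⟨h5, h6, h7⟩ := pv_of_nd_nd hu3 (by omega) (hrel.resolve_left h4)
      exact ⟨h5, h6, (h7.imp And.right And.right).symm, not_nonBasic_pv hu3 (by omega)⟩
  obtain ⟨p, hpe, p1, p2, p3, p4⟩ := hp1
  rw [hpe]
  exact ⟨lower_of_not p1 p2.le (by dsimp only; omega) p4,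
    lower_of_not (by dsimp only; omega) (by dsimp only; omega) hv' (not_nonBasic_pv hv hv'),
    lower_of_related hv' hnA p1 (by dsimp only; omega) hv le_rfl p3 (.inr p2),
    lower_of_related hv' hnA hu hlt.le (by dsimp only; omega) hp.2.1.le
      (by dsimp only; rw [hp.2.2.1]; exact hrel) (.inl hp.2.1),
    .inr ⟨rfl, rfl, lower_of_related hv' hnA p1 (by dsimp only; omega) (by dsimp only; omega)
      hp.2.1.le (by dsimp only; rw [hp.2.2.1]; exact p3) (.inr p2)⟩⟩

lemma isLead_of_eq_pv {u v : ℕ} (hu : 2 ≤ u) (hv : 3 ≤ v) (hv' : v ≤ numPts α + 1)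
    (h3 : nd α (nd α u) = nd α v) (h4 : nd α u = pv α v) (h5 : u + 1 < v) :
    IsLead α u v (constraintOf α u v) := by
  have hu3 := three_le_of_nd_nd hu hv hv' h3
  have hk := nd_le_pv hu3 hv' h3 (by omega)
  have hne : v ≠ nd α v + 1 := fun h => by
    have := pv_of_eq hv hv' h
    have := hk.2.1.nd_lt
    omega
  have hp := pv_of_ne hv hv' hne
  have hnA := nd_ne_of_related hv hv' (.inr h3)
  rw [constraintOf_of_eq hv hv' h4 hne]
  have hen : v - 1 = en α (nd α u) := by
    have := hp.2.2.2
    rw [← h4] at this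
    omega
  have hnden := hk.2.1.nd_en
  rw [← hen] at hnden
  obtain ⟨p1, p2, p3⟩ := pv_of_nd_nd hu3 (by omega) h3
  refine ⟨lower_of_not p1 p2.le (by dsimp only; omega) (not_nonBasic_pv hu3 (by omega)),
    lower_of_not (by dsimp only; omega) (by dsimp only; omega) hv'
      (not_nonBasic_edge (by dsimp only; omega)),
    lower_of_related hv' hnA p1 (by dsimp only; omega) hv le_rfl
      (p3.imp And.right And.right).symm (.inr p2),
    lower_of_related hv' hnA hu (by dsimp only; omega) (by dsimp only; omega)
      (by dsimp only; omega) (.inl hnden.symm) (.inl (by dsimp only; omega)),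
    .inr ⟨rfl, rfl, ?_⟩⟩
  -- If `I = l_k`, the variable joining the left ends is `X_{l_k,r_k}`, which belongs to the basis.
  rcases p3 with p3 | p3
  · exact lower_of_related hv' hnA p1 (by dsimp only; omega) (by dsimp only; omega)
      (by dsimp only; omega) (.inl (p3.1.trans hnden.symm)) (.inr p2)
  · refine lower_of_not p1 (by dsimp only; omega) (by dsimp only; omega)
      fun h => h.not_basic (.inr ?_)
    dsimp only
    rw [hnden, p3.1]
    exact ⟨rfl, hen⟩

lemma isLead_of_eq_nd {u v : ℕ} (hu : 2 ≤ u) (hv : 3 ≤ v) (hv' : v ≤ numPts α + 1)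
    (h3 : u = nd α v) (h5 : v ≠ en α u) :
    IsLead α u v (constraintOf α u v) := by
  have h1 := nd_lt hv hv'
  have hE := le_en_nd hv hv'
  have hA : nd α u = nd α (nd α v) := by rw [h3]
  rw [h3] at h5
  have hx := nx_of_ne hv hv' h5
  have hl := (isLabel_nd hv hv').nd_succ
  rw [← h3] at hl
  rw [constraintOf_of_parent hA, if_pos h3]
  exact ⟨lower_of_not hu (by dsimp only; omega) (by dsimp only; omega)
      (not_nonBasic_edge (by dsimp only; omega)),
    lower_nx hv hv' h5,
    lower_of_parent hA hu (by dsimp only; omega) (by dsimp only; omega) hx.2.2.1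
      (by dsimp only; omega) hA (.inl hx.1),
    lower_of_nd_eq hv' hA (by dsimp only; omega) (by dsimp only; omega) hv (by dsimp only; omega)
      hv' (hl.trans h3),
    .inl ⟨rfl, rfl, lower_of_nd_eq hv' hA (by dsimp only; omega) (by dsimp only; omega)
      (by dsimp only; omega) (by dsimp only; omega) (by dsimp only; omega)
      ((hl.trans h3).trans hx.2.2.1.symm)⟩⟩

lemma isLead_of_lt_nd {u v : ℕ} (hu : 2 ≤ u) (hv : 3 ≤ v) (hv' : v ≤ numPts α + 1)
    (h3 : nd α u = nd α (nd α v)) (h4 : u < nd α v) :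
    IsLead α u v (constraintOf α u v) := by
  have h1 := nd_lt hv hv'
  have hE := le_en_nd hv hv'
  have hlab := isLabel_nd hv hv'
  have hu3 : 3 ≤ u := by
    by_contra hcon
    have h6 : u = 2 := by omega
    rw [h6, nd_two] at h3
    have := two_le_nd (α := α) (v := nd α v) (by omega) (by omega)
    omega
  have hlx := hlab.nx_eq (by omega)
  have hxv := nx_of_ne (α := α) (v := nd α v) (by omega) (by omega) hlx.2
  have hEE := le_en_nd (α := α) (v := nd α v) (by omega) (by omega)
  have hy := nx_le (α := α) (v := nd α v) hu3 (by omega) h3 h4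
  have hune : u ≠ en α (nd α u) := by rw [h3]; omega
  have hxu := nx_of_ne (α := α) (v := u) hu3 (by omega) hune
  have hlu := lower_nx (u := u) (v := v) hu3 (by omega) hune
  rw [constraintOf_of_parent h3, if_neg (by omega)]
  -- At the last vertex of the pair, `v + 1` already lies on the parent level, so the variables
  -- ending there have both ends on one level and the descent along the child pair stops.
  by_cases hve : v = en α (nd α v)
  · have hx := (nx_of_eq hv hv' hve).1
    have hw : nd α (v + 1) = nd α (nd α v) := by
      rw [show v + 1 = nx α (nd α v) by omega]; exact hxv.2.2.1
    rw [hx]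
    exact ⟨hlu,
      lower_of_not (by dsimp only; omega) (by dsimp only; omega) (by dsimp only; omega)
        (not_nonBasic_edge (by dsimp only; omega)),
      lower_of_nd_eq hv' h3 hu (by dsimp only; omega) (by dsimp only; omega)
        (by dsimp only; omega) (by dsimp only; omega) (h3.trans hw.symm),
      lower_of_parent h3 (by dsimp only; omega) (by dsimp only; omega) le_rfl rfl hv'
        (hxu.2.2.1.trans h3) (.inr hxu.1),
      .inl ⟨rfl, rfl, lower_of_nd_eq hv' h3 (by dsimp only; omega) (by dsimp only; omega)
        (by dsimp only; omega) (by dsimp only; omega) (by dsimp only; omega)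
        ((hxu.2.2.1.trans h3).trans hw.symm)⟩⟩
  · have hx := nx_of_ne hv hv' hve
    exact ⟨hlu, lower_nx hv hv' hve,
      lower_of_parent h3 hu (by dsimp only; omega) (by dsimp only; omega) hx.2.2.1
        (by dsimp only; omega) h3 (.inl hx.1),
      lower_of_parent h3 (by dsimp only; omega) (by dsimp only; omega) le_rfl rfl hv'
        (hxu.2.2.1.trans h3) (.inr hxu.1),
      .inl ⟨rfl, rfl, lower_of_parent h3 (by dsimp only; omega) (by dsimp only; omega)
        (by dsimp only; omega) hx.2.2.1 (by dsimp only; omega) (hxu.2.2.1.trans h3)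
        (.inl hx.1)⟩⟩

lemma isLead_constraintOf {u v : ℕ} (h : NonBasic α u v) :
    IsLead α u v (constraintOf α u v) := by
  obtain ⟨hu, hv, hv', h⟩ := h
  rcases h with h | h | ⟨h3, h4, h5⟩ | ⟨h3, -, h5⟩ | ⟨h3, h4⟩
  · exact isLead_of_lt_pv hu hv hv' (.inl h)
  · exact isLead_of_lt_pv hu hv hv' (.inr h)
  · exact isLead_of_eq_pv hu hv hv' h3 h4 h5
  · exact isLead_of_eq_nd hu hv hv' h3 h5
  · exact isLead_of_lt_nd hu hv hv' h3 h4

/-- The vertices of a planar variable. -/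
def ends (α : List Block) (d : ℕ × ℕ) : ℕ × ℕ := if d.1 = 1 then (d.2, numPts α + 1) else d

lemma IsDiag.ends_chord {u v : ℕ} (h : IsDiag α u v) :
    ends α (chord (numPts α) u v) = (u, v) := by
  unfold IsDiag at h
  rw [chord_eq (by omega) h.1 h.2.2.1]
  unfold ends
  split_ifs with h1 h2 h2 <;> simp_all

/-- The constraint determining a planar variable. -/
def constraintAt (α : List Block) (d : ℕ × ℕ) : Interval × Interval :=
  constraintOf α (ends α d).1 (ends α d).2

lemma NonBasic.constraintAt_chord {u v : ℕ} (h : NonBasic α u v) :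
    constraintAt α (chord (numPts α) u v) = constraintOf α u v := by
  rw [constraintAt, h.isDiag.ends_chord]

/-- The rank of a planar variable. -/
def rankAt (α : List Block) (d : ℕ × ℕ) : ℕ := rank α (ends α d).1 (ends α d).2

lemma Lower.planar_eq {K : Type*} {u v x y : ℕ} (h : Lower α u v x y) (hd : NonBasic α u v)
    {X X' : ℕ × ℕ → K}
    (hX : ∀ e, e ∉ allowed α \ preferredBasis α ∨
      rankAt α e < rankAt α (chord (numPts α) u v) → X e = X' e) :
    planar (numPts α) X x y = planar (numPts α) X' x y := by
  obtain ⟨h1, h2, h3, h4⟩ := h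
  apply hX
  by_cases h5 : chord (numPts α) x y ∈ allowed α \ preferredBasis α
  · right
    have h6 : IsDiag α x y := by
      have := (chord_mem_diagonals h2 h1 h3).1
        (Finset.mem_filter.1 (Finset.mem_sdiff.1 h5).1).1
      exact ⟨h1, this.1, h3, this.2⟩
    obtain ⟨u', v', h7, h8⟩ := mem_allowed_sdiff_basis.1 h5
    obtain ⟨rfl, rfl⟩ := (h6.chord_eq_iff h7.isDiag).1 h8
    rw [rankAt, rankAt, h6.ends_chord, hd.isDiag.ends_chord]
    exact h4 h7
  · exact .inl h5

variable {K : Type*} [Field K]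

/-- In `-s_{I,J}` the variables joining the two left ends and the two right ends have coefficient
`1`, and `X_d` is one of them. Everything else is lower. -/
lemma mandelstam_triangular {d : ℕ × ℕ} (hd : d ∈ allowed α \ preferredBasis α)
    {X X' : ℕ × ℕ → K}
    (hX : ∀ e, e ∉ allowed α \ preferredBasis α ∨ rankAt α e < rankAt α d → X e = X' e) :
    -mandelstam (numPts α) X (constraintAt α d) - X d =
      -mandelstam (numPts α) X' (constraintAt α d) - X' d := by
  obtain ⟨u, v, h, rfl⟩ := mem_allowed_sdiff_basis.1 hd
  rw [h.constraintAt_chord]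
  obtain ⟨h1, h2, h3, h4, h5⟩ := isLead_constraintOf h
  set c := constraintOf α u v
  have e1 := h1.planar_eq h hX
  have e2 := h2.planar_eq h hX
  have e3 := h3.planar_eq h hX
  have e4 := h4.planar_eq h hX
  unfold mandelstam
  rw [e1, e2, e3, e4]
  rcases h5 with ⟨h6, h7, h8⟩ | ⟨h6, h7, h8⟩
  · rw [h8.planar_eq h hX, h6, h7]
    unfold planar
    ring
  · rw [h8.planar_eq h hX, h6, h7]
    unfold planar
    ring

/-- The variables of the preferred basis are coordinates on the subspace. -/
theorem existsUnique_mem_subspace (b : ℕ × ℕ → K) (c : Interval × Interval → K)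
    (y : ℕ × ℕ → K) :
    ∃! X : ℕ × ℕ → K, X ∈ subspace α b c ∧ ∀ d ∈ preferredBasis α, X d = y d := by
  classical
  have key := existsUnique_of_triangular (allowed α \ preferredBasis α) (rankAt α)
    (fun d X => -mandelstam (numPts α) X (constraintAt α d))
    (fun d hd X X' hX => mandelstam_triangular hd hX) (fun d => c (constraintAt α d))
    (fun e : ℕ × ℕ => if e ∈ preferredBasis α then y e else if e ∈ diagonals α then b e else (0 : K))
  convert key using 2 with X
  have hb : ∀ d ∈ preferredBasis α, d ∈ diagonals α ∧ FlavorAllowed α d := fun d hd =>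
    Finset.mem_filter.1 (basis_subset_allowed hd)
  constructor
  · rintro ⟨⟨h1, h2, h3⟩, h4⟩
    refine ⟨fun e he => ?_, fun d hd => ?_⟩
    · split_ifs with h5 h6
      · exact h4 e h5
      · exact h2 e h6 fun h7 =>
          he (Finset.mem_sdiff.2 ⟨Finset.mem_filter.2 ⟨h6, h7⟩, h5⟩)
      · exact h1 e h6
    · obtain ⟨u, v, h, rfl⟩ := mem_allowed_sdiff_basis.1 hd
      apply h3
      rw [h.constraintAt_chord]
      exact constraintOf_mem h
  · rintro ⟨h1, h2⟩
    refine ⟨⟨fun d hd => ?_, fun d hd hd' => ?_, fun h hh => ?_⟩, fun d hd => ?_⟩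
    · rw [h1 d (fun h => hd (Finset.mem_filter.1 (Finset.mem_sdiff.1 h).1).1),
        if_neg (fun h => hd (hb d h).1), if_neg hd]
    · rw [h1 d (fun h => hd' (Finset.mem_filter.1 (Finset.mem_sdiff.1 h).1).2),
        if_neg (fun h => hd' (hb d h).2), if_pos hd]
    · obtain ⟨u, v, h, rfl⟩ := mem_constraints.1 hh
      rw [← h.constraintAt_chord]
      exact h2 _ (mem_allowed_sdiff_basis.2 ⟨u, v, h, rfl⟩)
    · rw [h1 d (fun h => (Finset.mem_sdiff.1 h).2 hd), if_pos hd]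

end

end BiColor

namespace BiColor

section

variable {α : List Block}

/-! The deformed variables -/

/-- The second block is a pair, and there is a third one. -/
def SecondIsPair (α : List Block) : Prop := ∃ S₂ B₃ Bs, α = .pair S₂ :: B₃ :: Bs

lemma SecondIsPair.mem_levels {S₂ : List Block} {B₃ : Block} {Bs : List Block} :
    (3, S₂) ∈ levels (.pair S₂ :: B₃ :: Bs) := by
  simp [levels, levelsList, Block.levels]

lemma SecondIsPair.l₃_eq (hα : SecondIsPair α) : l₃ α = nx α 3 := by
  obtain ⟨S₂, B₃, Bs, rfl⟩ := hα
  have : At (.pair S₂ :: B₃ :: Bs) 3 2 [] (.pair S₂ :: B₃ :: Bs) := ⟨by simp [levels], by simp⟩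
  rw [this.nx_eq]
  simp [l₃, outer, place]

lemma SecondIsPair.r₂_eq (hα : SecondIsPair α) : r₂ α + 1 = nx α 3 := by
  obtain ⟨S₂, B₃, Bs, rfl⟩ := hα
  have : At (.pair S₂ :: B₃ :: Bs) 3 2 [] (.pair S₂ :: B₃ :: Bs) := ⟨by simp [levels], by simp⟩
  rw [this.nx_eq]
  simp [r₂, outer, place, Placed.r, Placed.endpt]
  omega

lemma SecondIsPair.isLabel (hα : SecondIsPair α) : IsLabel α 3 := by
  obtain ⟨S₂, B₃, Bs, rfl⟩ := hα
  exact ⟨S₂, SecondIsPair.mem_levels⟩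

lemma SecondIsPair.spec (hα : SecondIsPair α) : nx α 3 = en α 3 + 1 ∧ 5 ≤ nx α 3 ∧
    nx α 3 ≤ numPts α ∧ nd α (nx α 3) = 2 := by
  have hl := hα.isLabel
  have hr := hl.range
  have h1 := hl.nx_eq (by omega)
  have h2 := nx_of_ne (α := α) (v := 3) (by omega) (by omega) h1.2
  refine ⟨h1.1, by omega, ?_, by rw [h2.2.2.1, nd_three]⟩
  obtain ⟨S₂, B₃, Bs, rfl⟩ := hα
  rw [h1.1, en_eq_of_mem SecondIsPair.mem_levels]
  have := B₃.size_pos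
  simp [numPts]; omega

lemma mem_place_outer {S₂ : List Block} {B₃ : Block} {Bs : List Block}
    (hα : α = .pair S₂ :: B₃ :: Bs) {p : Placed} :
    p ∈ (outer α).drop 1 ↔ (∃ β γ, At α p.l 2 β (p.block :: γ)) ∧ nx α 3 ≤ p.l := by
  have hs := SecondIsPair.spec ⟨S₂, B₃, Bs, hα⟩
  have h3 : nx α 3 = 3 + (sizes S₂ + 2) := by
    subst hα
    rw [hs.1, en_eq_of_mem SecondIsPair.mem_levels]; omega
  have hd : (outer α).drop 1 = place (nx α 3) (B₃ :: Bs) := by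
    rw [h3, hα]; simp [outer, place]
  rw [hd]
  constructor
  · intro hp
    obtain ⟨β, C, γ, h1, rfl⟩ := mem_place.1 hp
    refine ⟨⟨.pair S₂ :: β, γ, ?_, ?_⟩, by simp⟩
    · simp [levels, hα, h1]
    · simp [h3]; omega
  · rintro ⟨⟨β, γ, h⟩, h1⟩
    obtain ⟨x, C⟩ := p
    have h2 : (⟨x, C⟩ : Placed) ∈ place 3 α := mem_subs_of_at (y := 2) (by simp [levels]) h
    rw [hα, place, List.mem_cons] at h2
    rcases h2 with h2 | h2
    · simp only [Placed.mk.injEq] at h2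
      simp only at h1
      omega
    · rwa [h3, ← size_pair]

lemma chord_mem_toDiagonals {u v : ℕ} (h : IsDiag α u v) {L : List (ℕ × ℕ)} :
    chord (numPts α) u v ∈ toDiagonals α L ↔
      ∃ e ∈ L, chord (numPts α) e.1 e.2 = chord (numPts α) u v := by
  simp [toDiagonals, h.mem]

lemma IsDiag.chord_eq_chord_iff {u v u' v' : ℕ} (h : IsDiag α u v) (hu' : 2 ≤ u')
    (huv : u' < v') (hv' : v' ≤ numPts α + 1) :
    chord (numPts α) u' v' = chord (numPts α) u v ↔ u' = u ∧ v' = v := by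
  unfold IsDiag at h
  constructor
  · exact chord_injective huv hu' hv' (by omega) (by omega) (by omega)
  · rintro ⟨rfl, rfl⟩; rfl

lemma chord_mem_F₁ (hα : SecondIsPair α) {u v : ℕ} (h : IsDiag α u v) :
    chord (numPts α) u v ∈ F₁ α ↔ (v = nx α 3 ∧ (u = 2 ∨ u = 3)) ∨
      (u = 3 ∧ nx α 3 < v ∧ nd α (nd α v) = 2 ∧ v = en α (nd α v)) := by
  have hs := hα.spec
  rw [F₁, chord_mem_toDiagonals h, hα.l₃_eq]
  obtain ⟨S₂, B₃, Bs, hα'⟩ := hα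
  constructor
  · rintro ⟨e, he, h1⟩
    simp only [List.mem_cons, List.mem_map, List.mem_filter] at he
    rcases he with rfl | rfl | ⟨p, ⟨hp, hp2⟩, rfl⟩
    · have := (h.chord_eq_chord_iff (by simp) (by simp; omega) (by simp; omega)).1 h1
      simp only at this
      exact .inl ⟨this.2.symm, .inr this.1.symm⟩
    · have := (h.chord_eq_chord_iff (by simp) (by simp; omega) (by simp; omega)).1 h1
      simp only at this
      exact .inl ⟨this.2.symm, .inl this.1.symm⟩
    · obtain ⟨⟨β, γ, h2⟩, h3⟩ := (mem_place_outer hα').1 hp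
      rcases p with ⟨x, _ | bs⟩
      · simp [Placed.isPair] at hp2
      · simp only at h2 h3
        have hl := h2.mem_levels
        have h4 := en_eq_of_mem hl
        have h5 : Placed.r ⟨x, .pair bs⟩ = en α x := by
          rw [h4]; simp [Placed.r, Placed.endpt]; omega
        have hl' : IsLabel α x := ⟨bs, hl⟩
        have h6 := hl'.range
        have h7 := hl'.nd_en
        dsimp only at h1
        rw [h5] at h1
        have := (h.chord_eq_chord_iff (by simp) (by omega) (by omega)).1 h1
        right
        rw [← this.2, h7]
        exact ⟨this.1.symm, by omega, h2.nd_eq, rfl⟩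
  · rintro (⟨h1, h2 | h2⟩ | ⟨h1, h2, h3, h4⟩)
    · exact ⟨(2, nx α 3), by simp, by rw [h1, h2]⟩
    · exact ⟨(3, nx α 3), by simp, by rw [h1, h2]⟩
    · have hr := h
      unfold IsDiag at hr
      have hl := isLabel_nd (α := α) (v := v) (by omega) (by omega)
      have h5 := nd_lt (α := α) (v := v) (by omega) (by omega)
      have h6 := two_le_nd (α := α) (v := v) (by omega) (by omega)
      have h7 : nd α v ≠ 2 := by intro h7; rw [h7, nd_two] at h3; omega
      obtain ⟨β, bs, γ, hx, hl'⟩ := hl.exists_at (by omega)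
      rw [h3] at hx
      -- The pair ending at `v` begins no earlier than `l₃`: it is a block of the outermost level,
      -- and it is not `B₂` because `v` lies beyond `l₃`.
      have h8 : nx α 3 ≤ nd α v := by
        have h9 := (nd_le_pv (α := α) (u := v) (v := numPts α + 1) (by omega) le_rfl
          (by rw [h3, nd_last]) (by
            rcases eq_or_lt_of_le hr.2.2.1 with h10 | h10
            · rw [h10, nd_last] at h7; omega
            · exact h10))
        have h11 := hl.nx_eq h7
        rcases eq_or_lt_of_le h9.1 with h10 | h10
        · rw [← h10] at h4; omega
        · exact nx_le (by omega) (by omega) (by rw [h3, nd_three]) h10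
      refine ⟨(3, en α (nd α v)), ?_, by rw [h1, ← h4]⟩
      simp only [List.mem_cons, List.mem_map, List.mem_filter]
      right; right
      refine ⟨⟨nd α v, .pair bs⟩, ⟨(mem_place_outer hα').2 ⟨⟨β, γ, hx⟩, h8⟩, rfl⟩, ?_⟩
      rw [en_eq_of_mem hl']
      simp [Placed.r, Placed.endpt]; omega

lemma chord_mem_F₂ (hα : SecondIsPair α) {u v : ℕ} (h : IsDiag α u v) :
    chord (numPts α) u v ∈ F₂ α ↔ u + 1 = nx α 3 ∧ nx α 3 < v ∧ nd α v = 2 := by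
  have hs := hα.spec
  have hr := h
  unfold IsDiag at hr
  have hr2 := hα.r₂_eq
  rw [F₂, chord_mem_toDiagonals h]
  obtain ⟨S₂, B₃, Bs, hα'⟩ := hα
  constructor
  · rintro ⟨e, he, h1⟩
    simp only [List.mem_cons, List.mem_map] at he
    rcases he with rfl | ⟨p, hp, rfl⟩
    · have h2 : chord (numPts α) (r₂ α) 1 = chord (numPts α) (r₂ α) (numPts α + 1) := by
        simp [chord]
      rw [h2] at h1
      have := (h.chord_eq_chord_iff (by omega) (by omega) (by omega)).1 h1
      rw [← this.2, nd_last]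
      omega
    · obtain ⟨⟨β, γ, h2⟩, h3⟩ := (mem_place_outer hα').1 hp
      have h4 := h2.range
      have := (h.chord_eq_chord_iff (by omega) (by simp; omega) (by simp; omega)).1 h1
      rw [← this.2]
      simp only at this ⊢
      exact ⟨by omega, by omega, h2.nd_eq⟩
  · rintro ⟨h1, h2, h3⟩
    have h4 : u = r₂ α := by omega
    obtain ⟨β, γ, hv⟩ := exists_at (α := α) (v := v) (by omega) (by omega)
    rw [h3] at hv
    rcases γ with _ | ⟨C, γ⟩
    · have := hv.en_eq
      rw [en_two] at this
      refine ⟨(r₂ α, 1), by simp, ?_⟩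
      rw [h4, show v = numPts α + 1 by simpa using this.symm]
      simp [chord]
    · refine ⟨(r₂ α, v), ?_, by rw [h4]⟩
      simp only [List.mem_cons, List.mem_map]
      right
      exact ⟨⟨v, C⟩, (mem_place_outer hα').2 ⟨⟨β, γ, hv⟩, h2.le⟩, rfl⟩

lemma chord_mem_F₃a (hα : SecondIsPair α) {u v : ℕ} (h : IsDiag α u v) :
    chord (numPts α) u v ∈ F₃a α ↔ v = nx α 3 ∧ nd α u = 3 := by
  have hs := hα.spec
  have hr := h
  unfold IsDiag at hr
  rw [F₃a, chord_mem_toDiagonals h, hα.l₃_eq]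
  have hlab := hα.isLabel
  obtain ⟨S₂, B₃, Bs, hα'⟩ := hα
  have hl : (3, S₂) ∈ levels α := by rw [hα']; exact SecondIsPair.mem_levels
  have hen := en_eq_of_mem hl
  have ht : ∀ e, (e ∈ ((outer α).take 1).flatMap fun p => p.subs.map fun I => (I.l, nx α 3)) ↔
      ∃ I ∈ place 4 S₂, (I.l, nx α 3) = e := by
    intro e
    have h1 : (outer α).take 1 = [⟨3, .pair S₂⟩] := by rw [hα']; simp [outer, place]
    rw [h1]
    simp [Placed.subs]
  simp only [ht]
  constructor
  · rintro ⟨e, ⟨I, hI, rfl⟩, h1⟩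
    obtain ⟨β, C, γ, rfl, rfl⟩ := mem_place.1 hI
    have hx : At α (4 + sizes β) 3 β (C :: γ) := ⟨hl, rfl⟩
    have := C.size_pos
    simp at hen
    have := (h.chord_eq_chord_iff (by simp; omega) (by simp; omega) (by simp; omega)).1 h1
    simp only at this
    rw [← this.1, hx.nd_eq]
    exact ⟨this.2.symm, rfl⟩
  · rintro ⟨h1, h2⟩
    obtain ⟨β, γ, hv⟩ := exists_at (α := α) (v := u) (by
      by_contra hcon
      have : u = 2 := by omega
      rw [this, nd_two] at h2
      omega) (by omega)
    rw [h2] at hv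
    rcases γ with _ | ⟨C, γ⟩
    · have := hv.en_eq
      simp at this
      omega
    · exact ⟨_, ⟨_, mem_subs_of_at hl hv, rfl⟩, by rw [h1]⟩

lemma mem_zipIdx_place {s m k : ℕ} {bs : List Block} {I : Placed} :
    (I, k) ∈ (place s bs).zipIdx m ↔ ∃ γ₁ C γ₂, bs = γ₁ ++ C :: γ₂ ∧ I = ⟨s + sizes γ₁, C⟩ ∧
      k = m + γ₁.length := by
  induction bs generalizing s m with
  | nil => simp [place]
  | cons B bs ih =>
    rw [place, List.zipIdx_cons, List.mem_cons, ih]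
    constructor
    · rintro (h | ⟨γ₁, C, γ₂, rfl, rfl, rfl⟩)
      · simp only [Prod.mk.injEq] at h
        exact ⟨[], B, bs, by simp, by simp [h.1], by simp [h.2]⟩
      · exact ⟨B :: γ₁, C, γ₂, by simp, by simp [add_assoc], by simp; omega⟩
    · rintro ⟨γ₁, C, γ₂, h1, rfl, rfl⟩
      rcases γ₁ with _ | ⟨B', γ₁⟩
      · simp only [List.nil_append, List.cons.injEq] at h1
        left; simp [h1.1]
      · simp only [List.cons_append, List.cons.injEq] at h1
        obtain ⟨rfl, rfl⟩ := h1
        right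
        exact ⟨γ₁, C, γ₂, rfl, by simp [add_assoc], by simp; omega⟩

lemma length_place (s : ℕ) (bs : List Block) : (place s bs).length = bs.length := by
  induction bs generalizing s with
  | nil => simp [place]
  | cons B bs ih => simp [place, ih]

/-- `rest α v` counts the sub-block at `v` and those behind it, that is `s - ℓ + 1` of them, so the
prefactor `s - ℓ + 2` is `rest α v + 1`. -/
lemma mem_locList (hα : SecondIsPair α) {e : (ℕ × ℕ) × ℕ} : e ∈ locList α ↔
    ∃ v, 3 ≤ v ∧ v ≤ numPts α ∧ nx α 3 < v ∧ nd α (nd α v) = 2 ∧ v ≠ en α (nd α v) ∧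
      e = ((3, v), rest α v + 1) := by
  have hs := hα.spec
  have hn : nx α 3 ≤ numPts α := by omega
  obtain ⟨S₂, B₃, Bs, hα'⟩ := hα
  simp only [locList, List.mem_flatMap, List.mem_map, Prod.exists]
  constructor
  · rintro ⟨p, hp, I, k, hI, rfl⟩
    obtain ⟨⟨β, γ, h2⟩, h3⟩ := (mem_place_outer hα').1 hp
    rcases p with ⟨x, _ | bs⟩
    · simp [Placed.subs] at hI
    simp only [Placed.subs] at hI h2 h3 ⊢
    obtain ⟨γ₁, C, γ₂, rfl, rfl, rfl⟩ := mem_zipIdx_place.1 hI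
    have hl := h2.mem_levels
    have hx := At.of_mem hl
    have hr := hx.range
    have := C.size_pos
    have h5 := hx.en_eq
    simp only [sizes_cons] at hr h5
    refine ⟨x + 1 + sizes γ₁, by omega, by omega, by omega, by rw [hx.nd_eq, h2.nd_eq],
      by rw [hx.nd_eq]; omega, ?_⟩
    rw [hx.rest_eq, length_place]
    simp only [List.length_append, List.length_cons, Prod.mk.injEq, true_and]
    omega
  · rintro ⟨v, h0, h1, h2, h3, h4, rfl⟩
    have hl := isLabel_nd (α := α) (v := v) (by omega) (by omega)
    have h5 := nd_lt (α := α) (v := v) (by omega) (by omega)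
    have h6 := two_le_nd (α := α) (v := v) (by omega) (by omega)
    have h7 : nd α v ≠ 2 := by intro h7; rw [h7, nd_two] at h3; omega
    obtain ⟨β, bs, γ, hx, hl'⟩ := hl.exists_at (by omega)
    rw [h3] at hx
    have h8 : nx α 3 ≤ nd α v := by
      have h9 := le_en_nd (α := α) (v := v) (by omega) (by omega)
      rcases eq_or_lt_of_le (show 3 ≤ nd α v by omega) with h10 | h10
      · rw [← h10] at h9; omega
      · exact nx_le (by omega) (by omega) (by rw [h3, nd_three]) h10
    obtain ⟨c₁, c₂, hv⟩ := exists_at (α := α) (v := v) (by omega) (by omega)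
    rcases c₂ with _ | ⟨D, c₂⟩
    · have := hv.en_eq
      simp at this
      omega
    have h0 : At α (nd α v + 1) (nd α v) [] bs := ⟨hl', by simp⟩
    have h11 := hv.eq_of_label h0
    refine ⟨⟨nd α v, .pair bs⟩, (mem_place_outer hα').2 ⟨⟨β, γ, hx⟩, h8⟩, ⟨v, D⟩, c₁.length, ?_, ?_⟩
    · simp only [Placed.subs]
      exact mem_zipIdx_place.2 ⟨c₁, D, c₂, h11.symm, by rw [← hv.2], by simp⟩
    · simp only [Placed.subs, length_place]
      rw [hv.rest_eq, show bs = c₁ ++ D :: c₂ from h11.symm]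
      simp only [List.length_append, List.length_cons, Prod.mk.injEq, true_and]
      omega

lemma chord_mem_F₃b (hα : SecondIsPair α) {u v : ℕ} (h : IsDiag α u v) :
    chord (numPts α) u v ∈ F₃b α ↔
      u = 3 ∧ nx α 3 < v ∧ nd α (nd α v) = 2 ∧ v ≠ en α (nd α v) := by
  have hs := hα.spec
  have hr := h
  unfold IsDiag at hr
  rw [F₃b, chord_mem_toDiagonals h]
  simp only [List.mem_map]
  constructor
  · rintro ⟨_, ⟨e, he, rfl⟩, h1⟩
    obtain ⟨w, h2, h3, h4, h5, h6, rfl⟩ := (mem_locList hα).1 he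
    obtain ⟨rfl, rfl⟩ := (h.chord_eq_chord_iff (by simp) (by simp; omega) (by simp; omega)).1 h1
    exact ⟨rfl, h4, h5, h6⟩
  · rintro ⟨rfl, h1, h2, h3⟩
    have : v ≠ numPts α + 1 := by
      rintro rfl
      rw [nd_last, nd_two] at h2
      omega
    exact ⟨_, ⟨_, (mem_locList hα).2 ⟨v, by omega, by omega, h1, h2, h3, rfl⟩, rfl⟩, rfl⟩

lemma lookup_eq_some {A B : Type*} [BEq A] [LawfulBEq A] {l : List (A × B)} {g : A → B} {k : A}
    (hg : ∀ e ∈ l, e.2 = g e.1) (hk : ∃ e ∈ l, e.1 = k) : l.lookup k = some (g k) := by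
  induction l with
  | nil => simp at hk
  | cons e l ih =>
    rw [List.lookup_cons]
    split
    · rename_i h
      rw [hg e (by simp), ← eq_of_beq h]
    · rename_i h
      apply ih (fun e he => hg e (by simp [he]))
      obtain ⟨e', he', h1⟩ := hk
      rcases List.mem_cons.1 he' with rfl | he'
      · simp [h1] at h
      · exact ⟨e', he', h1⟩

/-- The coefficient with which `X_{u,v}` is shifted. -/
def shiftCoeff (α : List Block) (u v : ℕ) : ℤ :=
  if v = nx α 3 ∧ u + 1 < nx α 3 ∧ (u = 2 ∨ u = 3 ∨ nd α u = 3) then 1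
  else if u + 1 = nx α 3 ∧ nx α 3 < v ∧ nd α v = 2 then -1
  else if u = 3 ∧ nx α 3 < v ∧ nd α (nd α v) = 2 then rest α v + 1
  else 0

/-- The variables `X_{3,r_i}` of `F⁽¹⁾` and `X_{3,l_I}` of `F⁽³⁾` merge into one family: `v` one
level below the outermost one, behind `l₃`. The prefactor is `rest α v + 1` throughout, with `rest α
v = 0` at `v = r_i`. -/
lemma chord_mem_deformed (hα : SecondIsPair α) {u v : ℕ} (h : IsDiag α u v) :
    chord (numPts α) u v ∈ deformed α ↔
      (v = nx α 3 ∧ u + 1 < nx α 3 ∧ (u = 2 ∨ u = 3 ∨ nd α u = 3)) ∨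
      (u + 1 = nx α 3 ∧ nx α 3 < v ∧ nd α v = 2) ∨
      (u = 3 ∧ nx α 3 < v ∧ nd α (nd α v) = 2) := by
  have hr := h
  unfold IsDiag at hr
  rw [deformed, F₃, Finset.mem_union, Finset.mem_union, Finset.mem_union, chord_mem_F₁ hα h,
    chord_mem_F₂ hα h, chord_mem_F₃a hα h, chord_mem_F₃b hα h]
  constructor
  · rintro ((h1 | h1) | (h1 | h1)) <;> omega
  · rintro (h1 | h1 | h1) <;> omega

lemma lam_chord (hα : SecondIsPair α) {u v : ℕ} (h : IsDiag α u v)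
    (hd : chord (numPts α) u v ∈ deformed α) :
    lam α (chord (numPts α) u v) = shiftCoeff α u v := by
  have hs := hα.spec
  have hr := h
  unfold IsDiag at hr
  rw [chord_mem_deformed hα h] at hd
  unfold lam shiftCoeff
  simp only [chord_mem_F₁ hα h, chord_mem_F₂ hα h, chord_mem_F₃a hα h]
  rcases hd with h1 | h1 | h1
  · rw [if_pos h1]
    split_ifs with h2 h3 h4
    · rfl
    · omega
    · rfl
    · omega
  · rw [if_neg (by omega), if_pos h1, if_neg (by omega), if_pos h1]
  · rw [if_neg (by omega : ¬ (v = nx α 3 ∧ _)), if_neg (by omega : ¬ (v = nx α 3 ∧ _)),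
      if_neg (by omega : ¬ (u + 1 = nx α 3 ∧ _)),
      if_neg (by omega : ¬ (u + 1 = nx α 3 ∧ _)), if_pos h1]
    have h5 := nx_of_eq (α := α) (v := v) (by omega) (by omega)
    split_ifs with h2
    · have : v = en α (nd α v) := by omega
      rw [(h5 this).2]; rfl
    · have hvn : v ≠ numPts α + 1 := by
        rintro rfl
        rw [nd_last, nd_two] at h1
        omega
      rw [chord_of_lt (by omega) (by omega)]
      have := lookup_eq_some (l := locList α) (g := fun d => rest α d.2 + 1) (k := (u, v))
        (by intro e he
            obtain ⟨w, -, -, -, -, -, rfl⟩ := (mem_locList hα).1 he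
            rfl)
        ⟨_, (mem_locList hα).2 ⟨v, by omega, by omega, h1.2.1, h1.2.2, by omega, rfl⟩,
          by rw [h1.1]⟩
      rw [this]
      simp

lemma shiftCoeff_ne_zero (hα : SecondIsPair α) {u v : ℕ} (h : IsDiag α u v) :
    shiftCoeff α u v ≠ 0 ↔ chord (numPts α) u v ∈ deformed α := by
  rw [chord_mem_deformed hα h]
  unfold shiftCoeff
  split_ifs <;> simp_all
  omega

/-- The direction of the shift. -/
def shiftDir (α : List Block) (d : ℕ × ℕ) : ℤ := if d ∈ deformed α then lam α d else 0

lemma deformed_subset_diagonals : deformed α ⊆ diagonals α := by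
  unfold deformed F₁ F₂ F₃ F₃a F₃b toDiagonals
  intro d
  simp only [Finset.mem_union, Finset.mem_inter]
  tauto

lemma shiftDir_chord (hα : SecondIsPair α) {u v : ℕ} (hu : 2 ≤ u) (huv : u ≤ v)
    (hv : v ≤ numPts α + 1) : shiftDir α (chord (numPts α) u v) = shiftCoeff α u v := by
  have hs := hα.spec
  unfold shiftDir
  by_cases h : IsDiag α u v
  · by_cases h' : chord (numPts α) u v ∈ deformed α
    · rw [if_pos h', lam_chord hα h h']
    · rw [if_neg h']
      have := (shiftCoeff_ne_zero hα h).not.2 h'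
      push Not at this
      exact this.symm
  · have h' : chord (numPts α) u v ∉ diagonals α := by
      rw [chord_mem_diagonals huv hu hv]
      unfold IsDiag at h
      tauto
    rw [if_neg (fun h => h' (deformed_subset_diagonals h))]
    unfold IsDiag at h
    unfold shiftCoeff
    rw [if_neg (by omega), if_neg (by omega), if_neg ?_]
    rintro ⟨h1, h2, h3⟩
    omega

lemma mem_deformed_iff {d : ℕ × ℕ} (hα : SecondIsPair α) : d ∈ deformed α ↔
    ∃ u v, IsDiag α u v ∧ shiftCoeff α u v ≠ 0 ∧ d = chord (numPts α) u v := by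
  constructor
  · intro h
    obtain ⟨u, v, h1, rfl⟩ := mem_diagonals_iff.1 (deformed_subset_diagonals h)
    exact ⟨u, v, h1, (shiftCoeff_ne_zero hα h1).2 h, rfl⟩
  · rintro ⟨u, v, h1, h2, rfl⟩
    exact (shiftCoeff_ne_zero hα h1).1 h2

lemma deformed_subset_allowed (hα : SecondIsPair α) : deformed α ⊆ allowed α := by
  intro d hd
  have hs := hα.spec
  obtain ⟨u, v, h1, rfl⟩ := mem_diagonals_iff.1 (deformed_subset_diagonals hd)
  have hr := h1
  unfold IsDiag at hr
  rw [h1.mem_allowed_iff]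
  rw [chord_mem_deformed hα h1] at hd
  unfold Related
  have h3 := nd_three (α := α)
  rcases hd with ⟨rfl, h4, rfl | rfl | h5⟩ | ⟨h4, h5, h6⟩ | ⟨rfl, h4, h5⟩
  · right; right; rw [hs.2.2.2, nd_two]
  · left; rw [h3, hs.2.2.2]
  · right; left; rw [h5, h3, hs.2.2.2]
  · right; left
    rw [show u = en α 3 by omega, hα.isLabel.nd_en, h3, h6]
  · right; right; rw [h3, h5]

lemma lam_ne_zero (hα : SecondIsPair α) {d : ℕ × ℕ} (hd : d ∈ deformed α) : lam α d ≠ 0 := by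
  obtain ⟨u, v, h1, h2, rfl⟩ := (mem_deformed_iff hα).1 hd
  rwa [lam_chord hα h1 hd]

lemma SecondIsPair.isDiag (hα : SecondIsPair α) : IsDiag α 3 (nx α 3) := by
  have := hα.spec
  unfold IsDiag; omega

lemma SecondIsPair.shiftVar_eq (hα : SecondIsPair α) :
    shiftVar α = chord (numPts α) 3 (nx α 3) := by
  rw [shiftVar, hα.l₃_eq]

lemma shiftVar_mem_deformed (hα : SecondIsPair α) : shiftVar α ∈ deformed α := by
  rw [hα.shiftVar_eq, chord_mem_deformed hα hα.isDiag]
  have := hα.spec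
  exact .inl ⟨rfl, by omega, .inr (.inl rfl)⟩

lemma shiftVar_mem_basis (hα : SecondIsPair α) : shiftVar α ∈ preferredBasis α := by
  rw [hα.shiftVar_eq, mem_preferredBasis_iff]
  have := hα.spec
  exact ⟨_, _, hα.isDiag, .inl ⟨by rw [nd_three, this.2.2.2], .inr (by rw [this.2.2.2])⟩, rfl⟩

lemma lam_shiftVar (hα : SecondIsPair α) : lam α (shiftVar α) = 1 := by
  have h := shiftVar_mem_deformed hα
  have := hα.spec
  rw [hα.shiftVar_eq] at h ⊢
  rw [lam_chord hα hα.isDiag h, shiftCoeff, if_pos ⟨rfl, by omega, .inr (.inl rfl)⟩]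

end

end BiColor

-- The direction of the shift satisfies the homogeneous constraints

namespace BiColor

section

variable {α : List Block}

/-- Pairs that begin inside `B₂` end inside it. With `shiftCoeff_of_lt` and `shiftCoeff_of_le`, this
disposes of all constraints supported on one side of `l₃`. -/
lemma SecondIsPair.en_lt (hα : SecondIsPair α) {a : ℕ} (ha : IsLabel α a) (h3 : 3 ≤ a)
    (h : a < nx α 3) : en α a < nx α 3 ∧ (a ≠ 3 → en α a + 1 < nx α 3) := by
  have hs := hα.spec
  have hr := ha.range
  have h1 : a + 1 < nx α 3 := by
    by_contra hcon
    have h2 : nx α 3 = a + 1 := by omega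
    have := ha.nd_succ
    rw [← h2, hs.2.2.2] at this
    omega
  have h2 := hα.isLabel.en_nd_le (w := a + 1) (by omega) (by omega)
  rw [ha.nd_succ] at h2
  refine ⟨by omega, fun h4 => ?_⟩
  have h5 := ha.en_lt_en_nd (by omega)
  have h6 := hα.isLabel.en_nd_le (w := a) (by omega) (by omega)
  omega

lemma SecondIsPair.eq_two (hα : SecondIsPair α) {a v : ℕ} (ha : IsLabel α a) (h : a < nx α 3)
    (hv : nx α 3 ≤ v) (hv' : v ≤ en α a) : a = 2 := by
  by_contra hcon
  have := ha.range
  have := (hα.en_lt ha (by omega) h).1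
  omega

lemma eq_three_of_lt_nx {u : ℕ} (h3 : 3 ≤ u) (hn : u ≤ numPts α + 1) (hu : u < nx α 3)
    (h : nd α u = 2) : u = 3 := by
  by_contra hcon
  have := nx_le (α := α) (x := 3) (v := u) le_rfl hn (by rw [nd_three, h]) (by omega)
  omega

lemma shiftCoeff_of_le (hα : SecondIsPair α) {u v : ℕ} (h : nx α 3 ≤ u) :
    shiftCoeff α u v = 0 := by
  have hs := hα.spec
  unfold shiftCoeff
  rw [if_neg (by omega), if_neg (by omega), if_neg (by omega)]

lemma shiftCoeff_of_lt (hα : SecondIsPair α) {u v : ℕ} (h : v < nx α 3) :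
    shiftCoeff α u v = 0 := by
  have hs := hα.spec
  unfold shiftCoeff
  rw [if_neg (by omega), if_neg (by omega), if_neg (by omega)]

lemma shiftCoeff_succ (hα : SecondIsPair α) {u : ℕ} : shiftCoeff α u (u + 1) = 0 := by
  have hs := hα.spec
  unfold shiftCoeff
  rw [if_neg (by omega), if_neg (by omega), if_neg (by omega)]

/-- The combination of the shift coefficients that enters a Mandelstam variable. -/
def shiftMandelstam (α : List Block) (h : Interval × Interval) : ℤ :=
  shiftCoeff α h.1.1 h.1.2 + shiftCoeff α h.2.1 h.2.2 +
    (shiftCoeff α h.1.1 h.2.2 + shiftCoeff α h.1.2 h.2.1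
      - shiftCoeff α h.1.1 h.2.1 - shiftCoeff α h.1.2 h.2.2)

lemma shiftMandelstam_of_le (hα : SecondIsPair α) {i j k l : ℕ} (hi : nx α 3 ≤ i)
    (hj : nx α 3 ≤ j) (hk : nx α 3 ≤ k) : shiftMandelstam α ((i, j), (k, l)) = 0 := by
  simp [shiftMandelstam, shiftCoeff_of_le hα hi, shiftCoeff_of_le hα hj, shiftCoeff_of_le hα hk]

lemma shiftMandelstam_of_lt (hα : SecondIsPair α) {i j k l : ℕ} (hj : j < nx α 3)
    (hk : k < nx α 3) (hl : l < nx α 3) : shiftMandelstam α ((i, j), (k, l)) = 0 := by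
  simp [shiftMandelstam, shiftCoeff_of_lt hα hj, shiftCoeff_of_lt hα hk, shiftCoeff_of_lt hα hl]

/-- Only the outermost level matters, where `I` is the particle `r₁ = 2`. There `X_{2,v}` and
`X_{3,v}` shift alike, by `1` at `v = l₃` and by `0` behind it. -/
lemma shiftMandelstam_of_eq_nd (hα : SecondIsPair α) {v : ℕ} (hv : 3 ≤ v)
    (hv' : v ≤ numPts α + 1) (h1 : v ≠ nd α v + 1) (h2 : v ≠ en α (nd α v)) :
    shiftMandelstam α ((nd α v, nd α v + 1), (v, nx α v)) = 0 := by
  have hs := hα.spec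
  have h3 := nx_of_ne hv hv' h2
  have hl := isLabel_nd hv hv'
  have h4 := two_le_nd hv hv'
  have h5 := nd_lt hv hv'
  have h6 := le_en_nd hv hv'
  rcases Nat.lt_or_ge (nd α v) (nx α 3) with h | h
  · rcases eq_or_lt_of_le h4 with h7 | h7
    · rw [← h7] at h3 ⊢
      have h8 : nx α 3 ≤ v := nx_le le_rfl hv' (by rw [nd_three, h7]) (by omega)
      have e1 : shiftCoeff α 2 (nx α v) = 0 := by
        unfold shiftCoeff
        rw [if_neg (by omega), if_neg (by omega), if_neg (by omega)]
      have e2 : shiftCoeff α 3 (nx α v) = 0 := by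
        unfold shiftCoeff
        rw [if_neg (by omega), if_neg (by omega), if_neg]
        rw [h3.2.2.1, nd_two]; omega
      have e3 : shiftCoeff α 2 v = shiftCoeff α 3 v := by
        unfold shiftCoeff
        have h9 : nd α (nd α v) = 0 := by rw [← h7, nd_two]
        by_cases h10 : v = nx α 3
        · rw [if_pos (by omega), if_pos (by omega)]
        · rw [if_neg (by omega), if_neg (by omega), if_neg (by omega), if_neg (by omega),
            if_neg (by omega), if_neg (by omega)]
      have e4 : shiftCoeff α 2 (2 + 1) = 0 := shiftCoeff_of_lt hα (by omega)
      have e5 : shiftCoeff α v (nx α v) = 0 := shiftCoeff_of_le hα h8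
      simp only [shiftMandelstam, e1, e3, e4, e5, Nat.reduceAdd, e2]
      ring
    · have := (hα.en_lt hl h7 h).1
      exact shiftMandelstam_of_lt hα (by omega) (by omega) (by omega)
  · exact shiftMandelstam_of_le hα h (by omega) (by omega)

/-- The only case with deformed variables is `I = B₂`, `u = 3`. It reads `1 + λ(X_{3,nx v}) -
λ(X_{3,v}) = 0`, so going back over one sub-block raises the prefactor by one. The recursion starts
from `0` just behind `r_i` and explains the value `s - ℓ + 2`. -/
lemma shiftMandelstam_of_lt_nd (hα : SecondIsPair α) {u v : ℕ} (hu : 2 ≤ u) (hv : 3 ≤ v)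
    (hv' : v ≤ numPts α + 1) (h1 : nd α u = nd α (nd α v)) (h2 : u < nd α v) :
    shiftMandelstam α ((u, nx α u), (v, nx α v)) = 0 := by
  have hs := hα.spec
  have hl := isLabel_nd hv hv'
  have h5 := nd_lt hv hv'
  have h6 := le_en_nd hv hv'
  have hb := two_le_nd (α := α) (v := nd α v) (by omega) (by omega)
  have hbl := isLabel_nd (α := α) (v := nd α v) (by omega) (by omega)
  have hen := le_en_nd (α := α) (v := nd α v) (by omega) (by omega)
  have hu3 : 3 ≤ u := by
    by_contra hcon
    have : u = 2 := by omega
    rw [this, nd_two] at h1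
    omega
  have h7 := nx_le (α := α) hu3 (by omega) h1 h2
  have h8 := nd_lt (α := α) hu3 (by omega)
  have hne : u ≠ en α (nd α u) := by
    rw [h1]; omega
  have h9 := nx_of_ne (α := α) hu3 (by omega) hne
  have hw : v < nx α v ∧ (nx α v ≤ en α (nd α v) ∨ v = en α (nd α v) ∧ nx α v = v + 1) := by
    by_cases hve : v = en α (nd α v)
    · have := nx_of_eq hv hv' hve
      omega
    · have := nx_of_ne hv hv' hve
      omega
  rcases Nat.lt_or_ge u (nx α 3) with h | h
  · rcases Nat.lt_or_ge (nd α v) (nx α 3) with h10 | h10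
    · have := (hα.en_lt hl (by omega) h10).2 (by
        intro h11
        rw [h11] at h2
        omega)
      exact shiftMandelstam_of_lt hα (by omega) (by omega) (by omega)
    · have h11 := hα.eq_two hbl (by omega) h10 (by omega)
      obtain rfl := eq_three_of_lt_nx hu3 (by omega) h (by omega)
      have e1 : shiftCoeff α 3 (nx α 3) = 1 := by
        unfold shiftCoeff
        rw [if_pos (by omega)]
      have e2 : shiftCoeff α 3 v = rest α v + 1 := by
        unfold shiftCoeff
        rw [if_neg (by omega), if_neg (by omega), if_pos (by omega)]
      have e3 : shiftCoeff α 3 (nx α v) = rest α v := by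
        by_cases hve : v = en α (nd α v)
        · have h12 := nx_of_eq hv hv' hve
          have h13 := hl.nx_eq (by omega)
          have h14 := nx_of_ne (α := α) (v := nd α v) (by omega) (by omega) h13.2
          rw [← hve, ← h12.1] at h13
          rw [h13.1] at h14
          unfold shiftCoeff
          rw [if_neg (by omega), if_neg (by omega), if_neg, h12.2]
          · rfl
          · rw [h14.2.2.1, h11, nd_two]; omega
        · have h12 := nx_of_ne hv hv' hve
          unfold shiftCoeff
          rw [if_neg (by omega), if_neg (by omega), if_pos, h12.2.2.2.2]
          · push_cast; rfl
          · rw [h12.2.2.1]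
            omega
      have e4 : ∀ x, shiftCoeff α v x = 0 := fun _ => shiftCoeff_of_le hα (by omega)
      have e5 : ∀ x, shiftCoeff α (nx α 3) x = 0 := fun _ => shiftCoeff_of_le hα le_rfl
      simp only [shiftMandelstam, e1, e2, e3, e4, e5]
      ring
  · exact shiftMandelstam_of_le hα h (by omega) (by omega)

/-- The only case with deformed variables is `I = r₂`: `X_{r₂,v}` and `X_{r₂,pv v}` both shift by
`-1` and enter with opposite signs. -/
lemma shiftMandelstam_of_nd_eq (hα : SecondIsPair α) {u v : ℕ} (hu : 2 ≤ u) (hv : 3 ≤ v)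
    (hv' : v ≤ numPts α + 1) (h1 : nd α u = nd α v) (h2 : nd α v + 1 < u) (h3 : u < pv α v) :
    shiftMandelstam α ((u - 1, u), (pv α v, v)) = 0 := by
  have hs := hα.spec
  have hl := isLabel_nd hv hv'
  have h4 := two_le_nd hv hv'
  have h6 := le_en_nd hv hv'
  have hp := pv_of_ne hv hv' (by intro h; have := pv_of_eq hv hv' h; omega)
  rcases Nat.lt_or_ge (u - 1) (nx α 3) with h | h
  · rcases Nat.lt_or_ge v (nx α 3) with h7 | h7
    · exact shiftMandelstam_of_lt hα (by omega) (by omega) (by omega)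
    · have h8 := hα.eq_two hl (by omega) h7 h6.1
      have h9 : u = nx α 3 := by
        have := nx_le (α := α) (x := 3) (v := u) le_rfl (by omega) (by rw [nd_three]; omega)
          (by omega)
        omega
      have e1 : shiftCoeff α (u - 1) u = 0 := by
        have := shiftCoeff_succ hα (u := u - 1)
        rwa [Nat.sub_add_cancel (by omega)] at this
      have e2 : shiftCoeff α (u - 1) v = -1 := by
        unfold shiftCoeff
        rw [if_neg (by omega), if_pos (by omega)]
      have e3 : shiftCoeff α (u - 1) (pv α v) = -1 := by
        unfold shiftCoeff
        rw [if_neg (by omega), if_pos (by omega)]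
      have e4 : ∀ x, shiftCoeff α u x = 0 := fun _ => shiftCoeff_of_le hα (by omega)
      have e5 : ∀ x, shiftCoeff α (pv α v) x = 0 := fun _ => shiftCoeff_of_le hα (by omega)
      simp only [shiftMandelstam, e1, e2, e3, e4, e5]
      ring
  · exact shiftMandelstam_of_le hα h (by omega) (by omega)

lemma pv_eq_nd_or {u : ℕ} (hu : 3 ≤ u) (hu' : u ≤ numPts α + 1) :
    nd α u ≤ pv α u ∧ pv α u < u ∧ (pv α u = nd α u ∨ nd α (pv α u) = nd α u) := by
  have h := nd_lt hu hu'
  by_cases h1 : u = nd α u + 1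
  · have := pv_of_eq hu hu' h1
    omega
  · have := pv_of_ne hu hu' h1
    omega

/-- If a child pair of the pair of `v` begins before `l₃` and `v` does not, the child is `B₂`. -/
lemma SecondIsPair.nd_eq_three (hα : SecondIsPair α) {u v : ℕ} (hu : 3 ≤ u) (hv : 3 ≤ v)
    (hv' : v ≤ numPts α + 1) (h1 : nd α (nd α u) = nd α v) (h2 : u < v)
    (h3 : nd α u < nx α 3) (h4 : nx α 3 ≤ v) : nd α v = 2 ∧ nd α u = 3 := by
  have h5 := nd_le_pv hu hv' h1 h2
  have h6 := nd_lt (α := α) h5.1 (by have := nd_lt (α := α) hu (by omega); omega)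
  have h7 := hα.eq_two (isLabel_nd hv hv') (by omega) h4 (le_en_nd hv hv').1
  exact ⟨h7, eq_three_of_lt_nx h5.1 (by omega) h3 (by omega)⟩

/-- Here `I` is `l₂` or a sub-block of `B₂` when deformed variables occur. For `J = B₃` the
variables `X_{u,l₃}` and `X_{pv u,l₃}` cancel, except when `u = r₂`: then the former is a massless
side and `X_{r₂,v}`, with prefactor `-1`, takes its place. For later `J` only `X_{r₂,v}` and
`X_{r₂,pv v}` can occur, and they cancel. -/
lemma shiftMandelstam_of_nd_lt_pv (hα : SecondIsPair α) {u v : ℕ} (hu : 3 ≤ u) (hv : 3 ≤ v)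
    (hv' : v ≤ numPts α + 1) (h1 : nd α (nd α u) = nd α v) (h2 : u < v) (h3 : nd α u < pv α v) :
    shiftMandelstam α ((pv α u, u), (pv α v, v)) = 0 := by
  have hs := hα.spec
  have h4 := two_le_nd hv hv'
  have h6 := le_en_nd (α := α) hu (by omega)
  have hp := pv_of_ne hv hv' (by
    intro h
    have := pv_of_eq hv hv' h
    have h5 := nd_le_pv hu hv' h1 h2
    have := h5.2.1.nd_lt
    omega)
  have hi := pv_eq_nd_or (α := α) hu (by omega)
  have hx := nd_le_pv hu hv' h1 h2
  rcases Nat.lt_or_ge (pv α u) (nx α 3) with h | h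
  · rcases Nat.lt_or_ge v (nx α 3) with h7 | h7
    · exact shiftMandelstam_of_lt hα (by omega) (by omega) (by omega)
    · obtain ⟨h8, h9⟩ := hα.nd_eq_three hu hv hv' h1 h2 (by omega) h7
      rw [h9] at hx h6 hi
      have hnd : nd α (nd α v) = 0 := by rw [h8, nd_two]
      have hndp : nd α (nd α (pv α v)) = 0 := by rw [hp.2.2.1, h8, nd_two]
      have e1 : shiftCoeff α (pv α u) u = 0 := shiftCoeff_of_lt hα (by omega)
      have e2 : shiftCoeff α (pv α v) v = 0 := shiftCoeff_of_le hα (by omega)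
      have e3 : shiftCoeff α (pv α u) v = 0 := by
        unfold shiftCoeff
        rw [if_neg (by omega), if_neg (by omega), if_neg (by omega)]
      simp only [shiftMandelstam, e1, e2, e3]
      unfold shiftCoeff
      rcases eq_or_lt_of_le (show nx α 3 ≤ pv α v by omega) with h10 | h10
      · rcases eq_or_lt_of_le (show u + 1 ≤ nx α 3 by omega) with h11 | h11
        · rw [if_neg (by omega : ¬ (pv α v = nx α 3 ∧ u + 1 < nx α 3 ∧ _)),
            if_neg (by omega : ¬ (u + 1 = nx α 3 ∧ nx α 3 < pv α v ∧ _)),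
            if_neg (by omega : ¬ (u = 3 ∧ nx α 3 < pv α v ∧ _)),
            if_pos (by omega : (pv α v = nx α 3 ∧ pv α u + 1 < nx α 3 ∧ _)),
            if_neg (by omega : ¬ (v = nx α 3 ∧ u + 1 < nx α 3 ∧ _)),
            if_pos (by omega : (u + 1 = nx α 3 ∧ nx α 3 < v ∧ _))]
          rfl
        · rw [if_pos (by omega : (pv α v = nx α 3 ∧ u + 1 < nx α 3 ∧ _)),
            if_pos (by omega : (pv α v = nx α 3 ∧ pv α u + 1 < nx α 3 ∧ _)),
            if_neg (by omega : ¬ (v = nx α 3 ∧ u + 1 < nx α 3 ∧ _)),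
            if_neg (by omega : ¬ (u + 1 = nx α 3 ∧ nx α 3 < v ∧ _)),
            if_neg (by omega : ¬ (u = 3 ∧ nx α 3 < v ∧ _))]
          rfl
      · split_ifs <;> omega
  · exact shiftMandelstam_of_le hα h (by omega) (by omega)

/-- When deformed variables occur, `J = r₂` and `v = l₃`, and the shifts of `X_{pv u,l₃}` and
`X_{u,l₃}` are both `1` and cancel. -/
lemma shiftMandelstam_of_nd_eq_pv (hα : SecondIsPair α) {u v : ℕ} (hu : 3 ≤ u) (hv : 3 ≤ v)
    (hv' : v ≤ numPts α + 1) (h1 : nd α (nd α u) = nd α v) (h2 : u + 1 < v)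
    (h3 : nd α u = pv α v) : shiftMandelstam α ((pv α u, u), (v - 1, v)) = 0 := by
  have hs := hα.spec
  have h6 := le_en_nd (α := α) hu (by omega)
  have hx := nd_le_pv hu hv' h1 (by omega)
  have h4 := two_le_nd hv hv'
  have hp := pv_of_ne hv hv' (by
    intro h
    have := pv_of_eq hv hv' h
    have := nd_lt (α := α) hx.1 (by have := nd_lt (α := α) hu (by omega); omega)
    omega)
  have hi := pv_eq_nd_or (α := α) hu (by omega)
  rcases Nat.lt_or_ge (pv α u) (nx α 3) with h | h
  · rcases Nat.lt_or_ge v (nx α 3) with h7 | h7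
    · exact shiftMandelstam_of_lt hα (by omega) (by omega) (by omega)
    · obtain ⟨h8, h9⟩ := hα.nd_eq_three hu hv hv' h1 (by omega) (by omega) h7
      rw [h9] at hx h6 hi h3
      have hvL : v = nx α 3 := by rw [h3, hp.2.2.2]
      have e1 : shiftCoeff α (pv α u) u = 0 := shiftCoeff_of_lt hα (by omega)
      have e2 : shiftCoeff α (v - 1) v = 0 := by
        have := shiftCoeff_succ hα (u := v - 1)
        rwa [Nat.sub_add_cancel (by omega)] at this
      have e3 : shiftCoeff α (pv α u) v = 1 := by
        unfold shiftCoeff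
        rw [if_pos (by omega)]
      have e4 : shiftCoeff α u v = 1 := by
        unfold shiftCoeff
        rw [if_pos (by omega)]
      have e5 : ∀ x, shiftCoeff α x (v - 1) = 0 := fun _ => shiftCoeff_of_lt hα (by omega)
      simp only [shiftMandelstam, e1, e2, e3, e4, e5]
      ring
  · exact shiftMandelstam_of_le hα h (by omega) (by omega)

theorem shiftMandelstam_constraintOf (hα : SecondIsPair α) {u v : ℕ} (h : NonBasic α u v) :
    shiftMandelstam α (constraintOf α u v) = 0 := by
  obtain ⟨hu, hv, hv', h⟩ := h
  have hr : ∀ {x}, nd α x = nd α v ∨ nd α (nd α x) = nd α v → nd α x ≠ nd α (nd α v) :=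
    fun h => nd_ne_of_related hv hv' h
  have h1 := isLabel_nd hv hv'
  have h2 := two_le_nd hv hv'
  have h3 := h1.nd_lt
  have hx : nd α (nd α u) = nd α v → nd α u ≠ nd α v := by
    intro h4 h5
    rw [h5] at h4
    omega
  unfold constraintOf
  rcases h with ⟨h4, h5, h6⟩ | ⟨h4, h5, h6⟩ | ⟨h4, h5, h6⟩ | ⟨h4, h5, h6⟩ | ⟨h4, h5⟩
  · rw [if_neg (hr (.inl h4)), if_pos (.inl h4), if_pos h4]
    exact shiftMandelstam_of_nd_eq hα hu hv hv' h4 h5 h6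
  · have hu3 := three_le_of_nd_nd hu hv hv' h4
    rw [if_neg (hr (.inr h4)), if_pos (.inr h6), if_neg (hx h4)]
    exact shiftMandelstam_of_nd_lt_pv hα hu3 hv hv' h4 h5 h6
  · have hu3 := three_le_of_nd_nd hu hv hv' h4
    rw [if_neg (hr (.inr h4)), if_neg (by have := hx h4; omega)]
    exact shiftMandelstam_of_nd_eq_pv hα hu3 hv hv' h4 h6 h5
  · subst h4
    rw [if_pos rfl, if_pos rfl]
    exact shiftMandelstam_of_eq_nd hα hv hv' h5 h6
  · rw [if_pos h4, if_neg (by omega)]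
    exact shiftMandelstam_of_lt_nd hα hu hv hv' h4 h5

lemma mandelstam_shiftDir {K : Type*} [Field K] (hα : SecondIsPair α) {h : Interval × Interval}
    (hh : h ∈ constraints α) : mandelstam (numPts α) (fun d => (shiftDir α d : K)) h = 0 := by
  obtain ⟨u, v, h1, rfl⟩ := mem_constraints.1 hh
  have h2 := shiftMandelstam_constraintOf hα h1
  obtain ⟨a1, a2, a3, a4, a5⟩ := isLead_constraintOf h1
  set c := constraintOf α u v
  have key : ∀ {x y}, Lower α u v x y →
      planar (numPts α) (fun d => (shiftDir α d : K)) x y = (shiftCoeff α x y : K) :=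
    fun h => by rw [planar, shiftDir_chord hα h.1 h.2.1 h.2.2.1]
  have a6 : 2 ≤ c.1.1 ∧ c.1.1 ≤ c.2.1 ∧ c.2.1 ≤ numPts α + 1 ∧ 2 ≤ c.1.2 ∧ c.1.2 ≤ c.2.2 ∧
      c.2.2 ≤ numPts α + 1 := by
    unfold Lower at *
    omega
  unfold mandelstam
  rw [key a1, key a2, key a3, key a4, planar, planar, shiftDir_chord hα a6.1 a6.2.1 a6.2.2.1,
    shiftDir_chord hα a6.2.2.2.1 a6.2.2.2.2.1 a6.2.2.2.2.2]
  unfold shiftMandelstam at h2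
  have := congrArg (Int.cast (R := K)) h2
  push_cast at this ⊢
  exact this

lemma shiftDir_eq_zero {d : ℕ × ℕ} (hd : d ∉ deformed α) : shiftDir α d = 0 := if_neg hd

lemma deformed_inter_basis (hα : SecondIsPair α) {d : ℕ × ℕ} (hd : d ∈ deformed α)
    (hb : d ∈ preferredBasis α) : d = shiftVar α := by
  have hs := hα.spec
  obtain ⟨u, v, h1, h2, rfl⟩ := mem_preferredBasis_iff.1 hb
  have hr := h1
  unfold IsDiag at hr
  rw [chord_mem_deformed hα h1] at hd
  rw [hα.shiftVar_eq]
  have h3 := nd_three (α := α)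
  have h20 := nd_two (α := α)
  rcases hd with ⟨rfl, h4, rfl | rfl | h5⟩ | ⟨h4, h5, h6⟩ | ⟨rfl, h4, h5⟩
  · exfalso
    rcases h2 with ⟨h6, -⟩ | ⟨-, h7⟩
    · omega
    · rw [en_two] at h7; omega
  · rfl
  · exfalso
    rcases h2 with ⟨h6, -⟩ | ⟨h6, -⟩
    · omega
    · obtain rfl : u = 2 := by omega
      omega
  · exfalso
    rcases h2 with ⟨h7, -⟩ | ⟨h7, -⟩
    · have : u = en α 3 := by omega
      rw [this, hα.isLabel.nd_en] at h7
      omega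
    · omega
  · exfalso
    rcases h2 with ⟨h7, -⟩ | ⟨h7, h8⟩
    · rw [h3] at h7
      rw [← h7, nd_two] at h5
      omega
    · omega

-- The shifted point in closed form

variable {K : Type*} [Field K] {b : ℕ × ℕ → K} {c : Interval × Interval → K}

lemma add_smul_shiftDir_mem_subspace (hα : SecondIsPair α) {X : ℕ × ℕ → K}
    (hX : X ∈ subspace α b c) (t : K) : (fun d => X d + t * shiftDir α d) ∈ subspace α b c := by
  obtain ⟨h1, h2, h3⟩ := hX
  refine ⟨fun d hd => ?_, fun d hd hf => ?_, fun h hh => ?_⟩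
  · simp only
    rw [h1 d hd, shiftDir_eq_zero (fun h => hd (deformed_subset_diagonals h))]
    simp
  · simp only
    rw [h2 d hd hf, shiftDir_eq_zero
      (fun h => hf (Finset.mem_filter.1 (deformed_subset_allowed hα h)).2)]
    simp
  · rw [← h3 h hh]
    have := mandelstam_shiftDir (K := K) hα hh
    unfold mandelstam planar at *
    linear_combination (-t) * this

/-- Both sides lie in the subspace and agree on the preferred basis, which contains no deformed
variable except `X_{3,l₃}`. Uniqueness of the coordinates does the rest. -/
theorem IsShift.eq (hα : SecondIsPair α) {X : ℕ × ℕ → K} (hX : X ∈ subspace α b c)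
    {Xhat : K → ℕ × ℕ → K} (h : IsShift α b c X Xhat) (z : K) (d : ℕ × ℕ) :
    Xhat z d = X d + (z - 1) * X (shiftVar α) * shiftDir α d := by
  have key : Xhat z = fun d => X d + (z - 1) * X (shiftVar α) * shiftDir α d := by
    refine (existsUnique_mem_subspace b c (Xhat z)).unique ⟨(h z).1, fun _ _ => rfl⟩
      ⟨add_smul_shiftDir_mem_subspace hα hX _, fun d hd => ?_⟩
    rw [(h z).2 d hd]
    split_ifs with h1
    · rw [h1, shiftDir, if_pos (shiftVar_mem_deformed hα), lam_shiftVar hα]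
      push_cast
      ring
    · rw [shiftDir_eq_zero (fun h2 => h1 (deformed_inter_basis hα h2 hd))]
      simp
  rw [key]

lemma IsShift.eq_of_mem (hα : SecondIsPair α) {X : ℕ × ℕ → K} (hX : X ∈ subspace α b c)
    {Xhat : K → ℕ × ℕ → K} (h : IsShift α b c X Xhat) (z : K) {d : ℕ × ℕ} (hd : d ∈ deformed α) :
    Xhat z d = X d - lam α d * (1 - z) * X (shiftVar α) := by
  rw [h.eq hα hX, shiftDir, if_pos hd]
  ring

lemma IsShift.eq_of_notMem (hα : SecondIsPair α) {X : ℕ × ℕ → K} (hX : X ∈ subspace α b c)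
    {Xhat : K → ℕ × ℕ → K} (h : IsShift α b c X Xhat) (z : K) {d : ℕ × ℕ} (hd : d ∉ deformed α) :
    Xhat z d = X d := by
  rw [h.eq hα hX, shiftDir_eq_zero hd]
  simp

variable [CharZero K]

lemma IsShift.pole_eq (hα : SecondIsPair α) {X : ℕ × ℕ → K} (hX : X ∈ subspace α b c)
    {Xhat : K → ℕ × ℕ → K} (h : IsShift α b c X Xhat) (hs : X (shiftVar α) ≠ 0)
    {d e : ℕ × ℕ} (hd : d ∈ deformed α) (he : e ∈ deformed α) :
    Xhat (pole α X d) e = X e - (lam α e : K) / (lam α d : K) * X d := by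
  have h1 : (lam α d : K) ≠ 0 := Int.cast_ne_zero.2 (lam_ne_zero hα hd)
  rw [h.eq_of_mem hα hX _ he, pole]
  field_simp
  ring

end

end BiColor

namespace BiColor

section

variable {α : List Block} {T : Finset (ℕ × ℕ)}

/-! Triangles of triangulations, with the vertices of the polygon numbered `2, …, n + 1` -/

/-- The vertices `u < v` are joined by a side of the polygon or by a chord in `T`. -/
def Joined (α : List Block) (T : Finset (ℕ × ℕ)) (u v : ℕ) : Prop :=
  Linked (numPts α) T (chord (numPts α) u v)

lemma Joined.mem {u v : ℕ} (h : Joined α T u v) (h' : IsDiag α u v) :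
    chord (numPts α) u v ∈ T := by
  have hm := mem_diagonals.1 h'.mem
  rcases h with h | h | h
  · exact h
  · omega
  · omega

lemma joined_succ {u : ℕ} (h : 2 ≤ u) (hu : u + 1 ≤ numPts α + 1) : Joined α T u (u + 1) := by
  unfold Joined Linked
  rw [chord_eq (by omega) h hu]
  split_ifs <;> simp
  omega

lemma joined_iff {u v : ℕ} (huv : u < v) (hv : v ≤ numPts α) :
    Linked (numPts α) T (u, v) ↔ if u = 1 then Joined α T v (numPts α + 1) else Joined α T u v := by
  unfold Joined
  split_ifs with h
  · rw [chord_last (by omega) (by omega), h]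
  · rw [chord_of_lt huv hv]

/-- The triangle on `(u, v)` away from the vertices between `u` and `v`. In the numbering `2, …, n +
1` the outer side of a chord ending at `n + 1` is the inner side of the chord `(1, u)`. -/
lemma exists_lower_apex (hT : T ⊆ diagonals α) (hc : NonCrossing T)
    (hcard : T.card + 3 = numPts α) {u v : ℕ} (hu : 2 ≤ u) (huv : u < v) (hv : v ≤ numPts α + 1)
    (hne : ¬ (u = 2 ∧ v = numPts α + 1)) (h : Joined α T u v) :
    (∃ w, 2 ≤ w ∧ w < u ∧ Joined α T w u ∧ Joined α T w v) ∨
      ∃ w, v < w ∧ w ≤ numPts α + 1 ∧ Joined α T u w ∧ Joined α T v w := by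
  have hj := @joined_iff α T
  rcases eq_or_lt_of_le hv with rfl | hv
  · left
    unfold Joined at h
    rw [chord_last (by omega) (by omega)] at h
    obtain ⟨w, h1, h2, h3, h4⟩ := exists_inner_apex hT hc hcard le_rfl (by omega) (by omega) h
    rw [hj h1 (by omega), if_pos rfl] at h3
    rw [hj h2 (by omega), if_neg (by omega)] at h4
    exact ⟨w, by omega, h2, h4, h3⟩
  · unfold Joined at h
    rw [chord_of_lt huv (by omega)] at h
    rcases exists_outer_apex hT hc hcard (by omega) huv (by omega) (by omega) h with
      ⟨w, h1, h2, h3, h4⟩ | ⟨w, h1, h2, h3, h4⟩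
    · rw [hj h2 (by omega)] at h3
      rw [hj (by omega) (by omega)] at h4
      split_ifs at h3 h4 with h5
      · exact .inr ⟨numPts α + 1, by omega, le_rfl, h3, h4⟩
      · exact .inl ⟨w, by omega, h2, h3, h4⟩
    · rw [hj (by omega) (by omega), if_neg (by omega)] at h3
      rw [hj (by omega) (by omega), if_neg (by omega)] at h4
      exact .inr ⟨w, h1, by omega, h3, h4⟩

lemma not_crosses_flip_chord (hT : T ⊆ diagonals α) (hc : NonCrossing T) {a b c d : ℕ}
    (hab : Joined α T a b) (hbc : Joined α T b c) (hcd : Joined α T c d) (had : Joined α T a d)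
    (h0 : 2 ≤ a) (h1 : a < b) (h2 : b < c) (h3 : c < d) (h4 : d ≤ numPts α + 1) {e : ℕ × ℕ}
    (he : e ∈ T) :
    (e ≠ chord (numPts α) a c → ¬ Crosses e (chord (numPts α) b d)) ∧
      (e ≠ chord (numPts α) b d → ¬ Crosses e (chord (numPts α) a c)) := by
  unfold Joined at hab hbc hcd had
  rw [chord_of_lt h1 (by omega)] at hab
  rw [chord_of_lt h2 (by omega)] at hbc
  rw [chord_of_lt (by omega : a < c) (by omega)]
  rcases eq_or_lt_of_le h4 with rfl | h4
  · rw [chord_last (by omega) (by omega)] at hcd had ⊢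
    exact (not_crosses_flip hT hc had hab hbc hcd (by omega) h1 h2 he).symm
  · rw [chord_of_lt (by omega) (by omega)] at hcd had ⊢
    exact not_crosses_flip hT hc hab hbc hcd had h1 h2 h3 he

/-! Deformed propagators in triangulations -/

/-- The deformed propagators that end on the edge `r₂` of the polygon: those at its right end and
those at its left end. -/
def EndsOnR₂ (α : List Block) (f : ℕ × ℕ) : Prop :=
  (∃ w, 2 ≤ w ∧ w + 1 < nx α 3 ∧ f = chord (numPts α) w (nx α 3) ∧ lam α f = 1) ∨
    ∃ w, nx α 3 < w ∧ w ≤ numPts α + 1 ∧ f = chord (numPts α) (nx α 3 - 1) w ∧ lam α f = -1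

lemma SecondIsPair.isDiag_left (hα : SecondIsPair α) {w : ℕ} (h2 : 2 ≤ w) (h : w + 1 < nx α 3) :
    IsDiag α w (nx α 3) := by
  have hs := hα.spec
  unfold IsDiag
  omega

lemma SecondIsPair.isDiag_right (hα : SecondIsPair α) {w : ℕ} (h : nx α 3 < w)
    (hw : w ≤ numPts α + 1) : IsDiag α (nx α 3 - 1) w := by
  have hs := hα.spec
  unfold IsDiag
  omega

lemma left_mem_deformed (hα : SecondIsPair α) {w : ℕ} (h2 : 2 ≤ w) (h : w + 1 < nx α 3)
    (hw : w = 2 ∨ w = 3 ∨ nd α w = 3) :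
    chord (numPts α) w (nx α 3) ∈ deformed α ∧ lam α (chord (numPts α) w (nx α 3)) = 1 := by
  have hd := hα.isDiag_left h2 h
  have hm : chord (numPts α) w (nx α 3) ∈ deformed α := by
    rw [chord_mem_deformed hα hd]
    omega
  refine ⟨hm, ?_⟩
  rw [lam_chord hα hd hm, shiftCoeff, if_pos ⟨rfl, h, hw⟩]

lemma right_mem_deformed (hα : SecondIsPair α) {w : ℕ} (h : nx α 3 < w)
    (hw : w ≤ numPts α + 1) (h2 : nd α w = 2) :
    chord (numPts α) (nx α 3 - 1) w ∈ deformed α ∧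
      lam α (chord (numPts α) (nx α 3 - 1) w) = -1 := by
  have hs := hα.spec
  have hd := hα.isDiag_right h hw
  have hm : chord (numPts α) (nx α 3 - 1) w ∈ deformed α := by
    rw [chord_mem_deformed hα hd]
    omega
  refine ⟨hm, ?_⟩
  rw [lam_chord hα hd hm, shiftCoeff, if_neg (by omega), if_pos (by omega)]

lemma nd_nd_eq_zero {v : ℕ} (h1 : 3 ≤ v) (h2 : v ≤ numPts α + 1) (h : nd α (nd α v) = 0) :
    nd α v = 2 := by
  have h3 := two_le_nd h1 h2
  have h4 := nd_lt h1 h2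
  by_contra hcon
  have := two_le_nd (α := α) (v := nd α v) (by omega) (by omega)
  omega

/-- A vertex before `l₃` that is related to a vertex of the outermost level. -/
lemma left_of_related (hα : SecondIsPair α) {w x : ℕ} (hw : 2 ≤ w) (h : w + 1 < nx α 3)
    (hx : nd α x = 2) (hr : Related α w x) : w = 2 ∨ w = 3 ∨ nd α w = 3 := by
  have hs := hα.spec
  have h20 := nd_two (α := α)
  have hz : ∀ v, v ≤ 2 → nd α v = 0 := fun v hv => by rw [nd, if_pos hv]
  rcases Nat.lt_or_ge w 3 with h3 | h3
  · exact .inl (by omega)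
  unfold Related at hr
  have h4 := nd_lt (α := α) h3 (by omega)
  rcases hr with h5 | h5 | h5
  · exact .inr (.inl (eq_three_of_lt_nx (α := α) h3 (by omega) (by omega) (by omega)))
  · right; right
    refine eq_three_of_lt_nx (α := α) ?_ (by omega) (by omega) (by omega)
    by_contra hcon
    have := hz (nd α w) (by omega)
    omega
  · have := two_le_nd (α := α) h3 (by omega)
    rw [hx, h20] at h5
    omega

/-- The vertices after `l₃` related to `r₂` are on the outermost level. -/
lemma nd_eq_two_of_related (hα : SecondIsPair α) {u w : ℕ} (hu : nd α u = 3) (h : nx α 3 < w)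
    (hw : w ≤ numPts α + 1) (hr : Related α u w) : nd α w = 2 := by
  have hs := hα.spec
  have h1 := le_en_nd (α := α) (v := w) (by omega) hw
  unfold Related at hr
  rw [hu, nd_three] at hr
  rcases hr with h2 | h2 | h2
  · rw [← h2] at h1
    omega
  · exact h2.symm
  · have hl := isLabel_nd (α := α) (v := w) (by omega) hw
    have := two_le_nd (α := α) (v := w) (by omega) hw
    have h3 := hl.en_lt_en_nd (by intro h3; rw [h3, nd_two] at h2; omega)
    rw [← h2] at h3
    omega

lemma nd_r₂ (hα : SecondIsPair α) : nd α (nx α 3 - 1) = 3 := by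
  have hs := hα.spec
  rw [show nx α 3 - 1 = en α 3 by omega, hα.isLabel.nd_en]

/-- The triangle on the side `r₂` of the polygon, whose ends are `nx α 3 - 1` and `nx α 3`. Either
way one of its two other sides is a genuine diagonal, and being allowed restricts the level of the
apex. -/
lemma exists_apex (hα : SecondIsPair α) (hT : T ⊆ allowed α) (hc : NonCrossing T)
    (hcard : T.card + 3 = numPts α) :
    (∃ w, 2 ≤ w ∧ w + 1 < nx α 3 ∧ Joined α T w (nx α 3 - 1) ∧ Joined α T w (nx α 3) ∧
      chord (numPts α) w (nx α 3) ∈ T ∧ (w = 2 ∨ w = 3 ∨ nd α w = 3)) ∨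
    ∃ w, nx α 3 < w ∧ w ≤ numPts α + 1 ∧ Joined α T (nx α 3) w ∧ Joined α T (nx α 3 - 1) w ∧
      chord (numPts α) (nx α 3 - 1) w ∈ T ∧ nd α w = 2 := by
  have hs := hα.spec
  have hj : Joined α T (nx α 3 - 1) (nx α 3) := by
    have := joined_succ (α := α) (T := T) (u := nx α 3 - 1) (by omega) (by omega)
    rwa [Nat.sub_add_cancel (by omega)] at this
  have hTd : T ⊆ diagonals α := hT.trans (Finset.filter_subset _ _)
  rcases exists_lower_apex hTd hc hcard (by omega) (by omega) (by omega) (by omega) hj with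
    ⟨w, h1, h2, h3, h4⟩ | ⟨w, h1, h2, h3, h4⟩
  · have hd := hα.isDiag_left (w := w) h1 (by omega)
    have hm := h4.mem hd
    exact .inl ⟨w, h1, by omega, h3, h4, hm,
      left_of_related hα (by omega) (by omega) hs.2.2.2 (hd.mem_allowed_iff.1 (hT hm))⟩
  · have hd := hα.isDiag_right h1 h2
    have hm := h3.mem hd
    exact .inr ⟨w, h1, h2, h4, h3, hm,
      nd_eq_two_of_related hα (nd_r₂ hα) h1 h2 (hd.mem_allowed_iff.1 (hT hm))⟩

/-- Hence every diagram contains a deformed propagator and falls off at least like `1/z`. -/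
lemma exists_endsOnR₂ (hα : SecondIsPair α) (hT : T ⊆ allowed α) (hc : NonCrossing T)
    (hcard : T.card + 3 = numPts α) : ∃ f ∈ T, f ∈ deformed α ∧ EndsOnR₂ α f := by
  rcases exists_apex hα hT hc hcard with ⟨w, h1, h2, -, -, h3, h4⟩ | ⟨w, h1, h2, -, -, h3, h4⟩
  · have := left_mem_deformed hα h1 h2 h4
    exact ⟨_, h3, this.1, .inl ⟨w, h1, h2, rfl, this.2⟩⟩
  · have := right_mem_deformed hα h1 h2 h4
    exact ⟨_, h3, this.1, .inr ⟨w, h1, h2, rfl, this.2⟩⟩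

lemma not_crosses_of_endsOnR₂ (hα : SecondIsPair α) {f g : ℕ × ℕ} (hf : EndsOnR₂ α f)
    (hg : EndsOnR₂ α g) (h : lam α f = lam α g) : ¬ Crosses f g := by
  have hs := hα.spec
  rcases hf with ⟨w, h1, h2, rfl, h3⟩ | ⟨w, h1, h2, rfl, h3⟩ <;>
    rcases hg with ⟨x, h4, h5, rfl, h6⟩ | ⟨x, h4, h5, rfl, h6⟩
  · rw [chord_of_lt (by omega) (by omega), chord_of_lt (by omega) (by omega)]
    unfold Crosses
    simp only
    omega
  · omega
  · omega
  · rw [chord_eq (by omega) (by omega) (by omega), chord_eq (by omega) (by omega) (by omega)]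
    unfold Crosses
    split_ifs <;> simp only <;> omega

lemma insert_triangulation (hα : SecondIsPair α) (hT : T ⊆ allowed α \ deformed α)
    (hcard : T.card + 4 = numPts α) (hc : NonCrossing T)
    {f : ℕ × ℕ} (hf : f ∈ deformed α) (hfT : ∀ d ∈ T, ¬ Crosses d f) :
    insert f T ⊆ allowed α ∧ (insert f T).card + 3 = numPts α ∧ NonCrossing (insert f T) := by
  refine ⟨?_, ?_, hc.insert hfT⟩
  · intro d hd
    rcases Finset.mem_insert.1 hd with rfl | hd
    · exact deformed_subset_allowed hα hf
    · exact (Finset.mem_sdiff.1 (hT hd)).1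
  · rw [Finset.card_insert_of_notMem (fun h => (Finset.mem_sdiff.1 (hT h)).2 hf)]
    omega

/-- `T` with `f` added is a triangulation whose only deformed chord is `f`, so the deformed side of
the triangle on `r₂` must be `f`. -/
lemma endsOnR₂_of_compatible (hα : SecondIsPair α) (hT : T ⊆ allowed α \ deformed α)
    (hcard : T.card + 4 = numPts α) (hc : NonCrossing T)
    {f : ℕ × ℕ} (hf : f ∈ deformed α)
    (hfT : ∀ d ∈ T, ¬ Crosses d f) : EndsOnR₂ α f := by
  obtain ⟨h1, h2, h3⟩ := insert_triangulation hα hT hcard hc hf hfT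
  obtain ⟨g, hg, hgd, hge⟩ := exists_endsOnR₂ hα h1 h3 h2
  rcases Finset.mem_insert.1 hg with rfl | hg
  · exact hge
  · exact absurd hgd (Finset.mem_sdiff.1 (hT hg)).2

/-- Deformed chords with equal prefactors share an end of the side `r₂`, so they do not cross. As
`T` with `f` added is maximal, it contains `g` as well, and `f` is its only deformed chord. -/
lemma eq_of_compatible (hα : SecondIsPair α) (hT : T ⊆ allowed α \ deformed α)
    (hcard : T.card + 4 = numPts α) (hc : NonCrossing T)
    {f g : ℕ × ℕ} (hf : f ∈ deformed α) (hfT : ∀ d ∈ T, ¬ Crosses d f)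
    (hg : g ∈ deformed α) (hgT : ∀ d ∈ T, ¬ Crosses d g) (h : lam α f = lam α g) : f = g := by
  obtain ⟨h1, h2, h3⟩ := insert_triangulation hα hT hcard hc hf hfT
  have h4 := not_crosses_of_endsOnR₂ hα (endsOnR₂_of_compatible hα hT hcard hc hf hfT)
    (endsOnR₂_of_compatible hα hT hcard hc hg hgT) h
  have h5 := h3.mem_of_not_crosses (S := polygon α) (h1.trans (Finset.filter_subset _ _))
    (by simpa [polygon] using h2) (deformed_subset_diagonals hg) (by
      intro e he
      rcases Finset.mem_insert.1 he with rfl | he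
      · exact h4
      · exact hgT e he)
  rcases Finset.mem_insert.1 h5 with h5 | h5
  · exact h5.symm
  · exact absurd hg (Finset.mem_sdiff.1 (hT h5)).2

/-- In the triangulation obtained from `T` by adding `f`, one triangle at `f` has the side `r₂`. The
flip of `f` ends on the other end of that side. It remains to see that the flipped chord is
deformed, which follows from the allowed chords around the quadrilateral. -/
theorem exists_opposite (hα : SecondIsPair α) (hT : T ⊆ allowed α \ deformed α)
    (hcard : T.card + 4 = numPts α) (hc : NonCrossing T)
    {f : ℕ × ℕ} (hf : f ∈ deformed α) (hfT : ∀ d ∈ T, ¬ Crosses d f) :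
    ∃ g ∈ deformed α, g ≠ f ∧ (∀ d ∈ T, ¬ Crosses d g) ∧ lam α g = -lam α f := by
  have hs := hα.spec
  obtain ⟨h1, h2, h3⟩ := insert_triangulation hα hT hcard hc hf hfT
  have hdiag : insert f T ⊆ diagonals α := h1.trans (Finset.filter_subset _ _)
  have huniq : ∀ g ∈ insert f T, g ∈ deformed α → g = f := fun g hg hgd => by
    rcases Finset.mem_insert.1 hg with h | h
    · exact h
    · exact absurd hgd (Finset.mem_sdiff.1 (hT h)).2
  have hj : Joined α (insert f T) (nx α 3 - 1) (nx α 3) := by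
    have := joined_succ (α := α) (T := insert f T) (u := nx α 3 - 1) (by omega) (by omega)
    rwa [Nat.sub_add_cancel (by omega)] at this
  have hne : ∀ {g}, lam α g = -lam α f → g ≠ f := by
    rintro g h rfl
    have := lam_ne_zero hα hf
    omega
  have hTf : ∀ e ∈ T, e ≠ f := by
    rintro e he rfl
    exact (Finset.mem_sdiff.1 (hT he)).2 hf
  have hx0 : ∀ x, nx α 3 < x → 3 ≤ x := fun x h => by omega
  rcases exists_apex hα h1 h3 h2 with ⟨w, h4, h5, h6, h7, h8, h9⟩ | ⟨w, h4, h5, h6, h7, h8, h9⟩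
  · have hF := left_mem_deformed hα h4 h5 h9
    obtain rfl := huniq _ h8 hF.1
    rcases exists_lower_apex hdiag h3 h2 h4 (by omega) (by omega) (by omega) h7 with
      ⟨x, h10, h11, h12, h13⟩ | ⟨x, h10, h11, h12, h13⟩
    -- An apex before `w` would make `(x, l₃)` a second deformed chord of the triangulation.
    · exfalso
      have hd := hα.isDiag_left (w := x) h10 (by omega)
      have hm := h13.mem hd
      have h14 := left_mem_deformed hα h10 (by omega)
        (left_of_related hα (by omega) (by omega) hs.2.2.2 (hd.mem_allowed_iff.1 (h1 hm)))
      have := (hd.chord_eq_iff (hα.isDiag_left h4 h5)).1 (huniq _ hm h14.1)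
      omega
    · have hx : nd α x = 2 := by
        by_cases hx : w = 2 ∧ x = numPts α + 1
        · rw [hx.2, nd_last]
        · have hd : IsDiag α w x := ⟨h4, by omega, h11, hx⟩
          have hm := h12.mem hd
          have hr := hd.mem_allowed_iff.1 (h1 hm)
          have hnF : chord (numPts α) w x ∉ deformed α := fun h => by
            have := (hd.chord_eq_iff (hα.isDiag_left h4 h5)).1 (huniq _ hm h)
            omega
          have h20 := nd_two (α := α)
          have h00 : nd α 0 = 0 := by simp [nd]
          have hx2 := two_le_nd (α := α) (v := x) (by omega) h11
          rcases h9 with rfl | rfl | h9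
          · unfold Related at hr
            rw [h20, h00] at hr
            exact nd_nd_eq_zero (by omega) h11 (by omega)
          -- For `w = 3` flavor conservation also permits `x` one level below the outermost one, but
          -- then `X_{3,x}` is itself in `F` and would be a second deformed chord.
          · rw [chord_mem_deformed hα hd] at hnF
            unfold Related at hr
            rw [nd_three, h20] at hr
            omega
          · exact nd_eq_two_of_related hα h9 h10 h11 hr
      have hG := right_mem_deformed hα h10 h11 hx
      have hl : lam α (chord (numPts α) (nx α 3 - 1) x) =
          -lam α (chord (numPts α) w (nx α 3)) := by rw [hG.2, hF.2]
      refine ⟨_, hG.1, hne hl, fun e he => ?_, hl⟩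
      exact (not_crosses_flip_chord hdiag h3 h6 hj h13 h12 h4 (by omega) (by omega) h10 h11
        (Finset.mem_insert_of_mem he)).1 (hTf e he)
  · have hF := right_mem_deformed hα h4 h5 h9
    obtain rfl := huniq _ h8 hF.1
    rcases exists_lower_apex hdiag h3 h2 (by omega) (by omega) h5 (by omega) h7 with
      ⟨x, h10, h11, h12, h13⟩ | ⟨x, h10, h11, h12, h13⟩
    · have hx : x = 2 ∨ x = 3 ∨ nd α x = 3 := by
        by_cases hx : x = 2 ∧ w = numPts α + 1
        · exact .inl hx.1
        · have hd : IsDiag α x w := ⟨h10, by omega, h5, hx⟩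
          exact left_of_related hα (by omega) (by omega) h9 (hd.mem_allowed_iff.1 (h1 (h13.mem hd)))
      have hG := left_mem_deformed hα h10 (by omega) hx
      have hl : lam α (chord (numPts α) x (nx α 3)) =
          -lam α (chord (numPts α) (nx α 3 - 1) w) := by rw [hG.2, hF.2]; rfl
      refine ⟨_, hG.1, hne hl, fun e he => ?_, hl⟩
      exact (not_crosses_flip_chord hdiag h3 h12 hj h6 h13 h10 (by omega) (by omega) h4 h5
        (Finset.mem_insert_of_mem he)).2 (hTf e he)
    · exfalso
      have hd := hα.isDiag_right (w := x) (by omega) h11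
      have hm := h12.mem hd
      have h14 := right_mem_deformed hα (by omega) h11
        (nd_eq_two_of_related hα (nd_r₂ hα) (by omega) h11 (hd.mem_allowed_iff.1 (h1 hm)))
      have := (hd.chord_eq_iff (hα.isDiag_right h4 h5)).1 (huniq _ hm h14.1)
      omega

/-- The contributions to infinity of the two ends of an edge cancel. -/
lemma sum_inv_lam (hα : SecondIsPair α) (hT : T ⊆ allowed α \ deformed α)
    (hcard : T.card + 4 = numPts α) (hc : NonCrossing T)
    (K : Type*) [Field K] :
    ∑ f ∈ (deformed α).filter (fun f => ∀ d ∈ T, ¬ Crosses d f), (lam α f : K)⁻¹ = 0 := by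
  rcases ((deformed α).filter (fun f => ∀ d ∈ T, ¬ Crosses d f)).eq_empty_or_nonempty with h | h
  · rw [h, Finset.sum_empty]
  obtain ⟨f, hf⟩ := h
  rw [Finset.mem_filter] at hf
  obtain ⟨g, hg, hgf, hgT, hl⟩ := exists_opposite hα hT hcard hc hf.1 hf.2
  have key : (deformed α).filter (fun f => ∀ d ∈ T, ¬ Crosses d f) = {f, g} := by
    ext e
    rw [Finset.mem_filter, Finset.mem_insert, Finset.mem_singleton]
    constructor
    · rintro ⟨he, heT⟩
      have h1 := endsOnR₂_of_compatible hα hT hcard hc hf.1 hf.2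
      have h2 := endsOnR₂_of_compatible hα hT hcard hc he heT
      have h3 : lam α e = lam α f ∨ lam α e = lam α g := by
        rcases h1 with ⟨_, _, _, _, h1⟩ | ⟨_, _, _, _, h1⟩ <;>
          rcases h2 with ⟨_, _, _, _, h2⟩ | ⟨_, _, _, _, h2⟩ <;> omega
      exact h3.imp (eq_of_compatible hα hT hcard hc he heT hf.1 hf.2)
        (eq_of_compatible hα hT hcard hc he heT hg hgT)
    · rintro (rfl | rfl)
      · exact hf
      · exact ⟨hg, hgT⟩
  rw [key, Finset.sum_pair hgf.symm, hl]
  push_cast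
  rw [inv_neg, add_neg_cancel]

end

end BiColor

namespace BiColor

section

/-! Partial fractions -/

/-- The Lagrange basis polynomials at the nodes `a d` sum to `1`; evaluate at `0`. -/
lemma sum_inv_mul_prod_inv_sub {ι K : Type*} [DecidableEq ι] [Field K] {D : Finset ι} {a : ι → K}
    (hD : D.Nonempty) (ha : Set.InjOn a D) (h0 : ∀ d ∈ D, a d ≠ 0) :
    ∑ d ∈ D, (a d)⁻¹ * ∏ e ∈ D.erase d, (a e - a d)⁻¹ = ∏ e ∈ D, (a e)⁻¹ := by
  have h := congrArg (Polynomial.eval 0) (Lagrange.sum_basis ha hD)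
  rw [Polynomial.eval_finsetSum, Polynomial.eval_one] at h
  calc ∑ d ∈ D, (a d)⁻¹ * ∏ e ∈ D.erase d, (a e - a d)⁻¹
      = ∑ d ∈ D, (∏ e ∈ D, (a e)⁻¹) * Polynomial.eval 0 (Lagrange.basis D a d) := by
        refine Finset.sum_congr rfl fun d hd => ?_
        rw [Lagrange.basis, Polynomial.eval_prod, ← Finset.mul_prod_erase _ _ hd, mul_assoc,
          ← Finset.prod_mul_distrib]
        congr 1
        refine Finset.prod_congr rfl fun e he => ?_
        have he' := Finset.mem_of_mem_erase he
        have hne : a e - a d ≠ 0 := fun h =>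
          Finset.ne_of_mem_erase he (ha he' hd (sub_eq_zero.1 h))
        have hne' : a d - a e ≠ 0 := fun h => hne (by rw [← neg_sub, h, neg_zero])
        have := h0 e he'
        simp only [Lagrange.basisDivisor, Polynomial.eval_mul, Polynomial.eval_C,
          Polynomial.eval_sub, Polynomial.eval_X]
        field_simp
        ring
    _ = _ := by rw [← Finset.mul_sum, h, mul_one]

/-- Single out one index `i` and translate the nodes so that `a i` becomes `0`. By the previous
identity the other terms add up to minus the term of `i`. -/
lemma sum_prod_inv_sub_eq_zero {ι K : Type*} [DecidableEq ι] [Field K] {D : Finset ι} {a : ι → K}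
    (hD : 2 ≤ D.card) (ha : Set.InjOn a D) :
    ∑ d ∈ D, ∏ e ∈ D.erase d, (a e - a d)⁻¹ = 0 := by
  obtain ⟨i, hi⟩ := Finset.card_pos.1 (by omega : 0 < D.card)
  have hsub : ∀ {d}, d ∈ D.erase i → a d - a i ≠ 0 := fun hd h =>
    Finset.ne_of_mem_erase hd (ha (Finset.mem_of_mem_erase hd) hi (sub_eq_zero.1 h))
  have h := sum_inv_mul_prod_inv_sub (D := D.erase i) (a := fun d => a d - a i)
    (Finset.card_pos.1 (by rw [Finset.card_erase_of_mem hi]; omega))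
    (fun x hx y hy h => ha (Finset.mem_of_mem_erase hx) (Finset.mem_of_mem_erase hy)
      (by simpa using h)) (fun d hd => hsub hd)
  rw [← Finset.add_sum_erase _ _ hi, ← h, ← Finset.sum_add_distrib]
  refine Finset.sum_eq_zero fun d hd => ?_
  have hi' : i ∈ D.erase d := Finset.mem_erase.2 ⟨(Finset.ne_of_mem_erase hd).symm, hi⟩
  rw [← Finset.mul_prod_erase _ _ hi', Finset.erase_right_comm, ← neg_sub (a d) (a i), inv_neg]
  simp only [sub_sub_sub_cancel_right]
  ring

variable {α : List Block} {T : Finset (ℕ × ℕ)}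

lemma innerPart_polygon {d : ℕ × ℕ} (hd : d ∈ diagonals α) :
    innerPart (polygon α) d = leftVertices d := by
  rw [mem_diagonals] at hd
  ext s
  simp only [mem_innerPart, polygon, leftVertices, Finset.mem_Icc]
  omega

lemma outerPart_polygon {d : ℕ × ℕ} (hd : d ∈ diagonals α) :
    outerPart (polygon α) d = rightVertices α d := by
  rw [mem_diagonals] at hd
  ext s
  simp only [mem_outerPart, polygon, rightVertices, Finset.mem_Icc, Finset.mem_union]
  omega

lemma card_polygon : (polygon α).card = numPts α := by simp [polygon]

/-! The behaviour at infinity -/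

/-- The coefficient of `1 / (z X_{3,l₃})` in a deformed Feynman diagram. -/
def leadingCoeff {K : Type*} [Field K] (α : List Block) (X : ℕ × ℕ → K) (T : Finset (ℕ × ℕ)) : K :=
  if (T ∩ deformed α).card = 1 then
    (∏ f ∈ T ∩ deformed α, (lam α f : K)⁻¹) * ∏ e ∈ T \ deformed α, (X e)⁻¹
  else 0

lemma insert_inter_deformed (hT : T ⊆ allowed α \ deformed α) {f : ℕ × ℕ} (hf : f ∈ deformed α) :
    insert f T ∩ deformed α = {f} ∧ insert f T \ deformed α = T := by
  have h : ∀ e ∈ T, e ∉ deformed α := fun e he => (Finset.mem_sdiff.1 (hT he)).2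
  constructor
  · ext e
    simp only [Finset.mem_inter, Finset.mem_insert, Finset.mem_singleton]
    constructor
    · rintro ⟨rfl | h1, h2⟩
      · rfl
      · exact absurd h2 (h e h1)
    · rintro rfl
      exact ⟨.inl rfl, hf⟩
  · ext e
    simp only [Finset.mem_sdiff, Finset.mem_insert]
    constructor
    · rintro ⟨rfl | h1, h2⟩
      · exact absurd hf h2
      · exact h1
    · exact fun h1 => ⟨.inr h1, h e h1⟩

lemma inter_deformed_nonempty (hα : SecondIsPair α) (hT : T ∈ feynman α (polygon α)) :
    (T ∩ deformed α).Nonempty := by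
  obtain ⟨-, h1, h2, h3⟩ := mem_feynman.1 hT
  rw [card_polygon] at h2
  obtain ⟨f, hf, hf', -⟩ := exists_endsOnR₂ hα h1 h3 h2
  exact ⟨f, Finset.mem_inter.2 ⟨hf, hf'⟩⟩

/-- Diagrams with one deformed chord are grouped by their undeformed part `T₀`. Each group is `∏
1/X` over `T₀` times the sum of `1/λ` over the deformed chords compatible with `T₀`, which vanishes
by `sum_inv_lam`. -/
theorem sum_leadingCoeff {K : Type*} [Field K] (hα : SecondIsPair α) (X : ℕ × ℕ → K) :
    ∑ T ∈ feynman α (polygon α), leadingCoeff α X T = 0 := by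
  unfold leadingCoeff
  rw [← Finset.sum_filter, ← Finset.sum_fiberwise_of_maps_to
    (g := fun T => T \ deformed α) (fun T hT => Finset.mem_image_of_mem _ hT)]
  refine Finset.sum_eq_zero fun T₀ hT₀ => ?_
  have hT : T₀ ⊆ allowed α \ deformed α ∧ T₀.card + 4 = numPts α ∧ NonCrossing T₀ := by
    obtain ⟨T, h, rfl⟩ := Finset.mem_image.1 hT₀
    obtain ⟨h1, h2⟩ := Finset.mem_filter.1 h
    obtain ⟨-, h3, h4, h5⟩ := mem_feynman.1 h1
    rw [card_polygon] at h4
    have h6 := Finset.card_inter_add_card_sdiff T (deformed α)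
    exact ⟨Finset.sdiff_subset_sdiff h3 subset_rfl, by omega, h5.mono Finset.sdiff_subset⟩
  obtain ⟨h1, h2, h3⟩ := hT
  rw [← mul_zero (∏ e ∈ T₀, (X e)⁻¹), ← sum_inv_lam hα h1 h2 h3 K, Finset.mul_sum]
  symm
  refine Finset.sum_bij (fun f _ => insert f T₀) ?_ ?_ ?_ ?_
  · intro f hf
    rw [Finset.mem_filter] at hf
    obtain ⟨h4, h5⟩ := insert_inter_deformed h1 hf.1
    obtain ⟨h6, h7, h8⟩ := insert_triangulation hα h1 h2 h3 hf.1 hf.2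
    rw [Finset.mem_filter, Finset.mem_filter, mem_feynman, h4, card_polygon]
    exact ⟨⟨⟨h6.trans (Finset.filter_subset _ _), h6, h7, h8⟩, by simp⟩, h5⟩
  · intro f hf g hg h
    rw [Finset.mem_filter] at hf hg
    have h4 := (insert_inter_deformed h1 hf.1).1
    rw [h, (insert_inter_deformed h1 hg.1).1] at h4
    exact (Finset.singleton_injective h4).symm
  · intro T hT
    rw [Finset.mem_filter, Finset.mem_filter, mem_feynman] at hT
    obtain ⟨⟨⟨-, h4, -, h5⟩, h6⟩, rfl⟩ := hT
    obtain ⟨f, hf⟩ := Finset.card_eq_one.1 h6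
    have hfm : f ∈ T ∩ deformed α := by rw [hf]; simp
    rw [Finset.mem_inter] at hfm
    refine ⟨f, Finset.mem_filter.2 ⟨hfm.2, fun d hd =>
      h5 d (Finset.mem_sdiff.1 hd).1 f hfm.1⟩, ?_⟩
    rw [← Finset.singleton_union, ← hf, Finset.inter_comm, Finset.inter_comm,
      Finset.union_comm, Finset.sdiff_union_inter]
  · intro f hf
    rw [Finset.mem_filter] at hf
    obtain ⟨h4, h5⟩ := insert_inter_deformed h1 hf.1
    rw [h4, h5, Finset.prod_singleton, mul_comm]

/-! The recursion -/

variable {K : Type*} [Field K] [CharZero K] {b : ℕ × ℕ → K} {c : Interval × Interval → K}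

/-- With `a d = X_d / λ_d`, the prefactor is `(1/a_d - 1/X_{3,l₃})/λ_d`. Its first part reproduces
the diagram by partial fractions. Its second part vanishes by `sum_prod_inv_sub_eq_zero` unless the
diagram has exactly one deformed chord, when it is the `1/z` coefficient. -/
lemma sum_residues (hα : SecondIsPair α) {X : ℕ × ℕ → K} (hX : X ∈ subspace α b c)
    {Xhat : K → ℕ × ℕ → K} (h : IsShift α b c X Xhat) (h0 : ∀ d ∈ allowed α, X d ≠ 0)
    (hne : ∀ d ∈ deformed α, ∀ e ∈ deformed α, d ≠ shiftVar α → e ≠ d →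
      ¬ Crosses d e → Xhat (pole α X d) e ≠ 0) (hT : T ∈ feynman α (polygon α)) :
    ∑ d ∈ T ∩ deformed α, (1 / X d - 1 / ((lam α d : K) * X (shiftVar α))) *
        ∏ e ∈ T.erase d, (Xhat (pole α X d) e)⁻¹ =
      ∏ e ∈ T, (X e)⁻¹ - (X (shiftVar α))⁻¹ * leadingCoeff α X T := by
  obtain ⟨-, hTa, -, hTc⟩ := mem_feynman.1 hT
  have hD := inter_deformed_nonempty hα hT
  have hs : X (shiftVar α) ≠ 0 := h0 _ (deformed_subset_allowed hα (shiftVar_mem_deformed hα))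
  have hl : ∀ d ∈ deformed α, (lam α d : K) ≠ 0 := fun d hd =>
    Int.cast_ne_zero.2 (lam_ne_zero hα hd)
  have hmem : ∀ d ∈ T ∩ deformed α, d ∈ T ∧ d ∈ deformed α := fun d hd => Finset.mem_inter.1 hd
  set a : ℕ × ℕ → K := fun d => X d / lam α d with ha
  have ha0 : ∀ d ∈ T ∩ deformed α, a d ≠ 0 := fun d hd =>
    div_ne_zero (h0 _ (hTa (hmem d hd).1)) (hl _ (hmem d hd).2)
  have hval : ∀ d ∈ deformed α, ∀ e ∈ deformed α,
      Xhat (pole α X d) e = lam α e * (a e - a d) := fun d hd e he => by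
    rw [h.pole_eq hα hX hs hd he, ha]
    have := hl e he
    have := hl d hd
    field_simp
  -- Distinct poles follow from the hypothesis although it omits `d = (3, l₃)`: of two distinct
  -- chords at least one is not the shift variable, and equality of the nodes is symmetric.
  have hinj : Set.InjOn a (T ∩ deformed α : Finset _) := by
    have key : ∀ d ∈ T ∩ deformed α, ∀ e ∈ T ∩ deformed α, d ≠ shiftVar α → e ≠ d →
        a d ≠ a e := by
      intro d hd e he h1 h2 h3
      have h4 := hmem d hd
      have h5 := hmem e he
      refine hne d h4.2 e h5.2 h1 h2 (hTc d h4.1 e h5.1) ?_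
      rw [hval d h4.2 e h5.2, h3, sub_self, mul_zero]
    intro d hd e he hde
    by_contra hcon
    by_cases h1 : d = shiftVar α
    · exact key e he d hd (fun h2 => hcon (h1.trans h2.symm)) hcon hde.symm
    · exact key d hd e he h1 (fun h2 => hcon h2.symm) hde
  have hterm : ∀ d ∈ T ∩ deformed α, (1 / X d - 1 / ((lam α d : K) * X (shiftVar α))) *
        ∏ e ∈ T.erase d, (Xhat (pole α X d) e)⁻¹ =
      ((∏ e ∈ T ∩ deformed α, (lam α e : K)⁻¹) * ∏ e ∈ T \ deformed α, (X e)⁻¹) *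
        ((a d)⁻¹ * ∏ e ∈ (T ∩ deformed α).erase d, (a e - a d)⁻¹ -
          (X (shiftVar α))⁻¹ * ∏ e ∈ (T ∩ deformed α).erase d, (a e - a d)⁻¹) := by
    intro d hd
    have hd' := hmem d hd
    have e1 : T.erase d ∩ deformed α = (T ∩ deformed α).erase d := Finset.erase_inter _ _ _
    have e2 : T.erase d \ deformed α = T \ deformed α := by
      ext e
      simp only [Finset.mem_sdiff, Finset.mem_erase]
      constructor
      · exact fun h => ⟨h.1.2, h.2⟩
      · exact fun h => ⟨⟨fun h1 => h.2 (h1 ▸ hd'.2), h.1⟩, h.2⟩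
    rw [← Finset.prod_inter_mul_prod_sdiff (T.erase d) (deformed α), e1, e2,
      ← Finset.mul_prod_erase (T ∩ deformed α) _ hd]
    have e3 : ∏ e ∈ (T ∩ deformed α).erase d, (Xhat (pole α X d) e)⁻¹ =
        (∏ e ∈ (T ∩ deformed α).erase d, (lam α e : K)⁻¹) *
          ∏ e ∈ (T ∩ deformed α).erase d, (a e - a d)⁻¹ := by
      rw [← Finset.prod_mul_distrib]
      refine Finset.prod_congr rfl fun e he => ?_
      rw [hval d hd'.2 e (hmem e (Finset.mem_of_mem_erase he)).2, mul_inv]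
    have e4 : ∏ e ∈ T \ deformed α, (Xhat (pole α X d) e)⁻¹ = ∏ e ∈ T \ deformed α, (X e)⁻¹ :=
      Finset.prod_congr rfl fun e he => by
        rw [h.eq_of_notMem hα hX _ (Finset.mem_sdiff.1 he).2]
    have e5 : 1 / X d - 1 / ((lam α d : K) * X (shiftVar α)) =
        (lam α d : K)⁻¹ * ((a d)⁻¹ - (X (shiftVar α))⁻¹) := by
      have := hl d hd'.2
      have := h0 _ (hTa hd'.1)
      rw [ha]
      field_simp
    rw [e3, e4, e5]
    ring
  rw [Finset.sum_congr rfl hterm, ← Finset.mul_sum, Finset.sum_sub_distrib, ← Finset.mul_sum,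
    sum_inv_mul_prod_inv_sub hD hinj ha0, ← Finset.prod_inter_mul_prod_sdiff T (deformed α)]
  have e6 : ∏ e ∈ T ∩ deformed α, (X e)⁻¹ =
      (∏ e ∈ T ∩ deformed α, (lam α e : K)⁻¹) * ∏ e ∈ T ∩ deformed α, (a e)⁻¹ := by
    rw [← Finset.prod_mul_distrib]
    refine Finset.prod_congr rfl fun e he => ?_
    have := hl e (hmem e he).2
    rw [ha]
    field_simp
  rw [e6, leadingCoeff]
  split_ifs with hcard
  · obtain ⟨f, hf⟩ := Finset.card_eq_one.1 hcard
    rw [hf]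
    simp
    ring
  · rw [sum_prod_inv_sub_eq_zero (by have := Finset.card_pos.2 hD; omega) hinj]
    ring

/-- The sum over propagators of the diagrams containing them is exchanged with the sum over
diagrams. The `1/z` coefficients left over then add up to zero. -/
theorem amp_eq_sum (hα : SecondIsPair α) {X : ℕ × ℕ → K} (hX : X ∈ subspace α b c)
    {Xhat : K → ℕ × ℕ → K} (h : IsShift α b c X Xhat) (h0 : ∀ d ∈ allowed α, X d ≠ 0)
    (hne : ∀ d ∈ deformed α, ∀ e ∈ deformed α, d ≠ shiftVar α → e ≠ d →
      ¬ Crosses d e → Xhat (pole α X d) e ≠ 0) :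
    amp α (polygon α) X = ∑ d ∈ deformed α,
      (1 / X d - 1 / ((lam α d : K) * X (shiftVar α))) *
        amp α (leftVertices d) (Xhat (pole α X d)) *
        amp α (rightVertices α d) (Xhat (pole α X d)) := by
  have h1 : ∀ d ∈ deformed α, (1 / X d - 1 / ((lam α d : K) * X (shiftVar α))) *
        amp α (leftVertices d) (Xhat (pole α X d)) *
        amp α (rightVertices α d) (Xhat (pole α X d)) =
      ∑ T ∈ (feynman α (polygon α)).filter (fun T => d ∈ T),
        (1 / X d - 1 / ((lam α d : K) * X (shiftVar α))) *
          ∏ e ∈ T.erase d, (Xhat (pole α X d) e)⁻¹ := fun d hd => by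
    have hd' := deformed_subset_diagonals hd
    rw [← Finset.mul_sum, sum_feynman_mem α hd' (deformed_subset_allowed hα hd),
      innerPart_polygon hd', outerPart_polygon hd', mul_assoc]
  rw [Finset.sum_congr rfl h1, Finset.sum_comm' (t' := feynman α (polygon α))
    (s' := fun T => T ∩ deformed α) (by
      intro d T
      simp only [Finset.mem_filter, Finset.mem_inter]
      tauto), Finset.sum_congr rfl fun T hT => sum_residues hα hX h h0 hne hT,
    Finset.sum_sub_distrib, ← Finset.mul_sum, sum_leadingCoeff hα, mul_zero, sub_zero]
  rfl

end

end BiColor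

namespace BiColor

section

open Filter Topology

/-! Residues at infinity -/

/-- The integral is the same over all large circles, while the bound `2πR · sup ‖f‖` tends to `0`
because `z f(z)` does. -/
lemma hasResidueAtInfinity_zero {f : ℂ → ℂ}
    (hd : ∀ᶠ z in Bornology.cobounded ℂ, DifferentiableAt ℂ f z)
    (hf : Tendsto (fun z => z * f z) (Bornology.cobounded ℂ) (𝓝 0)) :
    HasResidueAtInfinity f 0 := by
  obtain ⟨r, -, hr⟩ := (Metric.hasBasis_cobounded_compl_closedBall (0 : ℂ)).eventually_iff.1 hd
  have hdiff : ∀ z : ℂ, r < ‖z‖ → DifferentiableAt ℂ f z := fun z hz => hr (by simpa using hz)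
  filter_upwards [eventually_gt_atTop (max r 0)] with R hR
  have hR0 : 0 < R := (le_max_right _ _).trans_lt hR
  have hRr : r < R := (le_max_left _ _).trans_lt hR
  refine ⟨ContinuousOn.circleIntegrable hR0.le fun z hz => ?_, ?_⟩
  · refine (hdiff z ?_).continuousAt.continuousWithinAt
    rw [mem_sphere_zero_iff_norm] at hz
    rwa [hz]
  suffices h : (∮ z in C(0, R), f z) = 0 by rw [h, mul_zero]
  rw [← norm_le_zero_iff]
  refine le_of_forall_pos_le_add fun ε hε => ?_
  obtain ⟨r', -, hr'⟩ := (Metric.hasBasis_cobounded_compl_closedBall (0 : ℂ)).eventually_iff.1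
    (hf.eventually (Metric.closedBall_mem_nhds 0 (by positivity : 0 < ε / (2 * Real.pi))))
  obtain ⟨R', hRR', hr'R'⟩ : ∃ R', R ≤ R' ∧ r' < R' :=
    ⟨max R (r' + 1), le_max_left _ _, by have := le_max_right R (r' + 1); linarith⟩
  have hR'0 : 0 < R' := hR0.trans_le hRR'
  have heq : (∮ z in C(0, R), f z) = ∮ z in C(0, R'), f z := by
    refine (Complex.circleIntegral_eq_of_differentiable_on_annulus_off_countable hR0 hRR'
      Set.countable_empty (fun z hz => ?_) fun z hz => ?_).symm
    · refine (hdiff z ?_).continuousAt.continuousWithinAt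
      have h1 := hz.2
      rw [mem_ball_zero_iff, not_lt] at h1
      linarith
    · refine hdiff z ?_
      have h1 := hz.1.2
      rw [mem_closedBall_zero_iff, not_le] at h1
      linarith
  rw [heq, zero_add]
  have hb : ∀ z ∈ Metric.sphere (0 : ℂ) R', ‖f z‖ ≤ ε / (2 * Real.pi) / R' := fun z hz => by
    rw [mem_sphere_zero_iff_norm] at hz
    have h1 : ‖z * f z‖ ≤ ε / (2 * Real.pi) := by
      have := hr' (x := z) (by simpa [hz] using hr'R')
      simpa using this
    rw [norm_mul, hz] at h1
    rw [le_div_iff₀ hR'0, mul_comm]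
    exact h1
  refine (circleIntegral.norm_integral_le_of_norm_le_const hR'0.le hb).trans (le_of_eq ?_)
  have := Real.pi_pos
  field_simp

lemma tendsto_affine_cobounded {p q : ℂ} (hp : p ≠ 0) :
    Tendsto (fun z : ℂ => p * z + q) (Bornology.cobounded ℂ) (Bornology.cobounded ℂ) := by
  rw [← tendsto_norm_atTop_iff_cobounded]
  have h : Tendsto (fun z : ℂ => ‖p‖ * ‖z‖ - ‖q‖) (Bornology.cobounded ℂ) atTop :=
    tendsto_atTop_add_const_right _ _
      (tendsto_norm_cobounded_atTop.const_mul_atTop (norm_pos_iff.2 hp))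
  refine tendsto_atTop_mono (fun z => ?_) h
  have := norm_sub_norm_le (p * z) (-q)
  rw [norm_neg, norm_mul, sub_neg_eq_add] at this
  exact this

lemma tendsto_inv_affine {p q : ℂ} (hp : p ≠ 0) :
    Tendsto (fun z : ℂ => (p * z + q)⁻¹) (Bornology.cobounded ℂ) (𝓝 0) :=
  tendsto_inv₀_cobounded.comp (tendsto_affine_cobounded hp)

lemma tendsto_mul_inv_affine {p q : ℂ} (hp : p ≠ 0) :
    Tendsto (fun z : ℂ => z * (p * z + q)⁻¹) (Bornology.cobounded ℂ) (𝓝 p⁻¹) := by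
  have h := ((tendsto_inv_affine (q := q) hp).const_mul (-q / p)).const_add p⁻¹
  rw [mul_zero, add_zero] at h
  refine h.congr' ?_
  have hne := (tendsto_affine_cobounded (q := q) hp).eventually (Bornology.eventually_ne_cobounded 0)
  filter_upwards [hne] with z hz
  field_simp
  ring

variable {α : List Block} {b : ℕ × ℕ → ℂ} {c : Interval × Interval → ℂ}

lemma IsShift.eq_affine (hα : SecondIsPair α) {X : ℕ × ℕ → ℂ} (hX : X ∈ subspace α b c)
    {Xhat : ℂ → ℕ × ℕ → ℂ} (h : IsShift α b c X Xhat) {d : ℕ × ℕ} (hd : d ∈ deformed α) (z : ℂ) :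
    Xhat z d = lam α d * X (shiftVar α) * z + (X d - lam α d * X (shiftVar α)) := by
  rw [h.eq_of_mem hα hX z hd]
  ring

/-- One deformed propagator absorbs the factor `z`; every further one tends to `0`, and the
undeformed ones are constant. The limit is therefore nonzero only if there is exactly one. -/
lemma tendsto_mul_diagram (hα : SecondIsPair α) {X : ℕ × ℕ → ℂ} (hX : X ∈ subspace α b c)
    {Xhat : ℂ → ℕ × ℕ → ℂ} (h : IsShift α b c X Xhat) (hs : X (shiftVar α) ≠ 0)
    {T : Finset (ℕ × ℕ)} (hT : T ∈ feynman α (polygon α)) :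
    Tendsto (fun z => z * ∏ d ∈ T, (Xhat z d)⁻¹) (Bornology.cobounded ℂ)
      (𝓝 ((X (shiftVar α))⁻¹ * leadingCoeff α X T)) := by
  obtain ⟨f, hf⟩ := inter_deformed_nonempty hα hT
  have hl : ∀ d ∈ T ∩ deformed α, (lam α d : ℂ) * X (shiftVar α) ≠ 0 := fun d hd =>
    mul_ne_zero (Int.cast_ne_zero.2 (lam_ne_zero hα (Finset.mem_inter.1 hd).2)) hs
  have h1 : ∀ z, z * ∏ d ∈ T, (Xhat z d)⁻¹ = (z * (Xhat z f)⁻¹) *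
      (∏ d ∈ (T ∩ deformed α).erase f, (Xhat z d)⁻¹) * ∏ d ∈ T \ deformed α, (X d)⁻¹ := fun z => by
    have h2 : ∏ d ∈ T \ deformed α, (Xhat z d)⁻¹ = ∏ d ∈ T \ deformed α, (X d)⁻¹ :=
      Finset.prod_congr rfl fun d hd => by
        rw [h.eq_of_notMem hα hX z (Finset.mem_sdiff.1 hd).2]
    rw [← Finset.prod_inter_mul_prod_sdiff T (deformed α), ← Finset.mul_prod_erase _ _ hf, h2]
    ring
  have h2 : Tendsto (fun z => z * (Xhat z f)⁻¹) (Bornology.cobounded ℂ)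
      (𝓝 ((lam α f : ℂ) * X (shiftVar α))⁻¹) := by
    simp only [h.eq_affine hα hX (Finset.mem_inter.1 hf).2]
    exact tendsto_mul_inv_affine (hl f hf)
  have h3 : Tendsto (fun z => ∏ d ∈ (T ∩ deformed α).erase f, (Xhat z d)⁻¹)
      (Bornology.cobounded ℂ) (𝓝 (∏ d ∈ (T ∩ deformed α).erase f, (0 : ℂ))) := by
    refine tendsto_finsetProd _ fun d hd => ?_
    have hd' := Finset.mem_of_mem_erase hd
    simp only [h.eq_affine hα hX (Finset.mem_inter.1 hd').2]
    exact tendsto_inv_affine (hl d hd')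
  simp only [h1]
  convert (h2.mul h3).mul_const (∏ d ∈ T \ deformed α, (X d)⁻¹) using 2
  rw [leadingCoeff, Finset.prod_const, Finset.card_erase_of_mem hf]
  split_ifs with hcard
  · obtain ⟨g, hg⟩ := Finset.card_eq_one.1 hcard
    rw [hg, Finset.mem_singleton] at hf
    rw [hg, hf]
    simp
    ring
  · have := Finset.card_pos.2 ⟨f, hf⟩
    rw [zero_pow (by omega)]
    ring

theorem tendsto_mul_amp (hα : SecondIsPair α) {X : ℕ × ℕ → ℂ} (hX : X ∈ subspace α b c)
    {Xhat : ℂ → ℕ × ℕ → ℂ} (h : IsShift α b c X Xhat) (hs : X (shiftVar α) ≠ 0) :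
    Tendsto (fun z => z * amp α (polygon α) (Xhat z)) (Bornology.cobounded ℂ) (𝓝 0) := by
  have := tendsto_finsetSum (feynman α (polygon α)) fun T hT =>
    tendsto_mul_diagram hα hX h hs hT
  rw [← Finset.mul_sum, sum_leadingCoeff hα, mul_zero] at this
  simpa only [amp, Finset.mul_sum] using this

theorem hasResidueAtInfinity_amp (hα : SecondIsPair α) {X : ℕ × ℕ → ℂ}
    (hX : X ∈ subspace α b c) {Xhat : ℂ → ℕ × ℕ → ℂ} (h : IsShift α b c X Xhat)
    (h0 : ∀ d ∈ allowed α, X d ≠ 0) :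
    HasResidueAtInfinity (fun z => z / (z - 1) * amp α (polygon α) (Xhat z)) 0 := by
  have hs : X (shiftVar α) ≠ 0 := h0 _ (deformed_subset_allowed hα (shiftVar_mem_deformed hα))
  have hl : ∀ d ∈ deformed α, (lam α d : ℂ) * X (shiftVar α) ≠ 0 := fun d hd =>
    mul_ne_zero (Int.cast_ne_zero.2 (lam_ne_zero hα hd)) hs
  have hne : ∀ᶠ z in Bornology.cobounded ℂ, ∀ d ∈ deformed α, Xhat z d ≠ 0 := by
    rw [Filter.eventually_all_finset]
    intro d hd
    simp only [h.eq_affine hα hX hd]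
    exact (tendsto_affine_cobounded (hl d hd)).eventually (Bornology.eventually_ne_cobounded 0)
  refine hasResidueAtInfinity_zero ?_ ?_
  · filter_upwards [hne, Bornology.eventually_ne_cobounded 1] with z hz hz1
    have h1 : z - 1 ≠ 0 := sub_ne_zero.2 hz1
    have hXd : ∀ d, DifferentiableAt ℂ (fun z => Xhat z d) z := fun d => by
      simp only [h.eq hα hX]
      fun_prop
    refine DifferentiableAt.mul (DifferentiableAt.div (by fun_prop) (by fun_prop) h1) ?_
    unfold amp
    refine DifferentiableAt.fun_sum fun T hT => ?_
    refine DifferentiableAt.fun_finsetProd fun d hd => ?_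
    refine DifferentiableAt.fun_inv (hXd d) ?_
    by_cases hd' : d ∈ deformed α
    · exact hz d hd'
    · rw [h.eq_of_notMem hα hX z hd']
      exact h0 d ((mem_feynman.1 hT).2.1 hd)
  -- The factor `z / (z - 1)` tends to `1`, so it does not affect the decay.
  · have h1 := (tendsto_mul_inv_affine (p := 1) (q := -1) one_ne_zero).mul
      (tendsto_mul_amp hα hX h hs)
    rw [mul_zero] at h1
    refine h1.congr fun z => ?_
    rw [one_mul, ← sub_eq_add_neg]
    ring

end

end BiColor

namespace BiColor

section

/-! Boundedness of edges -/

variable {α : List Block} {b : ℕ × ℕ → ℝ} {c : Interval × Interval → ℝ}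

/-- The edge of the polygon between `r₂` and `l₁` gives a deformed propagator with prefactor
`-1`. -/
lemma exists_lam_eq_neg_one (hα : SecondIsPair α) : ∃ g ∈ deformed α, lam α g = -1 := by
  have hs := hα.spec
  have hd : IsDiag α (nx α 3 - 1) (numPts α + 1) := by
    unfold IsDiag
    omega
  have hm : chord (numPts α) (nx α 3 - 1) (numPts α + 1) ∈ deformed α := by
    rw [chord_mem_deformed hα hd, nd_last]
    omega
  refine ⟨_, hm, ?_⟩
  rw [lam_chord hα hd hm, shiftCoeff, if_neg (by omega), if_pos]
  rw [nd_last]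
  omega

lemma mem_span_of_finrank_eq_one {V : Type*} [AddCommGroup V] [Module ℝ V] {S : Submodule ℝ V}
    (h : Module.finrank ℝ S = 1) {v w : V} (hv : v ∈ S) (hv0 : v ≠ 0) (hw : w ∈ S) :
    ∃ t : ℝ, t • v = w := by
  obtain ⟨t, ht⟩ := (finrank_eq_one_iff_of_nonzero' (⟨v, hv⟩ : S)
    (fun h => hv0 (congrArg Subtype.val h))).1 h ⟨w, hw⟩
  exact ⟨t, congrArg Subtype.val ht⟩

/-- Along the line the point moves in the direction `shiftDir`, because moving so leaves every
`X_t`, `t ∈ T`, equal to zero. Nonnegativity of `X_{3,l₃}` (slope `1`) and of a variable with slope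
`-1` bounds the parameter on both sides. -/
theorem edge_bounded (hα : SecondIsPair α) {T : Finset (ℕ × ℕ)} (hT : ∀ d ∈ T, d ∉ deformed α)
    (h : Module.finrank ℝ (vectorSpan ℝ {X | X ∈ subspace α b c ∧ ∀ d ∈ T, X d = 0}) = 1) :
    ∃ M : ℝ, ∀ X ∈ openAssociahedron α b c, (∀ d ∈ T, X d = 0) →
      ∀ d ∈ diagonals α, X d ≤ M := by
  set E := {X | X ∈ subspace α b c ∧ ∀ d ∈ T, X d = 0} with hE
  rcases E.eq_empty_or_nonempty with h0 | ⟨X₀, hX₀⟩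
  · exact ⟨0, fun X hX hXT => by
      have : X ∈ E := ⟨hX.1, hXT⟩
      rw [h0] at this
      exact this.elim⟩
  have hmem : ∀ t : ℝ, (fun d => X₀ d + t * shiftDir α d) ∈ E := fun t =>
    ⟨add_smul_shiftDir_mem_subspace hα hX₀.1 t, fun d hd => by
      simp only
      rw [hX₀.2 d hd, shiftDir_eq_zero (hT d hd)]
      simp⟩
  have hv : (fun d => (shiftDir α d : ℝ)) ∈ vectorSpan ℝ E := by
    have := vsub_mem_vectorSpan ℝ (hmem 1) hX₀
    convert this using 1
    ext d
    simp
  have hs1 : shiftDir α (shiftVar α) = 1 := by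
    rw [shiftDir, if_pos (shiftVar_mem_deformed hα), lam_shiftVar hα]
  obtain ⟨g, hg, hlg⟩ := exists_lam_eq_neg_one hα
  have hg1 : shiftDir α g = -1 := by rw [shiftDir, if_pos hg, hlg]
  have hline : ∀ X ∈ E, ∃ t : ℝ, ∀ d, X d = X₀ d + t * shiftDir α d := fun X hX => by
    obtain ⟨t, ht⟩ := mem_span_of_finrank_eq_one h hv (fun h => by
      have := congrFun h (shiftVar α)
      simp [hs1] at this) (vsub_mem_vectorSpan ℝ hX hX₀)
    refine ⟨t, fun d => ?_⟩
    have := congrFun ht d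
    simp only [Pi.smul_apply, smul_eq_mul, vsub_eq_sub, Pi.sub_apply] at this
    linarith
  -- A sum over all diagonals of nonnegative bounds serves as one bound for all of them.
  refine ⟨∑ d ∈ diagonals α, (|X₀ d| + (|X₀ (shiftVar α)| + |X₀ g|) * |(shiftDir α d : ℝ)|),
    fun X hX hXT d hd => ?_⟩
  obtain ⟨t, ht⟩ := hline X ⟨hX.1, hXT⟩
  have h1 := hX.2 _ (deformed_subset_diagonals (shiftVar_mem_deformed hα))
  have h2 := hX.2 _ (deformed_subset_diagonals hg)
  rw [ht, hs1] at h1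
  rw [ht, hg1] at h2
  push_cast at h1 h2
  have h3 : |t| ≤ |X₀ (shiftVar α)| + |X₀ g| := by
    have h4 := le_abs_self (X₀ (shiftVar α))
    have h5 := le_abs_self (X₀ g)
    have h6 := abs_nonneg (X₀ (shiftVar α))
    have h7 := abs_nonneg (X₀ g)
    rw [abs_le]
    constructor <;> linarith
  have hsum : ∀ d ∈ diagonals α, |X₀ d| + (|X₀ (shiftVar α)| + |X₀ g|) * |(shiftDir α d : ℝ)| ≤
      ∑ d ∈ diagonals α, (|X₀ d| + (|X₀ (shiftVar α)| + |X₀ g|) * |(shiftDir α d : ℝ)|) := by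
    generalize diagonals α = A
    intro d hd
    refine Finset.single_le_sum
      (f := fun d => |X₀ d| + (|X₀ (shiftVar α)| + |X₀ g|) * |(shiftDir α d : ℝ)|)
      (fun d _ => ?_) hd
    positivity
  calc X d = X₀ d + t * shiftDir α d := ht d
    _ ≤ |X₀ d| + |t| * |(shiftDir α d : ℝ)| := by
        rw [← abs_mul]
        exact add_le_add (le_abs_self _) (le_abs_self _)
    _ ≤ |X₀ d| + (|X₀ (shiftVar α)| + |X₀ g|) * |(shiftDir α d : ℝ)| :=
        add_le_add le_rfl (mul_le_mul_of_nonneg_right h3 (abs_nonneg _))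
    _ ≤ _ := hsum d hd

end

end BiColor
theorem mainTheorem2 {K : Type*} [Field K] [CharZero K]
    (α : List BiColor.Block) (S₂ : List BiColor.Block) (B₃ : BiColor.Block)
    (Bs : List BiColor.Block) (hα : α = BiColor.Block.pair S₂ :: B₃ :: Bs) :
    -- the preferred basis parametrizes the subspace, whatever the constants are
    (BiColor.preferredBasis α ⊆ BiColor.allowed α ∧
      (BiColor.preferredBasis α).card + 3 = BiColor.numPts α ∧
      BiColor.shiftVar α ∈ BiColor.preferredBasis α ∧
      ∀ (b : ℕ × ℕ → K) (c : BiColor.Interval × BiColor.Interval → K) (y : ℕ × ℕ → K),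
        ∃! X : ℕ × ℕ → K, X ∈ BiColor.subspace α b c ∧
          ∀ d ∈ BiColor.preferredBasis α, X d = y d) ∧
    -- `F` is the set of deformed propagators, with prefactors `λ`
    (BiColor.deformed α ⊆ BiColor.allowed α ∧
      BiColor.shiftVar α ∈ BiColor.deformed α ∧
      (∀ d ∈ BiColor.deformed α, BiColor.lam α d ≠ 0) ∧
      ∀ (b : ℕ × ℕ → K) (c : BiColor.Interval × BiColor.Interval → K),
        ∀ X ∈ BiColor.subspace α b c, ∀ Xhat, BiColor.IsShift α b c X Xhat →
          (∀ z, ∀ d ∈ BiColor.deformed α,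
            Xhat z d = X d - (BiColor.lam α d : K) * (1 - z) * X (BiColor.shiftVar α)) ∧
          (∀ z, ∀ d ∈ BiColor.allowed α, d ∉ BiColor.deformed α → Xhat z d = X d) ∧
          (X (BiColor.shiftVar α) ≠ 0 →
            ∀ d ∈ BiColor.deformed α, ∀ e ∈ BiColor.deformed α,
              Xhat (BiColor.pole α X d) e
                = X e - (BiColor.lam α e : K) / (BiColor.lam α d : K) * X d)) ∧
    -- the recursion, away from the zeros of the denominators of its terms
    (∀ (b : ℕ × ℕ → K) (c : BiColor.Interval × BiColor.Interval → K),
      ∀ X ∈ BiColor.subspace α b c, ∀ Xhat, BiColor.IsShift α b c X Xhat →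
        (∀ d ∈ BiColor.allowed α, X d ≠ 0) →
        (∀ d ∈ BiColor.deformed α, ∀ e ∈ BiColor.deformed α, d ≠ BiColor.shiftVar α → e ≠ d →
          ¬ BiColor.Crosses d e → Xhat (BiColor.pole α X d) e ≠ 0) →
        BiColor.amp α (BiColor.polygon α) X =
          ∑ d ∈ BiColor.deformed α,
            (1 / X d - 1 / ((BiColor.lam α d : K) * X (BiColor.shiftVar α))) *
              BiColor.amp α (BiColor.leftVertices d) (Xhat (BiColor.pole α X d)) *
              BiColor.amp α (BiColor.rightVertices α d) (Xhat (BiColor.pole α X d))) ∧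
    -- no pole at infinity
    (∀ (b : ℕ × ℕ → ℂ) (c : BiColor.Interval × BiColor.Interval → ℂ),
      ∀ X ∈ BiColor.subspace α b c, ∀ Xhat, BiColor.IsShift α b c X Xhat →
        (∀ d ∈ BiColor.allowed α, X d ≠ 0) →
        Filter.Tendsto (fun z : ℂ => z * BiColor.amp α (BiColor.polygon α) (Xhat z))
            (Bornology.cobounded ℂ) (nhds 0) ∧
          BiColor.HasResidueAtInfinity
            (fun z : ℂ => z / (z - 1) * BiColor.amp α (BiColor.polygon α) (Xhat z)) 0) ∧
    -- an edge on `n - 4` compatible undeformed facets that has one endpoint on a deformed facet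
    -- has its other endpoint on an allowed facet, with the opposite prefactor
    (∀ T ⊆ BiColor.allowed α \ BiColor.deformed α, T.card + 4 = BiColor.numPts α →
      (∀ d ∈ T, ∀ e ∈ T, ¬ BiColor.Crosses d e) →
      ∀ f ∈ BiColor.deformed α, (∀ d ∈ T, ¬ BiColor.Crosses d f) →
        ∃ g ∈ BiColor.deformed α, g ≠ f ∧ (∀ d ∈ T, ¬ BiColor.Crosses d g) ∧
          BiColor.lam α g = -BiColor.lam α f) ∧
    -- every edge of the open associahedron cut out by `n - 4` undeformed facets is bounded
    (∀ (b : ℕ × ℕ → ℝ) (c : BiColor.Interval × BiColor.Interval → ℝ),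
      (∀ d, 0 < b d) → (∀ h, 0 < c h) →
      ∀ T ⊆ BiColor.allowed α \ BiColor.deformed α, T.card + 4 = BiColor.numPts α →
        Module.finrank ℝ
          (vectorSpan ℝ {X | X ∈ BiColor.subspace α b c ∧ ∀ d ∈ T, X d = 0}) = 1 →
        ∃ M : ℝ, ∀ X ∈ BiColor.openAssociahedron α b c, (∀ d ∈ T, X d = 0) →
          ∀ d ∈ BiColor.diagonals α, X d ≤ M) := by
  have hS : BiColor.SecondIsPair α := ⟨S₂, B₃, Bs, hα⟩
  have hn : 3 ≤ BiColor.numPts α := by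
    have := hS.spec
    omega
  refine ⟨⟨BiColor.basis_subset_allowed, BiColor.card_preferredBasis hn,
      BiColor.shiftVar_mem_basis hS, BiColor.existsUnique_mem_subspace⟩,
    ⟨BiColor.deformed_subset_allowed hS, BiColor.shiftVar_mem_deformed hS,
      fun d hd => BiColor.lam_ne_zero hS hd, fun b c X hX Xhat h =>
      ⟨fun z d hd => h.eq_of_mem hS hX z hd, fun z d _ hd => h.eq_of_notMem hS hX z hd,
        fun hs d hd e he => h.pole_eq hS hX hs hd he⟩⟩,
    fun b c X hX Xhat h h0 hne => BiColor.amp_eq_sum hS hX h h0 hne,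
    fun b c X hX Xhat h h0 =>
      ⟨BiColor.tendsto_mul_amp hS hX h (h0 _ (BiColor.deformed_subset_allowed hS
        (BiColor.shiftVar_mem_deformed hS))), BiColor.hasResidueAtInfinity_amp hS hX h h0⟩,
    fun T hT hcard hc f hf hfT => BiColor.exists_opposite hS hT hcard hc hf hfT,
    fun b c _ _ T hT _ h =>
      BiColor.edge_bounded hS (fun d hd => (Finset.mem_sdiff.1 (hT hd)).2) h⟩
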